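/- A simplicial tree $T$ (a connected graph without cycles, not necessarily locally finite) is regarded as a metric space with its simplicial metric, i.e. the length metric on its geometric realization in which every edge has length $1$; a product of trees carries the $\ell_1$-product metric, i.e. the sum of the distances in the factors. A tree $T$ with a base vertex $t_0$ is called exponentially branching if there is a number $\sigma>0$ such that every vertex $t$ of $T$ has more than $e^{\sigma d(t,t_0)}$ neighbours (possibly infinitely many). Let $T$ be an exponentially branching tree and let $n\ge 2$ be an integer. Then there exists a bilipschitz embedding $\psi:\mathbb{H}^n\to T\times\cdots\times T$ of hyperbolic $n$-space $\mathbb{H}^n$ into the $2(n-1)$-fold product of $T$; that is, there are a map $\psi$ and a constant $L\ge 1$ such that $\frac1L\,d(x,y)\le d(\psi(x),\psi(y))\le L\,d(x,y)$ for all $x,y\in\mathbb{H}^n$. -/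

import Mathlib

open scoped NNReal ENNReal

/-! ### Hyperbolic space -/

/-- The set underlying hyperbolic `n`-space, for `n ≥ 1`, in the upper half-space model
`ℝⁿ⁻¹ × (0, ∞)`: a point has a horizontal part in Euclidean `ℝⁿ⁻¹` and a positive height. -/
@[ext]
structure HyperbolicSpace (n : ℕ) where
  /-- The horizontal coordinates. -/
  horiz : EuclideanSpace ℝ (Fin (n - 1))
  /-- The height above the boundary. -/
  height : ℝ
  height_pos : 0 < height

namespace HyperbolicSpace

/-- The hyperbolic distance (curvature `-1`) of the upper half-space model,
`cosh d(p, q) = 1 + |p - q|² / (2 h(p) h(q))`, where `|p - q|` is the Euclidean distance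
and `h` is the height. -/
noncomputable instance (n : ℕ) : Dist (HyperbolicSpace n) where
  dist p q := Real.arcosh
    (1 + (‖p.horiz - q.horiz‖ ^ 2 + (p.height - q.height) ^ 2) / (2 * p.height * q.height))

theorem dist_def {n : ℕ} (p q : HyperbolicSpace n) : dist p q = Real.arcosh
    (1 + (‖p.horiz - q.horiz‖ ^ 2 + (p.height - q.height) ^ 2) / (2 * p.height * q.height)) :=
  rfl

theorem one_le_aux {a b : ℝ} (ha : 0 < a) (hb : 0 < b) (s : ℝ) :
    1 ≤ 1 + (s ^ 2 + (a - b) ^ 2) / (2 * a * b) := by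
  have : 0 ≤ (s ^ 2 + (a - b) ^ 2) / (2 * a * b) := by positivity
  linarith

theorem arcosh_eq_dist (x s : ℝ) {a b : ℝ} (ha : 0 < a) (hb : 0 < b) :
    Real.arcosh (1 + (s ^ 2 + (a - b) ^ 2) / (2 * a * b)) =
      dist (⟨⟨x, a⟩, ha⟩ : UpperHalfPlane) ⟨⟨x + s, b⟩, hb⟩ := by
  rw [← Real.arcosh_cosh (dist_nonneg (x := (⟨⟨x, a⟩, ha⟩ : UpperHalfPlane))
    (y := ⟨⟨x + s, b⟩, hb⟩)), UpperHalfPlane.cosh_dist]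
  congr 3
  simp only [Complex.dist_eq, Complex.sq_norm, Complex.normSq_apply, Complex.sub_re,
    Complex.sub_im]
  ring

noncomputable instance (n : ℕ) : MetricSpace (HyperbolicSpace n) where
  dist_self p := by simp [dist_def]
  dist_comm p q := by
    simp only [dist_def]
    rw [norm_sub_rev, ← neg_sub q.height, neg_sq, mul_right_comm]
  dist_triangle p q r := by
    have hp := p.height_pos
    have hq := q.height_pos
    have hr := r.height_pos
    have key := dist_triangle (⟨⟨0, p.height⟩, hp⟩ : UpperHalfPlane)
      ⟨⟨0 + ‖p.horiz - q.horiz‖, q.height⟩, hq⟩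
      ⟨⟨0 + ‖p.horiz - q.horiz‖ + ‖q.horiz - r.horiz‖, r.height⟩, hr⟩
    rw [← arcosh_eq_dist, ← arcosh_eq_dist, add_assoc, ← arcosh_eq_dist] at key
    refine le_trans ?_ key
    have h1 := one_le_aux hp hr ‖p.horiz - r.horiz‖
    have h2 := one_le_aux hp hr (‖p.horiz - q.horiz‖ + ‖q.horiz - r.horiz‖)
    rw [dist_def, Real.arcosh_le_arcosh (by linarith) (by linarith)]
    have := norm_sub_le_norm_sub_add_norm_sub p.horiz q.horiz r.horiz
    gcongr
  eq_of_dist_eq_zero {p q} h := by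
    have hp := p.height_pos
    have hq := q.height_pos
    rw [dist_def, Real.arcosh_eq_zero_iff (one_le_aux hp hq _), add_eq_left,
      div_eq_zero_iff, or_iff_left (by positivity)] at h
    have h1 : ‖p.horiz - q.horiz‖ ^ 2 = 0 := by nlinarith [sq_nonneg (p.height - q.height)]
    have h2 : (p.height - q.height) ^ 2 = 0 := by nlinarith
    exact HyperbolicSpace.ext (sub_eq_zero.1 (norm_eq_zero.1 (pow_eq_zero_iff two_ne_zero |>.1 h1)))
      (sub_eq_zero.1 (pow_eq_zero_iff two_ne_zero |>.1 h2))

end HyperbolicSpace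

/-! ### Graphs and trees as metric spaces -/

namespace SimpleGraph

variable {V : Type*}

/-- In barycentric coordinates: the closed edge joining two adjacent vertices `u`, `v`,
consisting of the points `(1 - t) u + t v` with `0 ≤ t ≤ 1`; for `u = v` it is the vertex `u`. -/
def cell (u v : V) : Set (V →₀ ℝ) :=
  segment ℝ (Finsupp.single u 1) (Finsupp.single v 1)

/-- The geometric realization of a graph: the union of its vertices and its closed edges, where
a point is given by its barycentric coordinates. -/
def Realization (G : SimpleGraph V) : Type _ :=
  {p : V →₀ ℝ // ∃ u v, (u = v ∨ G.Adj u v) ∧ p ∈ cell u v}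

/-- `G.PathOfLength p q ℓ`: there is a piecewise linear path of length `ℓ` from `p` to `q` in the
realization of `G`, each piece of which runs inside one closed edge. Every edge has length `1`, so
that two points of the edge `{u, v}` are joined by a piece of length
`|p u - q u| = |p v - q v|`. -/
inductive PathOfLength (G : SimpleGraph V) : G.Realization → G.Realization → ℝ≥0∞ → Prop
  | refl (p : G.Realization) : PathOfLength G p p 0
  | step {p q r : G.Realization} {ℓ : ℝ≥0∞} {u v : V} (huv : u = v ∨ G.Adj u v)
      (hp : p.1 ∈ cell u v) (hq : q.1 ∈ cell u v) (hqr : PathOfLength G q r ℓ) :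
      PathOfLength G p r (ENNReal.ofReal |p.1 u - q.1 u| + ℓ)

theorem sub_eq_of_mem_cell {u v w : V} {p q : V →₀ ℝ} (hp : p ∈ cell u v) (hq : q ∈ cell u v) :
    |p w - q w| ≤ |p u - q u| ∧ |p v - q v| = |p u - q u| := by
  classical
  obtain ⟨a, b, ha, hb, hab, rfl⟩ := hp
  obtain ⟨c, d, hc, hd, hcd, rfl⟩ := hq
  obtain rfl : b = 1 - a := by linarith
  obtain rfl : d = 1 - c := by linarith
  by_cases huv : u = v
  · subst huv
    simp only [← add_smul]
    simp
  · have e : |c - a| = |a - c| := abs_sub_comm c a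
    by_cases h1 : u = w
    · subst h1
      simp [huv, Ne.symm huv, e]
    · by_cases h2 : v = w
      · subst h2
        simp [huv, Ne.symm huv, e]
      · simp [h1, h2, huv, Ne.symm huv, e]

theorem PathOfLength.trans {G : SimpleGraph V} {p q r : G.Realization} {ℓ m : ℝ≥0∞}
    (h : G.PathOfLength p q ℓ) (h' : G.PathOfLength q r m) : G.PathOfLength p r (ℓ + m) := by
  induction h with
  | refl p => simpa using h'
  | step huv hp hq _ ih => rw [add_assoc]; exact .step huv hp hq (ih h')

theorem PathOfLength.symm {G : SimpleGraph V} {p q : G.Realization} {ℓ : ℝ≥0∞}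
    (h : G.PathOfLength p q ℓ) : G.PathOfLength q p ℓ := by
  induction h with
  | refl p => exact .refl p
  | step huv hp hq _ ih =>
    rw [add_comm, abs_sub_comm]
    have := PathOfLength.step huv hq hp (.refl _)
    rw [add_zero] at this
    exact ih.trans this

theorem PathOfLength.le {G : SimpleGraph V} {p q : G.Realization} {ℓ : ℝ≥0∞}
    (h : G.PathOfLength p q ℓ) (w : V) : ENNReal.ofReal |p.1 w - q.1 w| ≤ ℓ := by
  induction h with
  | refl p => simp
  | @step p q r ℓ u v huv hp hq _ ih =>
    calc ENNReal.ofReal |p.1 w - r.1 w|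
        ≤ ENNReal.ofReal (|p.1 w - q.1 w| + |q.1 w - r.1 w|) :=
          ENNReal.ofReal_le_ofReal (abs_sub_le _ _ _)
      _ = ENNReal.ofReal |p.1 w - q.1 w| + ENNReal.ofReal |q.1 w - r.1 w| :=
          ENNReal.ofReal_add (abs_nonneg _) (abs_nonneg _)
      _ ≤ _ := add_le_add (ENNReal.ofReal_le_ofReal (sub_eq_of_mem_cell hp hq).1) ih

/-- The simplicial metric on a graph: the length metric for which every edge has length `1`. It is
the infimum of the lengths of the paths joining two points (and infinite if there are none, which
does not happen in a connected graph). -/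
noncomputable instance (G : SimpleGraph V) : EMetricSpace G.Realization where
  edist p q := sInf {ℓ | G.PathOfLength p q ℓ}
  edist_self p := nonpos_iff_eq_zero.1 (sInf_le (PathOfLength.refl p))
  edist_comm p q := by
    congr 1
    ext ℓ
    exact ⟨PathOfLength.symm, PathOfLength.symm⟩
  edist_triangle p q r := by
    rw [ENNReal.sInf_add]
    refine le_iInf₂ fun ℓ hℓ => ?_
    rw [add_comm, ENNReal.sInf_add]
    refine le_iInf₂ fun m hm => ?_
    rw [add_comm]
    exact sInf_le (PathOfLength.trans hℓ hm)
  eq_of_edist_eq_zero {p q} h := by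
    refine Subtype.ext (Finsupp.ext fun w => ?_)
    have : ENNReal.ofReal |p.1 w - q.1 w| ≤ 0 := h ▸ le_sInf fun ℓ hℓ => hℓ.le w
    have := abs_nonpos_iff.1 (ENNReal.ofReal_eq_zero.1 (nonpos_iff_eq_zero.1 this))
    linarith

/-- A simplicial tree `G` with base vertex `t₀` is exponentially branching if there is `σ > 0` such
that every vertex `t` has more than `exp (σ d(t, t₀))` (possibly infinitely many) neighbours. -/
def IsExponentiallyBranching (G : SimpleGraph V) (t₀ : V) : Prop :=
  ∃ σ : ℝ, 0 < σ ∧ ∀ t : V,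
    ENNReal.ofReal (Real.exp (σ * G.dist t t₀)) < ((G.neighborSet t).encard : ℝ≥0∞)

end SimpleGraph

/-- A bilipschitz embedding: a map which distorts distances at most by constant factors, both from
above and from below. -/
def IsBilipschitzEmbedding {X Y : Type*} [PseudoEMetricSpace X] [PseudoEMetricSpace Y]
    (f : X → Y) : Prop :=
  (∃ K : ℝ≥0, LipschitzWith K f) ∧ ∃ K : ℝ≥0, AntilipschitzWith K f

/-! Projecting hyperbolic `n`-space to the `n - 1` half-planes given by one horizontal coordinate
and the height, the distance lies between the largest and the sum of the projected distances
(`coordDist_le`, `dist_le_sum_coordDist`). So it suffices to map the half-plane to two copies of the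
tree by a jointly bilipschitz map.

Cut the half-plane into layers of heights `3 ^ (-t)` with `k ≤ t ≤ k + 1`, and the top of layer `k`
into runs of length `3 ^ (-k)` centred at `m * 3 ^ (-k)`. Colour the run `(k, m)` by the parity of
`k + m`; the runs of each colour are the vertices of one forest. Along the top of the layer, the map
to the forest of the colour of the run rests at the vertex `(k, m)`, while the map to the other one
walks from the vertex of one neighbouring run to that of the other, through the centre `cen k m`.
When a run is divided in three, the outer thirds keep its colour and hang below its vertex; the
middle third has the other colour and hangs below the centre of the walk. This forces the recursion
of `par` and `cen`. A half-run is walked in one or two edges (`hl_eq`), so interpolation across the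
layers gives Lipschitz maps (`WordMap.edist_plane_le`).

For the lower bound, a point of a forest is replaced by the interpolated indicator function of the
vertices above it, and distances by ℓ¹ distances. If the functions of two points of the half-plane
are close in both forests, the points are close: `Close.same_layer` treats small distances,
`Close.exists_ancestor` large ones.

It remains to realize the forests in the given tree. Their vertices have infinitely many children,
whereas the branching of the tree may be finite and only grow exponentially. So a vertex is spelled
gradually: the letter of depth `a` contains digit `j` of the ancestor of depth `a - j`, that is `a`
digits of a fixed base. If two siblings share their first `t` digits, their rays separate `t` steps
late and at most `2 * t` is lost. The digits come from greedy colourings such that siblings sharing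
`t` digits have descendants only far from each other; then at least `4 * t` vertices of the other
colour separate the points (`separation_aux`). Hence the loss in one tree is at most half the ℓ¹
distance in the other (`WordMap.l1_le`), and the sum over both trees loses only a factor 2
(`WordMap.l1_add_le`). -/

/-! ### A combinatorial forest of ternary runs -/

namespace TernaryForest

/-- The index of the parent run: rounding of `n / 3`. -/
def up (n : ℤ) : ℤ := (n + 1) / 3

theorem up_mul (n : ℤ) : up (3 * n) = n := by unfold up; omega

theorem up_mul_add {ε : ℤ} (hε : ε = 1 ∨ ε = -1) (n : ℤ) : up (3 * n + ε) = n := by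
  unfold up; omega

theorem eq_up (n : ℤ) : n = 3 * up n ∨ n = 3 * up n + 1 ∨ n = 3 * up n + -1 := by
  unfold up; omega

theorem natAbs_up_lt {n : ℤ} (h : n ≠ 3 * up n) : (up n).natAbs < n.natAbs := by
  unfold up at *; omega

/-- The parent of a vertex, as a function of its level and its index. -/
def parAux (k m : ℤ) : ℤ × ℤ :=
  if m ≠ 3 * up m then (k - 1, up m)
  else if up m = 3 * up (up m) then (k - 2, up (up m))
  else parAux (k - 2) (up (up m) + (up m - 3 * up (up m)))
termination_by m.natAbs
decreasing_by
  unfold up at *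
  omega

/-- The parent of a vertex of the forest. -/
def par (v : ℤ × ℤ) : ℤ × ℤ := parAux v.1 v.2

/-- The central vertex of the run `m` on level `k`. -/
def cen (k m : ℤ) : ℤ × ℤ :=
  if m = 3 * up m then (k - 1, up m) else par (k - 1, up m + (m - 3 * up m))

theorem cen_mul (k m : ℤ) : cen k (3 * m) = (k - 1, m) := by
  simp [cen, up_mul]

theorem cen_mul_add {ε : ℤ} (hε : ε = 1 ∨ ε = -1) (k m : ℤ) :
    cen k (3 * m + ε) = par (k - 1, m + ε) := by
  have : ε ≠ 0 := by omega
  simp [cen, up_mul_add hε, this]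

theorem par_mul_add {ε : ℤ} (hε : ε = 1 ∨ ε = -1) (k m : ℤ) :
    par (k, 3 * m + ε) = (k - 1, m) := by
  have : ε ≠ 0 := by omega
  rw [par, parAux]
  simp [up_mul_add hε, this]

/-- Outer thirds hang below the vertex of the run, the middle third below the centre of the walk
along it. Thus `par` and `cen` call each other; `parAux` is this loop unrolled. -/
theorem par_mul (k m : ℤ) : par (k, 3 * m) = cen (k - 1) m := by
  rw [par, parAux]
  simp only [up_mul, cen, ne_eq, not_true_eq_false, if_false]
  split_ifs
  · simp; ring
  · rw [par]; congr 1; ring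

/-- Induction along the ternary expansion of the index. -/
theorem ternary_induction {P : ℤ → Prop} (h0 : ∀ m, P (3 * m))
    (h1 : ∀ m ε, (ε = 1 ∨ ε = -1) → P m → P (3 * m + ε)) (m : ℤ) : P m := by
  induction h : m.natAbs using Nat.strong_induction_on generalizing m with
  | _ N ih =>
    rcases eq_up m with h' | h' | h'
    · rw [h']; exact h0 _
    · rw [h']; exact h1 _ _ (Or.inl rfl) (ih _ (h ▸ natAbs_up_lt (by omega)) _ rfl)
    · rw [h']; exact h1 _ _ (Or.inr rfl) (ih _ (h ▸ natAbs_up_lt (by omega)) _ rfl)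


/-- Eliminates `cen` from the recursion. In the last clause the parent is inherited from a vertex
two levels up, which is why a vertex has infinitely many children. -/
theorem par_cases (P : ℤ → ℤ → ℤ × ℤ → Prop)
    (h0 : ∀ k m ε, (ε = 1 ∨ ε = -1) → P k (3 * m + ε) (k - 1, m))
    (h1 : ∀ k m, P k (3 * (3 * m)) (k - 2, m))
    (h2 : ∀ k m ε, (ε = 1 ∨ ε = -1) → P (k - 2) (m + ε) (par (k - 2, m + ε)) →
      P k (3 * (3 * m + ε)) (par (k - 2, m + ε))) (k m : ℤ) : P k m (par (k, m)) := by
  induction h : m.natAbs using Nat.strong_induction_on generalizing m k with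
  | _ N ih =>
    have key : ∀ ε n, (ε = 1 ∨ ε = -1) → m = 3 * n + ε → P k m (par (k, m)) := by
      rintro ε n hε rfl
      rw [par_mul_add hε]; exact h0 _ _ _ hε
    rcases eq_up m with h' | h' | h'
    · have key2 : ∀ ε n, (ε = 1 ∨ ε = -1) → m = 3 * (3 * n + ε) → P k m (par (k, m)) := by
        rintro ε n hε rfl
        have e : par (k, 3 * (3 * n + ε)) = par (k - 2, n + ε) := by
          rw [par_mul, cen_mul_add hε]; congr 2; ring
        rw [e]
        exact h2 _ _ _ hε (ih _ (by omega) _ _ rfl)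
      rcases eq_up (up m) with h'' | h'' | h''
      · rw [h', h'', par_mul, cen_mul]
        have : k - 1 - 1 = k - 2 := by ring
        rw [this]; exact h1 _ _
      · exact key2 _ _ (Or.inl rfl) (by rw [← h'']; exact h')
      · exact key2 _ _ (Or.inr rfl) (by rw [← h'']; exact h')
    · exact key _ _ (Or.inl rfl) h'
    · exact key _ _ (Or.inr rfl) h'

theorem par_fst_lt (v : ℤ × ℤ) : (par v).1 < v.1 := by
  obtain ⟨k, m⟩ := v
  refine par_cases (fun k m w => w.1 < k) ?_ ?_ ?_ k m
  · intro k m ε _; exact sub_one_lt k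
  · intro k m; exact sub_lt_self k two_pos
  · intro k m ε _ ih; exact ih.trans (sub_lt_self k two_pos)

/-- The parity of level plus index is the colour. As parents preserve it, there are two separate
forests. -/
theorem even_par (v : ℤ × ℤ) : Even ((par v).1 + (par v).2) ↔ Even (v.1 + v.2) := by
  obtain ⟨k, m⟩ := v
  apply par_cases (fun k m w => Even (w.1 + w.2) ↔ Even (k + m)) <;> intros <;>
    simp only [Int.even_iff] at * <;> omega

/-- Climbing leads to column 0, where `par_zero` takes over; the depth `dep` is defined along this
descent. -/
theorem natAbs_par_lt {v : ℤ × ℤ} (hv : v.2 ≠ 0) : (par v).2.natAbs < v.2.natAbs := by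
  obtain ⟨k, m⟩ := v
  refine par_cases (fun k m w => m ≠ 0 → w.2.natAbs < m.natAbs) ?_ ?_ ?_ k m hv
  · intros; simp; omega
  · intros; simp; omega
  · intro k m ε hε ih _
    by_cases h : m + ε = 0
    · rw [h]
      have := par_mul (k - 2) 0
      have h2 := cen_mul (k - 2 - 1) 0
      simp only [mul_zero] at this h2
      rw [this, h2]
      simp; omega
    · have := ih h
      omega

theorem par_zero (k : ℤ) : par (k, 0) = (k - 2, 0) := by
  have := par_mul k 0
  have h2 := cen_mul (k - 1) 0
  simp only [mul_zero] at this h2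
  rw [this, h2]
  congr 1; ring

theorem cen_fst_lt (k m : ℤ) : (cen k m).1 < k := by
  have := par_fst_lt (k + 1, 3 * m)
  rw [par_mul] at this
  unfold cen
  split_ifs
  · simp
  · exact (par_fst_lt _).trans (by simp)

/-- The centre is the parent of the middle child run, whose colour is opposite to that of the run.
-/
theorem even_cen (k m : ℤ) : Even ((cen k m).1 + (cen k m).2) ↔ ¬ Even (k + m) := by
  have := even_par (k + 1, 3 * m)
  rw [par_mul] at this
  simp only [add_sub_cancel_right] at this
  rw [this]
  simp only [Int.even_iff]; omega

/-! ### Descendants -/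

/-- `Above y v`: the vertex `v` is a descendant of `y` (or equal to it). -/
def Above (y v : ℤ × ℤ) : Prop := ∃ i : ℕ, par^[i] v = y

theorem Above.refl (y : ℤ × ℤ) : Above y y := ⟨0, rfl⟩

theorem above_iff {y v : ℤ × ℤ} : Above y v ↔ v = y ∨ Above y (par v) := by
  constructor
  · rintro ⟨_ | i, hi⟩
    · exact Or.inl hi
    · exact Or.inr ⟨i, hi⟩
  · rintro (rfl | ⟨i, hi⟩)
    · exact Above.refl _
    · exact ⟨i + 1, hi⟩

theorem Above.of_par {y v : ℤ × ℤ} (h : Above y (par v)) : Above y v := above_iff.2 (Or.inr h)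

theorem Above.trans {x y v : ℤ × ℤ} (h : Above x y) (h' : Above y v) : Above x v := by
  obtain ⟨i, rfl⟩ := h
  obtain ⟨j, rfl⟩ := h'
  exact ⟨i + j, Function.iterate_add_apply _ _ _ _⟩

theorem above_par (v : ℤ × ℤ) : Above (par v) v := ⟨1, rfl⟩

theorem Above.fst_le {y v : ℤ × ℤ} (h : Above y v) : y.1 ≤ v.1 := by
  obtain ⟨i, rfl⟩ := h
  induction i generalizing v with
  | zero => simp
  | succ i ih => exact (ih (v := par v)).trans (par_fst_lt v).le

theorem Above.eq_of_fst_le {y v : ℤ × ℤ} (h : Above y v) (h' : v.1 ≤ y.1) : v = y := by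
  rcases above_iff.1 h with h | h
  · exact h
  · have := h.fst_le
    have := par_fst_lt v
    omega

theorem Above.even_iff {y v : ℤ × ℤ} (h : Above y v) : Even (v.1 + v.2) ↔ Even (y.1 + y.2) := by
  obtain ⟨i, rfl⟩ := h
  induction i generalizing v with
  | zero => rfl
  | succ i ih => exact (even_par v).symm.trans (ih (v := par v))

theorem Above.par_of_ne {y v : ℤ × ℤ} (h : Above y v) (hne : v ≠ y) : Above y (par v) :=
  (above_iff.1 h).resolve_left hne

theorem Above.total {x y v : ℤ × ℤ} (hx : Above x v) (hy : Above y v) (h : x.1 ≤ y.1) :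
    Above x y := by
  obtain ⟨i, hi⟩ := hx
  induction i generalizing v with
  | zero =>
    obtain rfl : v = x := hi
    obtain rfl := hy.eq_of_fst_le h
    exact Above.refl _
  | succ i ih =>
    rcases above_iff.1 hy with rfl | hy
    · exact ⟨i + 1, hi⟩
    · exact ih hy hi

/-- A vertex has at most one ancestor with a given parent. -/
theorem Above.eq_of_par_eq {x y v : ℤ × ℤ} (hx : Above x v) (hy : Above y v)
    (h : par x = par y) : x = y := by
  wlog hle : x.1 ≤ y.1 generalizing x y
  · exact (this hy hx h.symm (by omega)).symm
  rcases above_iff.1 (hx.total hy hle) with h' | h'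
  · exact h'.symm
  · have := h'.fst_le
    have := par_fst_lt x
    rw [← h] at *
    omega

/-! ### The vertices on a run -/

/-- The vertices of both trees on the run `m` of level `k`. -/
def OnRun (k m : ℤ) (v : ℤ × ℤ) : Prop :=
  v = (k, m) ∨ (∃ ε : ℤ, (ε = 1 ∨ ε = -1) ∧ (v = (k, m + ε) ∨ v = par (k, m + ε))) ∨ v = cen k m

theorem OnRun.self (k m : ℤ) : OnRun k m (k, m) := Or.inl rfl

theorem OnRun.corner {ε : ℤ} (hε : ε = 1 ∨ ε = -1) (k m : ℤ) : OnRun k m (k, m + ε) :=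
  Or.inr (Or.inl ⟨ε, hε, Or.inl rfl⟩)

theorem OnRun.par_corner {ε : ℤ} (hε : ε = 1 ∨ ε = -1) (k m : ℤ) :
    OnRun k m (par (k, m + ε)) :=
  Or.inr (Or.inl ⟨ε, hε, Or.inr rfl⟩)

theorem OnRun.cen (k m : ℤ) : OnRun k m (cen k m) := Or.inr (Or.inr rfl)

theorem OnRun.fst_le {k m : ℤ} {v : ℤ × ℤ} (h : OnRun k m v) : v.1 ≤ k := by
  rcases h with rfl | ⟨ε, hε, rfl | rfl⟩ | rfl
  · exact le_rfl
  · exact le_rfl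
  · exact (par_fst_lt _).le
  · exact (cen_fst_lt _ _).le

/-- The outer vertices of a child run. -/
theorem par_outer {ε : ℤ} (hε : ε = 1 ∨ ε = -1) (k m : ℤ) :
    par (k + 1, 3 * m + 2 * ε) = (k, m + ε) := by
  have : 3 * m + 2 * ε = 3 * (m + ε) + -ε := by ring
  rw [this, par_mul_add (by omega)]
  simp

theorem par_child {ε : ℤ} (hε : ε = 1 ∨ ε = -1) (k m : ℤ) :
    par (k + 1, 3 * m + ε) = (k, m) := by
  rw [par_mul_add hε]; simp

theorem par_middle (k m : ℤ) : par (k + 1, 3 * m) = TernaryForest.cen k m := by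
  rw [par_mul]; simp

theorem cen_child {ε : ℤ} (hε : ε = 1 ∨ ε = -1) (k m : ℤ) :
    TernaryForest.cen (k + 1) (3 * m + ε) = par (k, m + ε) := by
  rw [cen_mul_add hε]; simp

theorem cen_middle (k m : ℤ) : TernaryForest.cen (k + 1) (3 * m) = (k, m) := by
  rw [cen_mul]; simp

/-- A child run sees only vertices of the parent run and new ones attached to those; this is checked
for each of the three thirds. By induction it carries `Above` from a deep run to its ancestors. -/
theorem onRun_heredity {k n : ℤ} {v : ℤ × ℤ} (h : OnRun (k + 1) n v) :
    OnRun k (up n) v ∨ v.1 = k + 1 ∧ OnRun k (up n) (par v) := by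
  have key : ∀ m ε, (ε = 1 ∨ ε = -1) → n = 3 * m + ε →
      OnRun k m v ∨ v.1 = k + 1 ∧ OnRun k m (par v) := by
    rintro m ε hε rfl
    rcases h with rfl | ⟨δ, hδ, h⟩ | rfl
    · right; rw [par_child hε]; exact ⟨rfl, OnRun.self _ _⟩
    · rcases hε with rfl | rfl <;> rcases hδ with rfl | rfl
      · have e : 3 * m + 1 + 1 = 3 * m + 2 * 1 := by ring
        rw [e, par_outer (by simp)] at h
        rcases h with rfl | rfl
        · right; rw [par_outer (by simp)]; exact ⟨rfl, OnRun.corner (by simp) _ _⟩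
        · left; exact OnRun.corner (by simp) _ _
      · have e : 3 * m + 1 + -1 = 3 * m := by ring
        rw [e, par_middle] at h
        rcases h with rfl | rfl
        · right; rw [par_middle]; exact ⟨rfl, OnRun.cen _ _⟩
        · left; exact OnRun.cen _ _
      · have e : 3 * m + -1 + 1 = 3 * m := by ring
        rw [e, par_middle] at h
        rcases h with rfl | rfl
        · right; rw [par_middle]; exact ⟨rfl, OnRun.cen _ _⟩
        · left; exact OnRun.cen _ _
      · have e : 3 * m + -1 + -1 = 3 * m + 2 * -1 := by ring
        rw [e, par_outer (by simp)] at h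
        rcases h with rfl | rfl
        · right; rw [par_outer (by simp)]; exact ⟨rfl, OnRun.corner (by simp) _ _⟩
        · left; exact OnRun.corner (by simp) _ _
    · left; rw [cen_child hε]; exact OnRun.par_corner hε _ _
  rcases eq_up n with h' | h' | h'
  · have : ∀ m, n = 3 * m → OnRun k m v ∨ v.1 = k + 1 ∧ OnRun k m (par v) := by
      rintro m rfl
      rcases h with rfl | ⟨δ, hδ, rfl | rfl⟩ | rfl
      · right; rw [par_middle]; exact ⟨rfl, OnRun.cen _ _⟩
      · right; rw [par_child hδ]; exact ⟨rfl, OnRun.self _ _⟩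
      · left; rw [par_child hδ]; exact OnRun.self _ _
      · left; rw [cen_middle]; exact OnRun.self _ _
    exact this _ h'
  · exact key _ _ (by simp) h'
  · exact key _ _ (by simp) h'

/-- The vertex of the run reappears as the centre of the middle third, a corner as the parent of the
outer corner of an outer third, the parent of a corner as the centre of an outer third, and the
centre as the parent of the inner corner of an outer third. -/
theorem OnRun.persist {k m : ℤ} {v : ℤ × ℤ} (h : OnRun k m v) :
    ∃ n, up n = m ∧ OnRun (k + 1) n v := by
  rcases h with rfl | ⟨ε, hε, rfl | rfl⟩ | rfl
  · refine ⟨3 * m, up_mul _, ?_⟩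
    rw [← cen_middle]; exact OnRun.cen _ _
  · refine ⟨3 * m + ε, up_mul_add hε _, ?_⟩
    rw [← par_outer hε]
    have : 3 * m + 2 * ε = 3 * m + ε + ε := by ring
    rw [this]; exact OnRun.par_corner hε _ _
  · refine ⟨3 * m + ε, up_mul_add hε _, ?_⟩
    rw [← cen_child hε]; exact OnRun.cen _ _
  · refine ⟨3 * m + 1, up_mul_add (by simp) _, ?_⟩
    rw [← par_middle]
    have := OnRun.par_corner (ε := -1) (by simp) (k + 1) (3 * m + 1)
    simpa using this

theorem OnRun.persist_iterate {k m : ℤ} {v : ℤ × ℤ} (h : OnRun k m v) (j : ℕ) :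
    ∃ n, up^[j] n = m ∧ OnRun (k + j) n v := by
  induction j with
  | zero => exact ⟨m, rfl, by simpa using h⟩
  | succ j ih =>
    obtain ⟨n, hn, hv⟩ := ih
    obtain ⟨n', hn', hv'⟩ := hv.persist
    refine ⟨n', by rw [Function.iterate_succ_apply, hn', hn], ?_⟩
    push_cast
    rwa [← add_assoc]

/-- A descendant of `y` on a deeper run comes from a descendant of `y` on the ancestors of the
run. -/
theorem exists_onRun_above {k n : ℤ} {y v : ℤ × ℤ} (j : ℕ) (hv : OnRun (k + j) n v)
    (hy : y.1 ≤ k) (h : Above y v) : ∃ u, OnRun k (up^[j] n) u ∧ Above y u := by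
  induction j generalizing n v with
  | zero => exact ⟨v, by simpa using hv, h⟩
  | succ j ih =>
    push_cast at hv
    rw [← add_assoc] at hv
    rw [Function.iterate_succ_apply]
    rcases onRun_heredity hv with h' | ⟨h1, h'⟩
    · exact ih h' h
    · refine ih h' (h.par_of_ne ?_)
      rintro rfl
      omega

/-- All vertices, of the right colour, under a run are descendants of the vertex of the run. -/
theorem OnRun.above {k n : ℤ} {v : ℤ × ℤ} (j : ℕ) (hv : OnRun (k + j) n v)
    (hc : Even (v.1 + v.2) ↔ Even (k + up^[j] n)) : Above (k, up^[j] n) v := by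
  induction j generalizing n v with
  | zero =>
    simp only [Nat.cast_zero, add_zero, Function.iterate_zero, id] at *
    rcases hv with rfl | ⟨ε, hε, rfl | rfl⟩ | rfl
    · exact Above.refl _
    · exfalso; simp only [Int.even_iff] at hc; omega
    · exfalso; rw [even_par] at hc; simp only [Int.even_iff] at hc; omega
    · exfalso; rw [even_cen] at hc; simp only [Int.even_iff] at hc; omega
  | succ j ih =>
    push_cast at hv
    rw [← add_assoc] at hv
    rw [Function.iterate_succ_apply] at *
    rcases onRun_heredity hv with h' | ⟨h1, h'⟩
    · exact ih h' hc
    · exact (ih h' (by rw [even_par]; exact hc)).of_par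

/-- No vertex under a run is a descendant of the vertex of a run which is not adjacent. -/
theorem OnRun.not_above {k n m : ℤ} {v : ℤ × ℤ} (j : ℕ) (hv : OnRun (k + j) n v)
    (hm : 2 ≤ |up^[j] n - m|) : ¬ Above (k, m) v := by
  intro h
  obtain ⟨u, hu, hyu⟩ := exists_onRun_above j hv le_rfl h
  obtain rfl := hyu.eq_of_fst_le hu.fst_le
  rcases hu with h | ⟨ε, hε, h | h⟩ | h
  · simp only [Prod.mk.injEq, true_and] at h
    simp [h] at hm
  · simp only [Prod.mk.injEq, true_and] at h
    rw [h] at hm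
    rcases hε with rfl | rfl <;> simp at hm
  · have := par_fst_lt (k, up^[j] n + ε)
    rw [← h] at this
    simp at this
  · have := cen_fst_lt k (up^[j] n)
    rw [← h] at this
    simp at this

theorem OnRun.not_above_of_lt {k n : ℤ} {y v : ℤ × ℤ} (hv : OnRun k n v)
    (hm : k < y.1) : ¬ Above y v := fun h => by
  have := h.fst_le
  have := hv.fst_le
  omega

/-! ### Half-runs -/

/-- The combinatorial length, `1` or `2`, of the half of the run `m` on the side `ε`. -/
def hl (m ε : ℤ) : ℕ :=
  if m = 3 * up m then 1 else if m = 3 * up m + ε then 2 else hl (up m) (-ε)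
termination_by m.natAbs
decreasing_by
  exact natAbs_up_lt (by assumption)

theorem hl_mul (m ε : ℤ) : hl (3 * m) ε = 1 := by
  rw [hl]; simp [up_mul]

/-- On the outer half of an outer third the walk climbs two edges: to the corner of the larger run,
then to the parent of this corner, which is the new centre. -/
theorem hl_outer {ε : ℤ} (hε : ε = 1 ∨ ε = -1) (m : ℤ) : hl (3 * m + ε) ε = 2 := by
  have : ε ≠ 0 := by omega
  rw [hl]; simp [up_mul_add hε, this]

/-- The inner half climbs one edge to the old centre and then retraces the old half-run backwards,
leaving out only its first edge. -/
theorem hl_inner {ε : ℤ} (hε : ε = 1 ∨ ε = -1) (m : ℤ) : hl (3 * m + ε) (-ε) = hl m ε := by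
  have : ε ≠ 0 := by omega
  have h2 : ε ≠ -ε := by omega
  rw [hl]; simp [up_mul_add hε, this, h2]

theorem hl_eq (m : ℤ) : ∀ ε : ℤ, (ε = 1 ∨ ε = -1) → hl m ε = 1 ∨ hl m ε = 2 := by
  induction m using ternary_induction with
  | h0 m => intro ε _; exact Or.inl (hl_mul _ _)
  | h1 m δ hδ ih =>
    intro ε hε
    by_cases h : ε = δ
    · subst h; exact Or.inr (hl_outer hε _)
    · obtain rfl : ε = -δ := by omega
      rw [hl_inner hδ]; exact ih _ hδ

theorem par_corner_of_hl_eq_one (m : ℤ) : ∀ ε : ℤ, (ε = 1 ∨ ε = -1) → hl m ε = 1 →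
    ∀ k, par (k, m + ε) = cen k m := by
  induction m using ternary_induction with
  | h0 m => intro ε hε _ k; rw [cen_mul, par_mul_add hε]
  | h1 m δ hδ ih =>
    intro ε hε h k
    by_cases h' : ε = δ
    · subst h'; rw [hl_outer hε] at h; omega
    · obtain rfl : ε = -δ := by omega
      rw [hl_inner hδ] at h
      rw [cen_mul_add hδ, ih _ hδ h]
      simp [par_mul]

/-- The second edge goes up on the outer half of an outer third. Passing to an inner half reverses
the old walk and swaps the two directions. -/
theorem hl_eq_two_dir (m : ℤ) : ∀ ε : ℤ, (ε = 1 ∨ ε = -1) → hl m ε = 2 →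
    ∀ k, par (par (k, m + ε)) = cen k m ∨ par (cen k m) = par (k, m + ε) := by
  induction m using ternary_induction with
  | h0 m => intro ε hε h k; rw [hl_mul] at h; omega
  | h1 m δ hδ ih =>
    intro ε hε h k
    by_cases h' : ε = δ
    · subst h'
      left
      have : 3 * m + ε + ε = 3 * (m + ε) + -ε := by ring
      rw [this, par_mul_add (by omega), cen_mul_add hε]
    · obtain rfl : ε = -δ := by omega
      rw [hl_inner hδ] at h
      rw [cen_mul_add hδ]
      have : 3 * m + δ + -δ = 3 * m := by ring
      rw [this, par_mul]
      exact (ih _ hδ h (k - 1)).symm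

theorem not_up_and_down {k m ε : ℤ} (h : par (par (k, m + ε)) = cen k m) :
    par (cen k m) ≠ par (k, m + ε) := by
  intro h'
  have := par_fst_lt (par (k, m + ε))
  have := par_fst_lt (cen k m)
  rw [h'] at this
  rw [h] at *
  omega

/-- The path along a run does not turn back in the middle: if one half goes up to the centre, then
the vertices of the other half are not below the last vertex of this half. -/
theorem center_up (m : ℤ) : ∀ ε : ℤ, (ε = 1 ∨ ε = -1) → hl m ε = 2 →
    ∀ k, par (par (k, m + ε)) = cen k m → ¬ Above (par (k, m + ε)) (par (k, m + -ε)) := by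
  induction m using ternary_induction with
  | h0 m => intro ε hε h; rw [hl_mul] at h; omega
  | h1 m δ hδ _ =>
    intro ε hε h k hup hab
    -- the parents of the two corners
    have e1 : 3 * m + δ + δ = 3 * (m + δ) + -δ := by ring
    have e2 : 3 * m + δ + -δ = 3 * m := by ring
    have p1 : par (k, 3 * m + δ + δ) = (k - 1, m + δ) := by rw [e1, par_mul_add (by omega)]
    have p2 : par (k, 3 * m + δ + -δ) = cen (k - 1) m := by rw [e2, par_mul]
    by_cases h' : ε = δ
    · subst h'
      rw [p1, p2] at hab
      have := hab.fst_le
      have := cen_fst_lt (k - 1) m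
      simp at *; omega
    · obtain rfl : ε = -δ := by omega
      rw [neg_neg, p1, p2] at hab
      rw [p2, cen_mul_add hδ] at hup
      rcases above_iff.1 hab with h3 | h3
      · have := cen_fst_lt (k - 1) m
        rw [← h3] at this; simp at this
      · rw [← hup] at h3
        have := h3.fst_le
        have := par_fst_lt (cen (k - 1) m)
        omega

/-- A second edge going down occurs only on the inner half of an outer third. On the other half the
walk then climbs, and its first edge ends at a child of the centre. -/
theorem center_down (m : ℤ) : ∀ ε : ℤ, (ε = 1 ∨ ε = -1) → hl m ε = 2 →
    ∀ k, par (cen k m) = par (k, m + ε) → Above (cen k m) (par (k, m + -ε)) := by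
  induction m using ternary_induction with
  | h0 m => intro ε hε h; rw [hl_mul] at h; omega
  | h1 m δ hδ _ =>
    intro ε hε h k hdown
    have e1 : 3 * m + δ + δ = 3 * (m + δ) + -δ := by ring
    have p1 : par (k, 3 * m + δ + δ) = (k - 1, m + δ) := by rw [e1, par_mul_add (by omega)]
    by_cases h' : ε = δ
    · subst h'
      rw [p1, cen_mul_add hε] at hdown
      have := par_fst_lt (par (k - 1, m + ε))
      have := par_fst_lt (k - 1, m + ε)
      rw [hdown] at *
      simp at *; omega
    · obtain rfl : ε = -δ := by omega
      rw [neg_neg, p1, cen_mul_add hδ]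
      exact above_par _

end TernaryForest

namespace TernaryForest

/-! ### The rooted forest -/

/-- The vertices above the two roots `(0, 0)` and `(-1, 0)`. -/
def Spine (v : ℤ × ℤ) : Prop := v.2 = 0 ∧ v.1 ≤ 0

instance (v : ℤ × ℤ) : Decidable (Spine v) := inferInstanceAs (Decidable (_ ∧ _))

/-- The parent with respect to the roots `(0, 0)` and `(-1, 0)`; the roots are fixed. -/
def rpar (v : ℤ × ℤ) : ℤ × ℤ :=
  if Spine v then (if v.1 ≤ -2 then (v.1 + 2, 0) else v) else par v

/-- The distance to the root. -/
def dep (v : ℤ × ℤ) : ℕ :=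
  if Spine v then (-v.1 / 2).toNat else dep (par v) + 1
-- Off column 0 the index shrinks; in column 0 the level drops by two until the spine is reached.
termination_by (v.2.natAbs, v.1.toNat)
decreasing_by
  rename_i h
  by_cases h0 : v.2 = 0
  · have h1 : par v = (v.1 - 2, 0) := by rw [← par_zero, ← h0]
    rw [h1, h0]
    refine Prod.Lex.right _ ?_
    have : ¬ v.1 ≤ 0 := fun h' => h ⟨h0, h'⟩
    simp; omega
  · exact Prod.Lex.left _ _ (natAbs_par_lt h0)

theorem rpar_of_not_spine {v : ℤ × ℤ} (h : ¬ Spine v) : rpar v = par v := if_neg h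

theorem dep_of_not_spine {v : ℤ × ℤ} (h : ¬ Spine v) : dep v = dep (par v) + 1 := by
  rw [dep, if_neg h]

theorem Spine.dep_eq {v : ℤ × ℤ} (h : Spine v) : dep v = (-v.1 / 2).toNat := by
  rw [dep, if_pos h]

theorem Spine.eq {v : ℤ × ℤ} (h : Spine v) : v = (v.1, 0) := Prod.ext rfl h.1

theorem Spine.par {v : ℤ × ℤ} (h : Spine v) : Spine (par v) := by
  rw [h.eq, par_zero]; exact ⟨rfl, by have := h.2; simp; omega⟩

theorem Spine.dep_par {v : ℤ × ℤ} (h : Spine v) : dep (TernaryForest.par v) = dep v + 1 := by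
  have h2 := h.par
  have e : TernaryForest.par v = (v.1 - 2, 0) := by rw [h.eq, par_zero]
  rw [h2.dep_eq, h.dep_eq, e]
  have := h.2
  simp; omega

theorem Spine.rpar_par {v : ℤ × ℤ} (h : Spine v) : rpar (TernaryForest.par v) = v := by
  rw [rpar, if_pos h.par]
  have := h.2
  have e : TernaryForest.par v = (v.1 - 2, 0) := by rw [h.eq, par_zero]
  rw [e, if_pos (by simp; omega)]
  exact Prod.ext (by simp) h.1.symm

theorem Spine.rpar {v : ℤ × ℤ} (h : Spine v) : Spine (rpar v) := by
  rw [TernaryForest.rpar, if_pos h]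
  split_ifs
  · exact ⟨rfl, by simp; omega⟩
  · exact h

theorem Spine.rpar_iterate {v : ℤ × ℤ} (h : Spine v) (i : ℕ) :
    Spine (TernaryForest.rpar^[i] v) := by
  induction i with
  | zero => exact h
  | succ i ih => rw [Function.iterate_succ_apply']; exact ih.rpar

theorem dep_rpar {v : ℤ × ℤ} (h : dep v ≠ 0) : dep (rpar v) + 1 = dep v := by
  by_cases hs : Spine v
  · have h2 := hs.rpar
    rw [hs.dep_eq] at h ⊢
    rw [h2.dep_eq, rpar, if_pos hs]
    have h3 : v.1 ≤ -2 := by omega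
    rw [if_pos h3]
    simp; omega
  · rw [rpar_of_not_spine hs, dep_of_not_spine hs]

theorem dep_rpar_iterate {v : ℤ × ℤ} (i : ℕ) (h : i ≤ dep v) :
    dep (rpar^[i] v) = dep v - i := by
  induction i with
  | zero => simp
  | succ i ih =>
    rw [Function.iterate_succ_apply']
    have := ih (by omega)
    have := dep_rpar (v := rpar^[i] v) (by omega)
    omega

theorem even_rpar (v : ℤ × ℤ) : Even ((rpar v).1 + (rpar v).2) ↔ Even (v.1 + v.2) := by
  rw [rpar]
  split_ifs with h
  · rw [h.eq]; simp [Int.even_iff]; 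
  · rfl
  · exact even_par v

theorem even_rpar_iterate (v : ℤ × ℤ) (i : ℕ) :
    Even ((rpar^[i] v).1 + (rpar^[i] v).2) ↔ Even (v.1 + v.2) := by
  induction i with
  | zero => rfl
  | succ i ih => rw [Function.iterate_succ_apply', even_rpar, ih]

theorem eq_of_dep_eq_zero {v w : ℤ × ℤ} (hv : dep v = 0) (hw : dep w = 0)
    (h : Even (v.1 + v.2) ↔ Even (w.1 + w.2)) : v = w := by
  have key : ∀ v : ℤ × ℤ, dep v = 0 → v.2 = 0 ∧ (v.1 = 0 ∨ v.1 = -1) := by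
    intro v hv
    by_cases hs : Spine v
    · rw [hs.dep_eq] at hv
      have := hs.2
      exact ⟨hs.1, by omega⟩
    · rw [dep_of_not_spine hs] at hv; omega
  obtain ⟨h1, h2⟩ := key v hv
  obtain ⟨h3, h4⟩ := key w hw
  simp only [Int.even_iff] at h
  exact Prod.ext (by omega) (by omega)

/-- Adjacency in the rooted forest is adjacency in the forest. -/
theorem rpar_eq {v : ℤ × ℤ} (h : dep v ≠ 0) : rpar v = par v ∨ par (rpar v) = v := by
  by_cases hs : Spine v
  · right
    have h3 : v.1 ≤ -2 := by
      rw [hs.dep_eq] at h; omega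
    rw [rpar, if_pos hs, if_pos h3, par_zero, hs.eq]
    simp
  · exact Or.inl (rpar_of_not_spine hs)

/-- `rpar` maps the spine to itself, so a path that is still off the spine has only climbed by
`par`. -/
theorem not_spine_of_rpar_iterate {v : ℤ × ℤ} {i : ℕ} (h : ¬ Spine (rpar^[i] v)) :
    ¬ Spine v ∧ rpar^[i] v = par^[i] v := by
  induction i generalizing v with
  | zero => exact ⟨h, rfl⟩
  | succ i ih =>
    have hv : ¬ Spine v := fun hs => h (hs.rpar_iterate _)
    refine ⟨hv, ?_⟩
    rw [Function.iterate_succ_apply] at h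
    rw [Function.iterate_succ_apply, Function.iterate_succ_apply, (ih h).2, rpar_of_not_spine hv]

end TernaryForest

/-! ### Gluing Lipschitz maps along the line -/

/-- A map which is Lipschitz on the unit intervals `[j, j + 1]` is Lipschitz. -/
theorem edist_glue_le {E : Type*} [PseudoEMetricSpace E] (Φ : ℤ → ℝ → E) (C : ℝ≥0∞)
    (hL : ∀ j : ℤ, ∀ z ∈ Set.Icc (j : ℝ) (j + 1), ∀ z' ∈ Set.Icc (j : ℝ) (j + 1),
      edist (Φ j z) (Φ j z') ≤ C * ENNReal.ofReal |z - z'|)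
    (hm : ∀ j : ℤ, Φ j (j + 1) = Φ (j + 1) (j + 1)) (z z' : ℝ) :
    edist (Φ ⌊z⌋ z) (Φ ⌊z'⌋ z') ≤ C * ENNReal.ofReal |z - z'| := by
  have key : ∀ (n : ℕ) (z z' : ℝ), z ≤ z' → ⌊z'⌋ = ⌊z⌋ + n →
      edist (Φ ⌊z⌋ z) (Φ ⌊z'⌋ z') ≤ C * ENNReal.ofReal |z - z'| := by
    intro n
    induction n with
    | zero =>
      intro z z' _ h
      simp only [Nat.cast_zero, add_zero] at h
      rw [h]
      exact hL _ _ ⟨Int.floor_le z, (Int.lt_floor_add_one z).le⟩ _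
        ⟨h ▸ Int.floor_le z', h ▸ (Int.lt_floor_add_one z').le⟩
    | succ n ih =>
      intro z z' hz h
      set w : ℝ := ⌊z⌋ + 1 with hw
      have hfw : ⌊w⌋ = ⌊z⌋ + 1 := by
        rw [hw, Int.floor_add_one, Int.floor_intCast]
      have hzw : z ≤ w := (Int.lt_floor_add_one z).le
      have hwz : w ≤ z' := by
        have : ((⌊z⌋ + 1 : ℤ) : ℝ) ≤ z' := by
          rw [← Int.le_floor, h]; push_cast; omega
        simpa [hw] using this
      have h1 := ih w z' hwz (by rw [h, hfw]; push_cast; ring)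
      have h2 := hL ⌊z⌋ z ⟨Int.floor_le z, hzw⟩ w ⟨(Int.floor_le z).trans hzw, le_rfl⟩
      have h3 : Φ ⌊z⌋ w = Φ ⌊w⌋ w := by rw [hfw]; exact hm ⌊z⌋
      rw [h3] at h2
      refine (edist_triangle _ (Φ ⌊w⌋ w) _).trans ((add_le_add h2 h1).trans ?_)
      rw [← mul_add, ← ENNReal.ofReal_add (abs_nonneg _) (abs_nonneg _)]
      refine mul_le_mul_right (ENNReal.ofReal_le_ofReal ?_) _
      rw [abs_of_nonpos (by linarith), abs_of_nonpos (by linarith), abs_of_nonpos (by linarith)]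
      linarith
  rcases le_total z z' with h | h
  · refine key (⌊z'⌋ - ⌊z⌋).toNat z z' h ?_
    have := Int.floor_mono h
    omega
  · rw [edist_comm, abs_sub_comm]
    refine key (⌊z⌋ - ⌊z'⌋).toNat z' z h ?_
    have := Int.floor_mono h
    omega

namespace SimpleGraph

variable {V : Type*} {G : SimpleGraph V}

/-! ### Paths in the realization of a graph -/

/-- The point at parameter `s` of the unit speed path through the vertices `w j`. -/
noncomputable def pathPoint (w : ℤ → V) (hw : ∀ j, w j = w (j + 1) ∨ G.Adj (w j) (w (j + 1)))
    (s : ℝ) : G.Realization :=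
  ⟨(1 - Int.fract s) • Finsupp.single (w ⌊s⌋) 1 + Int.fract s • Finsupp.single (w (⌊s⌋ + 1)) 1,
    w ⌊s⌋, w (⌊s⌋ + 1), hw _, 1 - Int.fract s, Int.fract s,
    sub_nonneg.2 (Int.fract_lt_one s).le, Int.fract_nonneg s, by ring, rfl⟩

theorem pathPoint_congr {w w' : ℤ → V} (hw : ∀ j, w j = w (j + 1) ∨ G.Adj (w j) (w (j + 1)))
    (hw' : ∀ j, w' j = w' (j + 1) ∨ G.Adj (w' j) (w' (j + 1))) {n : ℤ}
    (h : ∀ j ≤ n, w j = w' j) {s : ℝ} (hs : s ≤ n) :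
    pathPoint (G := G) w hw s = pathPoint w' hw' s := by
  refine Subtype.ext ?_
  simp only [pathPoint]
  have h1 : ⌊s⌋ ≤ n := by
    have := Int.floor_mono hs
    simpa using this
  rw [h _ h1]
  -- At `s = n` the weight of `w (n + 1)`, about which nothing is known, vanishes.
  rcases eq_or_lt_of_le h1 with h2 | h2
  · have : Int.fract s = 0 := by
      have h3 := Int.floor_le s
      rw [h2] at h3
      have : s = n := le_antisymm hs h3
      rw [this]; simp
    simp [this]
  · rw [h (⌊s⌋ + 1) (by omega)]

theorem edist_le_of_mem_cell {u v : V} (huv : u = v ∨ G.Adj u v) {p q : G.Realization}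
    (hp : p.1 ∈ cell u v) (hq : q.1 ∈ cell u v) :
    EDist.edist p q ≤ ENNReal.ofReal |p.1 u - q.1 u| := by
  have := PathOfLength.step huv hp hq (.refl q)
  rw [add_zero] at this
  exact sInf_le this

/-- The point `(1 - θ) u + θ v` of an edge; the parameter `θ` is clamped to `[0, 1]`. -/
noncomputable def edgePoint (u v : V) (huv : u = v ∨ G.Adj u v) (θ : ℝ) : G.Realization :=
  ⟨(1 - max 0 (min 1 θ)) • Finsupp.single u 1 + max 0 (min 1 θ) • Finsupp.single v 1,
    u, v, huv, 1 - max 0 (min 1 θ), max 0 (min 1 θ),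
    sub_nonneg.2 (max_le zero_le_one (min_le_left _ _)), le_max_left _ _, by ring, rfl⟩

theorem edgePoint_val {u v : V} (huv : u = v ∨ G.Adj u v) {θ : ℝ} (h0 : 0 ≤ θ) (h1 : θ ≤ 1) :
    (edgePoint (G := G) u v huv θ).1 =
      (1 - θ) • Finsupp.single u 1 + θ • Finsupp.single v 1 := by
  simp only [edgePoint, min_eq_right h1, max_eq_right h0]

theorem edgePoint_mem {u v : V} (huv : u = v ∨ G.Adj u v) {θ : ℝ} (h0 : 0 ≤ θ) (h1 : θ ≤ 1) :
    (edgePoint (G := G) u v huv θ).1 ∈ cell u v := by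
  rw [edgePoint_val huv h0 h1]; exact ⟨_, _, sub_nonneg.2 h1, h0, by ring, rfl⟩

theorem pathPoint_eq_edgePoint (w : ℤ → V)
    (hw : ∀ j, w j = w (j + 1) ∨ G.Adj (w j) (w (j + 1))) (s : ℝ) :
    pathPoint (G := G) w hw s = edgePoint (w ⌊s⌋) (w (⌊s⌋ + 1)) (hw _) (s - (⌊s⌋ : ℝ)) :=
  Subtype.ext (edgePoint_val _ (Int.fract_nonneg s) (Int.fract_lt_one s).le).symm

theorem edist_pathPoint_le (w : ℤ → V) (hw : ∀ j, w j = w (j + 1) ∨ G.Adj (w j) (w (j + 1)))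
    (s s' : ℝ) :
    EDist.edist (pathPoint (G := G) w hw s) (pathPoint w hw s') ≤ ENNReal.ofReal |s - s'| := by
  classical
  rw [pathPoint_eq_edgePoint, pathPoint_eq_edgePoint]
  have := edist_glue_le (fun (j : ℤ) (z : ℝ) =>
    edgePoint (G := G) (w j) (w (j + 1)) (hw j) (z - (j : ℝ))) 1 ?_ ?_ s s'
  · simpa using this
  · intro j z hz z' hz'
    have h1 : 0 ≤ z - j ∧ z - j ≤ 1 := ⟨by linarith [hz.1], by linarith [hz.2]⟩
    have h2 : 0 ≤ z' - j ∧ z' - j ≤ 1 := ⟨by linarith [hz'.1], by linarith [hz'.2]⟩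
    refine (edist_le_of_mem_cell (hw j) (edgePoint_mem _ h1.1 h1.2)
      (edgePoint_mem _ h2.1 h2.2)).trans ?_
    rw [one_mul]
    refine ENNReal.ofReal_le_ofReal ?_
    rw [edgePoint_val _ h1.1 h1.2, edgePoint_val _ h2.1 h2.2]
    by_cases h : w j = w (j + 1)
    · simp [← h]
    · simp only [Finsupp.coe_add, Finsupp.coe_smul, Pi.add_apply, Pi.smul_apply,
        Finsupp.single_eq_same, Finsupp.single_apply, smul_eq_mul, if_neg (Ne.symm h)]
      rw [abs_sub_comm z z']
      refine le_of_eq (congrArg _ ?_)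
      ring
  · intro j
    refine Subtype.ext ?_
    rw [edgePoint_val _ (by norm_num) (by norm_num),
      edgePoint_val _ (by push_cast; norm_num) (by push_cast; norm_num)]
    push_cast
    simp

/-! ### Lipschitz functions on the realization -/

/-- The extension of a function on the vertices which is affine on the edges. -/
noncomputable def extend (η : V → ℝ) (p : V →₀ ℝ) : ℝ := Finsupp.linearCombination ℝ η p

theorem extend_pathPoint (η : V → ℝ) (w : ℤ → V)
    (hw : ∀ j, w j = w (j + 1) ∨ G.Adj (w j) (w (j + 1))) (s : ℝ) :
    extend η (pathPoint (G := G) w hw s).1 =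
      (1 - Int.fract s) * η (w ⌊s⌋) + Int.fract s * η (w (⌊s⌋ + 1)) := by
  simp [extend, pathPoint]; ring

theorem extend_pathPoint_of_affine (η : V → ℝ) (w : ℤ → V)
    (hw : ∀ j, w j = w (j + 1) ∨ G.Adj (w j) (w (j + 1))) {n : ℤ} {c d : ℝ}
    (h : ∀ j, n ≤ j → η (w j) = c + d * j) {s : ℝ} (hs : n ≤ s) :
    extend η (pathPoint (G := G) w hw s).1 = c + d * s := by
  have h1 : n ≤ ⌊s⌋ := Int.le_floor.2 hs
  rw [extend_pathPoint, h _ h1, h _ (by omega)]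
  push_cast
  have := Int.floor_add_fract s
  linear_combination d * this

/-- On a piece inside one edge the extension is affine with slope at most 1. All lower bounds for
distances in the tree come from testing with such functions. -/
theorem abs_extend_sub_le (η : V → ℝ) (hη : ∀ u v, G.Adj u v → |η u - η v| ≤ 1)
    (p q : G.Realization) : ENNReal.ofReal |extend η p.1 - extend η q.1| ≤ EDist.edist p q := by
  refine le_sInf fun ℓ hℓ => ?_
  simp only [Set.mem_ofPred_eq] at hℓ
  induction hℓ with
  | refl p => simp
  | @step p q r ℓ u v huv hp hq _ ih =>
    have key : |extend η p.1 - extend η q.1| ≤ |p.1 u - q.1 u| := by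
      obtain ⟨a, b, ha, hb, hab, hp⟩ := hp
      obtain ⟨c, d, hc, hd, hcd, hq⟩ := hq
      obtain rfl : b = 1 - a := by linarith
      obtain rfl : d = 1 - c := by linarith
      rw [← hp, ← hq]
      by_cases h : u = v
      · subst h
        simp only [← add_smul]
        simp
      · have h1 := hη u v (huv.resolve_left h)
        have e1 : extend η (a • Finsupp.single u 1 + (1 - a) • Finsupp.single v 1) -
            extend η (c • Finsupp.single u 1 + (1 - c) • Finsupp.single v 1) =
            (a - c) * (η u - η v) := by
          simp [extend]; ring
        have e2 : (a • Finsupp.single u 1 + (1 - a) • Finsupp.single v 1 : V →₀ ℝ) u -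
            (c • Finsupp.single u 1 + (1 - c) • Finsupp.single v 1 : V →₀ ℝ) u = a - c := by
          simp [h]
        rw [e1, e2, abs_mul]
        exact mul_le_of_le_one_right (abs_nonneg _) h1
    calc ENNReal.ofReal |extend η p.1 - extend η r.1|
        ≤ ENNReal.ofReal (|extend η p.1 - extend η q.1| + |extend η q.1 - extend η r.1|) :=
          ENNReal.ofReal_le_ofReal (abs_sub_le _ _ _)
      _ = ENNReal.ofReal |extend η p.1 - extend η q.1| +
          ENNReal.ofReal |extend η q.1 - extend η r.1| :=
          ENNReal.ofReal_add (abs_nonneg _) (abs_nonneg _)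
      _ ≤ _ := add_le_add (ENNReal.ofReal_le_ofReal key) ih

/-! ### Rooted trees -/

/-- Geodesics from `t` to both neighbours prolong to paths to `v`. There is only one such path, so
the vertices before `v` agree. -/
theorem IsTree.eq_of_adj_of_dist (hG : G.IsTree) (t v w w' : V) (hw : G.Adj v w)
    (hw' : G.Adj v w') (h : G.dist t v = G.dist t w + 1) (h' : G.dist t v = G.dist t w' + 1) :
    w = w' := by
  obtain ⟨p, hp, hpl⟩ := hG.connected.exists_path_of_dist t w
  obtain ⟨q, hq, hql⟩ := hG.connected.exists_path_of_dist t w'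
  have h1 : (p.concat hw.symm).IsPath :=
    Walk.isPath_of_length_eq_dist _ (by rw [Walk.length_concat, hpl, h])
  have h2 : (q.concat hw'.symm).IsPath :=
    Walk.isPath_of_length_eq_dist _ (by rw [Walk.length_concat, hql, h'])
  have h3 := (hG.existsUnique_path t v).unique h1 h2
  have := congrArg Walk.penultimate h3
  simpa using this

/-- The neighbours of `g` which are farther from the root `t`. -/
def childSet (G : SimpleGraph V) (t g : V) : Set V := {x | G.Adj g x ∧ G.dist t x = G.dist t g + 1}

/-- The parent function of a rooted tree. -/
theorem IsTree.exists_parent (hG : G.IsTree) (t : V) : ∃ π : V → V,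
    (∀ v, G.dist t (π v) ≤ G.dist t v) ∧ ∀ g x, x ∈ childSet G t g → π x = g := by
  classical
  refine ⟨fun v => if h : ∃ w, G.Adj v w ∧ G.dist t v = G.dist t w + 1 then h.choose else v,
    fun v => ?_, fun g x hx => ?_⟩
  · dsimp only
    split_ifs with h
    · have := h.choose_spec.2; omega
    · exact le_rfl
  · have h : ∃ w, G.Adj x w ∧ G.dist t x = G.dist t w + 1 := ⟨g, hx.1.symm, hx.2⟩
    dsimp only
    rw [dif_pos h]
    exact hG.eq_of_adj_of_dist t x _ _ h.choose_spec.1 hx.1.symm h.choose_spec.2 hx.2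

/-- Descending paths through different children of a vertex `g` are as far apart as possible. -/
theorem IsTree.le_edist_of_branch (hG : G.IsTree) (t : V) {w w' : ℤ → V}
    (hw : ∀ j, w j = w (j + 1) ∨ G.Adj (w j) (w (j + 1)))
    (hw' : ∀ j, w' j = w' (j + 1) ∨ G.Adj (w' j) (w' (j + 1))) {n : ℤ} (hn : w n = w' n)
    (hne : w (n + 1) ≠ w' (n + 1)) (hd : ∀ j, n ≤ j → w (j + 1) ∈ childSet G t (w j))
    (hd' : ∀ j, n ≤ j → w' (j + 1) ∈ childSet G t (w' j)) {s s' : ℝ} (hs : n ≤ s)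
    (hs' : n ≤ s') :
    ENNReal.ofReal (s + s' - 2 * n) ≤
      EDist.edist (pathPoint (G := G) w hw s) (pathPoint w' hw' s') := by
  classical
  obtain ⟨π, hπ1, hπ2⟩ := hG.exists_parent t
  set g := w n with hg
  have hiter : ∀ (i : ℕ) v, G.dist t (π^[i] v) ≤ G.dist t v := by
    intro i
    induction i with
    | zero => intro v; exact le_rfl
    | succ i ih => intro v; exact (ih (π v)).trans (hπ1 v)
  let D : V → Set V := fun y => {v | ∃ i : ℕ, π^[i] v = y}
  have hDpar : ∀ y v, v ∈ D y → v ≠ y → π v ∈ D y := by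
    rintro y v ⟨_ | i, hi⟩ hne
    · exact absurd hi hne
    · exact ⟨i, hi⟩
  have hDpar' : ∀ y v, π v ∈ D y → v ∈ D y := by
    rintro y v ⟨i, hi⟩
    exact ⟨i + 1, hi⟩
  have hDg : ∀ y, y ∈ childSet G t g → g ∉ D y := by
    rintro y hy ⟨i, hi⟩
    have := hiter i g
    rw [hi, hy.2] at this
    omega
  have hdisj : ∀ y y' v, y ∈ childSet G t g → y' ∈ childSet G t g → v ∈ D y → v ∈ D y' →
      y = y' := by
    have : ∀ y y' v, y ∈ childSet G t g → y' ∈ childSet G t g → ∀ i j : ℕ, i ≤ j →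
        π^[i] v = y → π^[j] v = y' → y = y' := by
      intro y y' v hy hy' i j hij hi hj
      obtain ⟨l, rfl⟩ := Nat.exists_eq_add_of_le hij
      rw [add_comm, Function.iterate_add_apply, hi] at hj
      rcases l with _ | l
      · exact hj
      · rw [Function.iterate_succ_apply, hπ2 _ _ hy] at hj
        exact absurd ⟨l, hj⟩ (hDg y' hy')
    rintro y y' v hy hy' ⟨i, hi⟩ ⟨j, hj⟩
    rcases le_total i j with h | h
    · exact this y y' v hy hy' i j h hi hj
    · exact (this y' y v hy' hy j i h hj hi).symm
  have hy : w (n + 1) ∈ childSet G t g := hd n le_rfl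
  have hy' : w' (n + 1) ∈ childSet G t g := by rw [hn]; exact hd' n le_rfl
  set y := w (n + 1)
  set y' := w' (n + 1)
  -- The distance gained beyond `g`, with sign `+` below `y` and `-` below `y'`. These subtrees are
  -- attached only at `g`, so `η` changes by at most 1 along edges; on the two paths it tends to `s
  -- - n` and `n - s'`.
  let η : V → ℝ := fun v => if v ∈ D y then (G.dist t v : ℝ) - G.dist t g
    else if v ∈ D y' then (G.dist t g : ℝ) - G.dist t v else 0
  have hηg : η g = 0 := by
    simp only [η]; rw [if_neg (hDg y hy), if_neg (hDg y' hy')]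
  have hstep : ∀ u v, v ∈ childSet G t u → |η u - η v| ≤ 1 := by
    intro u v huv
    have hpv : π v = u := hπ2 _ _ huv
    have hdist : (G.dist t v : ℝ) = G.dist t u + 1 := by exact_mod_cast huv.2
    by_cases h1 : v = y
    · have : u = g := by rw [← hpv, h1, hπ2 _ _ hy]
      rw [this] at hdist ⊢
      rw [hηg]
      simp only [η]
      rw [if_pos (show v ∈ D y from ⟨0, h1⟩), hdist]; norm_num
    by_cases h2 : v = y'
    · have : u = g := by rw [← hpv, h2, hπ2 _ _ hy']
      rw [this] at hdist ⊢
      rw [hηg]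
      have h3 : v ∉ D y := fun h3 => hne (hdisj y y' v hy hy' h3 ⟨0, h2⟩)
      simp only [η]
      rw [if_neg h3, if_pos (show v ∈ D y' from ⟨0, h2⟩), hdist]; norm_num
    have e1 : (u ∈ D y) = (v ∈ D y) := by
      rw [← hpv]; exact propext ⟨hDpar' _ _, fun h => hDpar _ _ h h1⟩
    have e2 : (u ∈ D y') = (v ∈ D y') := by
      rw [← hpv]; exact propext ⟨hDpar' _ _, fun h => hDpar _ _ h h2⟩
    simp only [η, e1, e2]
    split_ifs <;> (try rw [hdist]) <;> norm_num
  have hη : ∀ u v, G.Adj u v → |η u - η v| ≤ 1 := by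
    intro u v huv
    by_cases h : v ∈ childSet G t u
    · exact hstep u v h
    · have h' : u ∈ childSet G t v := ⟨huv.symm,
        (hG.dist_eq_dist_add_one_of_adj t huv).resolve_right fun h' => h ⟨huv, h'⟩⟩
      rw [abs_sub_comm]; exact hstep v u h'
  have hdist : ∀ (w : ℤ → V), w n = g → (∀ j, n ≤ j → w (j + 1) ∈ childSet G t (w j)) →
      ∀ i : ℕ, (G.dist t (w (n + i)) : ℝ) = G.dist t g + i ∧ w (n + 1 + i) ∈ D (w (n + 1)) := by
    intro w hwn hd i
    induction i with
    | zero => simp [hwn]; exact ⟨0, rfl⟩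
    | succ i ih =>
      have h1 := hd (n + i) (by omega)
      have h2 := hd (n + 1 + i) (by omega)
      refine ⟨?_, ?_⟩
      · have : (G.dist t (w (n + i + 1)) : ℝ) = G.dist t (w (n + i)) + 1 := by exact_mod_cast h1.2
        push_cast
        rw [← add_assoc, this, ih.1]; ring
      · push_cast
        rw [← add_assoc]
        refine hDpar' _ _ ?_
        rw [hπ2 _ _ h2]; exact ih.2
  have a1 : ∀ j, n ≤ j → η (w j) = -n + 1 * j := by
    intro j hj
    obtain ⟨i, rfl⟩ := Int.le.dest hj
    rcases i with _ | i
    · simp [← hg, hηg]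
    · have h1 := (hdist w rfl hd (i + 1)).1
      have h2 := (hdist w rfl hd i).2
      have e : n + 1 + (i : ℤ) = n + ((i + 1 : ℕ) : ℤ) := by push_cast; ring
      rw [e] at h2
      simp only [η]
      rw [if_pos h2, h1]; push_cast; ring
  have a2 : ∀ j, n ≤ j → η (w' j) = n + (-1) * j := by
    intro j hj
    obtain ⟨i, rfl⟩ := Int.le.dest hj
    rcases i with _ | i
    · simp [← hn, hηg]
    · have h1 := (hdist w' hn.symm hd' (i + 1)).1
      have h2 := (hdist w' hn.symm hd' i).2
      have e : n + 1 + (i : ℤ) = n + ((i + 1 : ℕ) : ℤ) := by push_cast; ring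
      rw [e] at h2
      have h3 : w' (n + ((i + 1 : ℕ) : ℤ)) ∉ D y := fun h3 => hne (hdisj y y' _ hy hy' h3 h2)
      simp only [η]
      rw [if_neg h3, if_pos h2, h1]; push_cast; ring
  have := abs_extend_sub_le η hη (pathPoint w hw s) (pathPoint w' hw' s')
  rw [extend_pathPoint_of_affine η w hw a1 hs, extend_pathPoint_of_affine η w' hw' a2 hs'] at this
  refine le_trans (ENNReal.ofReal_le_ofReal ?_) this
  refine le_trans (le_of_eq ?_) (le_abs_self _)
  ring

theorem IsTree.le_edist_of_dist (hG : G.IsTree) (t : V) {w w' : ℤ → V}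
    (hw : ∀ j, w j = w (j + 1) ∨ G.Adj (w j) (w (j + 1)))
    (hw' : ∀ j, w' j = w' (j + 1) ∨ G.Adj (w' j) (w' (j + 1))) {c : ℝ}
    (hd : ∀ j : ℤ, 0 ≤ j → (G.dist t (w j) : ℝ) = c + 1 * j)
    (hd' : ∀ j : ℤ, 0 ≤ j → (G.dist t (w' j) : ℝ) = c + 1 * j) {s s' : ℝ} (hs : 0 ≤ s)
    (hs' : 0 ≤ s') :
    ENNReal.ofReal |s - s'| ≤ EDist.edist (pathPoint (G := G) w hw s) (pathPoint w' hw' s') := by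
  have := abs_extend_sub_le (G := G) (fun v => (G.dist t v : ℝ)) (fun u v huv => by
    rcases hG.dist_eq_dist_add_one_of_adj t huv with h | h <;> rw [h] <;> push_cast <;> norm_num)
    (pathPoint w hw s) (pathPoint w' hw' s')
  rw [extend_pathPoint_of_affine _ w hw hd (by simpa using hs),
    extend_pathPoint_of_affine _ w' hw' hd' (by simpa using hs')] at this
  convert this using 3
  ring

end SimpleGraph

namespace SimpleGraph

variable {V : Type*} {G : SimpleGraph V}

/-! ### Exponentially branching trees contain trees of words -/

/-- At most one neighbour lies towards the root; the strict inequality in the branching condition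
will pay for it. -/
theorem IsTree.neighborSet_encard_le (hG : G.IsTree) (t g : V) :
    (G.neighborSet g).encard ≤ (childSet G t g).encard + 1 := by
  have h : G.neighborSet g ⊆ childSet G t g ∪ {x | G.Adj g x ∧ x ∉ childSet G t g} := by
    intro x hx
    by_cases h : x ∈ childSet G t g
    · exact Or.inl h
    · exact Or.inr ⟨hx, h⟩
  refine (Set.encard_le_encard h).trans ((Set.encard_union_le _ _).trans ?_)
  gcongr
  refine Set.encard_le_one_iff.2 fun x y hx hy => ?_
  have key : ∀ x, G.Adj g x ∧ x ∉ childSet G t g → G.dist t g = G.dist t x + 1 := fun x hx =>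
    (hG.dist_eq_dist_add_one_of_adj t hx.1).resolve_right fun h => hx.2 ⟨hx.1, h⟩
  exact hG.eq_of_adj_of_dist t g x y hx.1 hy.1 (key x hx) (key y hy)

theorem IsTree.le_childSet_encard (hG : G.IsTree) (t g : V) {σ : ℝ}
    (h : ENNReal.ofReal (Real.exp (σ * G.dist g t)) < ((G.neighborSet g).encard : ℝ≥0∞))
    {m : ℕ} (hm : (m : ℝ) ≤ Real.exp (σ * G.dist t g)) : (m : ℕ∞) ≤ (childSet G t g).encard := by
  have h1 : ((m : ℕ∞) : ℝ≥0∞) < ((G.neighborSet g).encard : ℝ≥0∞) := by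
    refine lt_of_le_of_lt ?_ h
    rw [dist_comm, ENat.toENNReal_coe, ← ENNReal.ofReal_natCast]
    exact ENNReal.ofReal_le_ofReal hm
  rw [ENat.toENNReal_lt] at h1
  have h2 := h1.trans_le (hG.neighborSet_encard_le t g)
  exact (ENat.lt_add_one_iff' (ENat.natCast_ne_top m)).1 h2

theorem exists_child_choice (t : V) (hne : ∀ g, (childSet G t g).Nonempty) (B : ℕ) :
    ∃ ch : V → (a : ℕ) → (Fin a → Fin B) → V, (∀ g a l, ch g a l ∈ childSet G t g) ∧
      ∀ g a, ((B ^ a : ℕ) : ℕ∞) ≤ (childSet G t g).encard → Function.Injective (ch g a) := by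
  classical
  have key : ∀ g (a : ℕ), ∃ c : (Fin a → Fin B) → V, (∀ l, c l ∈ childSet G t g) ∧
      (((B ^ a : ℕ) : ℕ∞) ≤ (childSet G t g).encard → Function.Injective c) := by
    intro g a
    by_cases h : ((B ^ a : ℕ) : ℕ∞) ≤ (childSet G t g).encard
    · obtain ⟨s, hs, hc⟩ := Set.exists_subset_encard_eq h
      have hfin : s.Finite := Set.finite_of_encard_eq_coe hc
      have := hfin.fintype
      have hcard : Fintype.card (Fin a → Fin B) ≤ Fintype.card s := by
        rw [Set.encard_eq_coe_toFinset_card, Set.toFinset_card] at hc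
        have hc' : Fintype.card s = B ^ a := by exact_mod_cast hc
        simp [hc']
      obtain ⟨f⟩ := Function.Embedding.nonempty_of_card_le hcard
      exact ⟨fun l => (f l : V), fun l => hs (f l).2,
        fun _ => Subtype.val_injective.comp f.injective⟩
    · exact ⟨fun _ => (hne g).choose, fun _ => (hne g).choose_spec, fun h' => absurd h' h⟩
  choose ch h1 h2 using key
  exact ⟨ch, h1, h2⟩

/-- The descending path from `r` which is determined by a sequence of letters, one of them being
read every `R` steps. -/
def node {B : ℕ} (ch : V → (a : ℕ) → (Fin a → Fin B) → V) (r : V) (R : ℕ)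
    (W : (a : ℕ) → Fin a → Fin B) : ℕ → V
  | 0 => r
  | j + 1 => if R ∣ j then ch (node ch r R W j) (j / R + 1) (W (j / R + 1))
      -- The letter of index 0 is a function on `Fin 0`, so between readings the choice of child
      -- does not depend on the word.
      else ch (node ch r R W j) 0 (W 0)

theorem node_congr {B : ℕ} (ch : V → (a : ℕ) → (Fin a → Fin B) → V) (r : V) {R : ℕ} (hR : 0 < R)
    {W W' : (a : ℕ) → Fin a → Fin B} {i : ℕ} (h : ∀ a ≤ i, W a = W' a) (j : ℕ) (hj : j ≤ R * i) :
    node ch r R W j = node ch r R W' j := by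
  induction j with
  | zero => rfl
  | succ j ih =>
    have ih := ih (by omega)
    simp only [node]
    rw [ih]
    split_ifs with hd
    · obtain ⟨q, rfl⟩ := hd
      have : q < i := lt_of_mul_lt_mul_left (Nat.lt_of_succ_le hj) (Nat.zero_le R)
      rw [Nat.mul_div_cancel_left _ hR, h (q + 1) this]
    · rw [h 0 (Nat.zero_le _)]

theorem node_succ_mem {B : ℕ} {t : V} {ch : V → (a : ℕ) → (Fin a → Fin B) → V}
    (hch : ∀ g a l, ch g a l ∈ childSet G t g) (r : V) (R : ℕ) (W : (a : ℕ) → Fin a → Fin B)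
    (j : ℕ) : node ch r R W (j + 1) ∈ childSet G t (node ch r R W j) := by
  simp only [node]
  split_ifs <;> exact hch _ _ _

theorem dist_node {B : ℕ} {t : V} {ch : V → (a : ℕ) → (Fin a → Fin B) → V}
    (hch : ∀ g a l, ch g a l ∈ childSet G t g) (r : V) (R : ℕ) (W : (a : ℕ) → Fin a → Fin B)
    (j : ℕ) : G.dist t (node ch r R W j) = G.dist t r + j := by
  induction j with
  | zero => rfl
  | succ j ih => rw [(node_succ_mem hch r R W j).2, ih]; rfl

theorem exists_dist_eq {t : V} (hne : ∀ g, (childSet G t g).Nonempty) (e : ℕ) :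
    ∃ r, G.dist t r = e := by
  induction e with
  | zero => exact ⟨t, dist_self⟩
  | succ e ih =>
    obtain ⟨r, hr⟩ := ih
    obtain ⟨x, hx⟩ := hne r
    exact ⟨x, by rw [hx.2, hr]⟩

/-- Words with an `a`-th letter in `(Fin B)ᵃ` can be realized by quasi-isometrically embedded rays
in an exponentially branching tree; different words have rays which branch apart. -/
theorem IsTree.exists_wordMap (hG : G.IsTree) (t : V) (hb : G.IsExponentiallyBranching t)
    {B : ℕ} (hB : 1 ≤ B) : ∃ R : ℕ, 0 < R ∧
    ∃ P : ((a : ℕ) → Fin a → Fin B) → ℝ → G.Realization,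
      (∀ W s s', EDist.edist (P W s) (P W s') ≤ R * ENNReal.ofReal |s - s'|) ∧
      (∀ W W' (i : ℕ), (∀ a ≤ i, W a = W' a) → ∀ s : ℝ, s ≤ i → P W s = P W' s) ∧
      (∀ W W' s s', 0 ≤ s → 0 ≤ s' →
        R * ENNReal.ofReal |s - s'| ≤ EDist.edist (P W s) (P W' s')) ∧
      ∀ W W' (i : ℕ), W (i + 1) ≠ W' (i + 1) → ∀ s s' : ℝ, i ≤ s → i ≤ s' →
        R * ENNReal.ofReal (s + s' - 2 * i) ≤ EDist.edist (P W s) (P W' s') := by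
  obtain ⟨σ, hσ, hb⟩ := hb
  have hne : ∀ g, (childSet G t g).Nonempty := by
    intro g
    rw [← Set.one_le_encard_iff_nonempty]
    have := hG.le_childSet_encard t g (hb g) (m := 1)
      (by rw [Nat.cast_one]; exact Real.one_le_exp (by positivity))
    simpa using this
  obtain ⟨ch, hch, hinj⟩ := exists_child_choice t hne B
  -- The letter of index `i + 1` is read at distance `e + R * i` from `t`, where `B ^ (i + 1)`
  -- children are needed. Starting at distance `e` pays for one factor `B`, and every `R` steps pay
  -- for another.
  have hexp : ∃ e : ℕ, (B : ℝ) ≤ Real.exp (σ * e) := by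
    obtain ⟨e, he⟩ := exists_nat_ge ((B : ℝ) / σ)
    refine ⟨e, ?_⟩
    have h1 : (B : ℝ) ≤ σ * e := by rw [mul_comm]; exact (div_le_iff₀ hσ).1 he
    linarith [Real.add_one_le_exp (σ * e)]
  obtain ⟨e, he⟩ := hexp
  obtain ⟨r, hr⟩ := exists_dist_eq hne e
  set R := e + 1 with hRdef
  have hR : 0 < R := Nat.succ_pos e
  have heR : (B : ℝ) ≤ Real.exp (σ * R) := he.trans (Real.exp_le_exp.2 (by
    rw [hRdef]; push_cast; nlinarith))
  have hRpos : (0 : ℝ) < R := by exact_mod_cast hR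
  let w : ((a : ℕ) → Fin a → Fin B) → ℤ → V := fun W j => node ch r R W j.toNat
  have hwsucc : ∀ W (j : ℤ), 0 ≤ j → w W (j + 1) ∈ childSet G t (w W j) := by
    intro W j hj
    have : (j + 1).toNat = j.toNat + 1 := by omega
    simp only [w]
    rw [this]
    exact node_succ_mem hch _ _ _ _
  have hw : ∀ W j, w W j = w W (j + 1) ∨ G.Adj (w W j) (w W (j + 1)) := by
    intro W j
    rcases lt_or_ge j 0 with hj | hj
    · left
      have h1 : (j + 1).toNat = 0 := by omega
      have h2 : j.toNat = 0 := by omega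
      simp only [w, h1, h2]
    · exact Or.inr (hwsucc W j hj).1
  have hdist : ∀ W (j : ℤ), 0 ≤ j → (G.dist t (w W j) : ℝ) = e + 1 * j := by
    intro W j hj
    simp only [w]
    rw [dist_node hch, hr]
    push_cast
    have h : ((j.toNat : ℤ) : ℝ) = (j : ℝ) := by rw [Int.toNat_of_nonneg hj]
    rw [Int.cast_natCast] at h
    rw [h, one_mul]
  have hofReal : ∀ x : ℝ, (R : ℝ≥0∞) * ENNReal.ofReal x = ENNReal.ofReal (R * x) := by
    intro x
    rw [ENNReal.ofReal_mul hRpos.le, ENNReal.ofReal_natCast]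
  refine ⟨R, hR, fun W s => pathPoint (w W) (hw W) (R * s), ?_, ?_, ?_, ?_⟩
  · intro W s s'
    refine (edist_pathPoint_le _ _ _ _).trans (le_of_eq ?_)
    rw [hofReal, ← mul_sub, abs_mul, abs_of_pos hRpos]
  · intro W W' i h s hs
    refine pathPoint_congr (n := R * i) _ _ (fun j hj => ?_) ?_
    · refine node_congr ch r hR h _ ?_
      rw [Int.toNat_le]; exact_mod_cast hj
    · push_cast; gcongr
  · intro W W' s s' hs hs'
    have := hG.le_edist_of_dist t (hw W) (hw W') (hdist W) (hdist W')
      (s := R * s) (s' := R * s') (by positivity) (by positivity)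
    refine le_trans (le_of_eq ?_) this
    rw [hofReal, ← mul_sub, abs_mul, abs_of_pos hRpos]
  · intro W W' i hi s s' hs hs'
    classical
    have hex : ∃ i, W (i + 1) ≠ W' (i + 1) := ⟨i, hi⟩
    -- The paths already part at the first difference `i₀ ≤ i`; parting earlier only increases the
    -- distance.
    obtain ⟨i₀, hi₀, hmin⟩ : ∃ i₀, W (i₀ + 1) ≠ W' (i₀ + 1) ∧ ∀ a < i₀, W (a + 1) = W' (a + 1) :=
      ⟨Nat.find hex, Nat.find_spec hex, fun a ha => not_not.1 (Nat.find_min hex ha)⟩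
    have hle : i₀ ≤ i := le_of_not_gt fun h => hi (hmin i h)
    have heq : ∀ a ≤ i₀, W a = W' a := by
      rintro (_ | a) ha
      · exact Subsingleton.elim _ _
      · exact hmin a ha
    have hn : w W ((R * i₀ : ℕ) : ℤ) = w W' ((R * i₀ : ℕ) : ℤ) := by
      simp only [w, Int.toNat_natCast]
      exact node_congr ch r hR heq _ le_rfl
    have hne' : w W (((R * i₀ : ℕ) : ℤ) + 1) ≠ w W' (((R * i₀ : ℕ) : ℤ) + 1) := by
      have e1 : (((R * i₀ : ℕ) : ℤ) + 1).toNat = R * i₀ + 1 := by omega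
      simp only [w, e1, node]
      rw [if_pos (Dvd.intro _ rfl), if_pos (Dvd.intro _ rfl), Nat.mul_div_cancel_left _ hR,
        ← node_congr ch r hR heq _ le_rfl]
      intro h
      refine hi₀ (hinj _ _ ?_ h)
      refine hG.le_childSet_encard t _ (hb _) ?_
      rw [dist_node hch, hr, pow_succ]
      push_cast
      rw [mul_add, Real.exp_add, mul_comm, show σ * ((R : ℝ) * i₀) = i₀ * (σ * R) by ring,
        Real.exp_nat_mul]
      gcongr
    have h1 : (((R * i₀ : ℕ) : ℤ) : ℝ) ≤ R * s := by
      have : (i₀ : ℝ) ≤ i := by exact_mod_cast hle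
      push_cast; gcongr; linarith
    have h2 : (((R * i₀ : ℕ) : ℤ) : ℝ) ≤ R * s' := by
      have : (i₀ : ℝ) ≤ i := by exact_mod_cast hle
      push_cast; gcongr; linarith
    have := hG.le_edist_of_branch t (hw W) (hw W') hn hne'
      (fun j hj => hwsucc W j (by omega)) (fun j hj => hwsucc W' j (by omega)) h1 h2
    refine le_trans ?_ this
    rw [hofReal]
    refine ENNReal.ofReal_le_ofReal ?_
    push_cast
    have : (i₀ : ℝ) ≤ i := by exact_mod_cast hle
    nlinarith

end SimpleGraph

/-- Greedy colouring. -/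
theorem WellFounded.exists_coloring {α : Type*} {r : α → α → Prop} (hr : WellFounded r) (N : ℕ)
    (hN : ∀ a, ∃ s : Finset α, s.card ≤ N ∧ ∀ b, r b a → b ∈ s) :
    ∃ χ : α → ℕ, (∀ a, 1 ≤ χ a ∧ χ a ≤ N + 1) ∧ ∀ a b, r b a → χ b ≠ χ a := by
  classical
  have step : ∀ a (f : ∀ b, r b a → ℕ), ∃ c, (1 ≤ c ∧ c ≤ N + 1) ∧ ∀ b h, f b h ≠ c := by
    intro a f
    obtain ⟨s, hs, hsr⟩ := hN a
    obtain ⟨c, hc, hc'⟩ := Finset.exists_mem_notMem_of_card_lt_card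
      (s := s.image fun b => if h : r b a then f b h else 0) (t := Finset.Icc 1 (N + 1))
      (by rw [Nat.card_Icc]; have := Finset.card_image_le (s := s)
            (f := fun b => if h : r b a then f b h else 0); omega)
    refine ⟨c, Finset.mem_Icc.1 hc, fun b h hb => hc' ?_⟩
    exact Finset.mem_image.2 ⟨b, hsr b h, by rw [dif_pos h, hb]⟩
  choose g hg hg' using step
  refine ⟨hr.fix g, fun a => ?_, fun a b hab => ?_⟩
  · rw [hr.fix_eq]; exact hg _ _
  · rw [hr.fix_eq g a]; exact hg' a (fun b _ => hr.fix g b) b hab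

namespace TernaryForest

/-! ### Vertices with a common parent -/

/-- The vertex `y` has descendants on runs close to `y'`. -/
def Near (W : ℕ) (y y' : ℤ × ℤ) : Prop :=
  ∃ j, |j - y'.2| ≤ W ∧ ∃ u, OnRun y'.1 j u ∧ Above y u

/-- The vertices on a run. -/
def runFinset (k m : ℤ) : Finset (ℤ × ℤ) :=
  {(k, m), (k, m + 1), (k, m + -1), par (k, m + 1), par (k, m + -1), cen k m}

theorem OnRun.mem_runFinset {k m : ℤ} {v : ℤ × ℤ} (h : OnRun k m v) : v ∈ runFinset k m := by
  rcases h with rfl | ⟨ε, rfl | rfl, rfl | rfl⟩ | rfl <;> simp [runFinset]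

theorem card_runFinset_le (k m : ℤ) : (runFinset k m).card ≤ 6 := Finset.card_le_six

/-- The window contains `2 * W + 1` runs with at most six vertices each, and each vertex has at most
one ancestor whose parent is `par y'`. -/
theorem exists_near_finset (W : ℕ) (y' : ℤ × ℤ) : ∃ s : Finset (ℤ × ℤ),
    s.card ≤ 6 * (2 * W + 1) ∧ ∀ y, par y = par y' → Near W y y' → y ∈ s := by
  classical
  let U := (Finset.Icc (y'.2 - W) (y'.2 + W)).biUnion (runFinset y'.1)
  let g : ℤ × ℤ → ℤ × ℤ := fun u =>
    if h : ∃ y, par y = par y' ∧ Above y u then h.choose else u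
  refine ⟨U.image g, ?_, ?_⟩
  · refine Finset.card_image_le.trans ((Finset.card_biUnion_le_card_mul _ _ 6
      fun j _ => card_runFinset_le _ _).trans ?_)
    rw [Int.card_Icc]
    omega
  · rintro y hy ⟨j, hj, u, hu, hyu⟩
    have hex : ∃ y, par y = par y' ∧ Above y u := ⟨y, hy, hyu⟩
    refine Finset.mem_image.2 ⟨u, Finset.mem_biUnion.2 ⟨j, ?_, hu.mem_runFinset⟩, ?_⟩
    · rw [Finset.mem_Icc]
      have := abs_le.1 hj
      omega
    · simp only [g]
      rw [dif_pos hex]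
      exact hex.choose_spec.2.eq_of_par_eq hyu (hex.choose_spec.1.trans hy.symm)

/-- A rank function which distinguishes the vertices with a common parent. -/
def rank (y : ℤ × ℤ) : ℕ ×ₗ ℕ := toLex ((y.1 - (par y).1).toNat, Encodable.encode y.2)

theorem rank_lt_or {y y' : ℤ × ℤ} (h : par y = par y') (hne : y ≠ y') :
    rank y < rank y' ∨ rank y' < rank y := by
  refine lt_or_gt_of_ne fun he => hne ?_
  have h1 := congrArg (fun z => (ofLex z).1) he
  have h2 := congrArg (fun z => (ofLex z).2) he
  simp only [rank, ofLex_toLex] at h1 h2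
  have e1 := par_fst_lt y
  have e2 := par_fst_lt y'
  rw [h] at h1 e1
  exact Prod.ext (by omega) (Encodable.encode_injective h2)

theorem fst_le_of_rank_lt {y y' : ℤ × ℤ} (h : par y = par y') (hlt : rank y < rank y') :
    y.1 ≤ y'.1 := by
  have h1 : (ofLex (rank y)).1 ≤ (ofLex (rank y')).1 := by
    rcases Prod.Lex.lt_iff.1 hlt with h | h
    · exact h.le
    · exact h.1.le
  simp only [rank, ofLex_toLex] at h1
  have e1 := par_fst_lt y
  have e2 := par_fst_lt y'
  rw [h] at h1 e1
  omega

/-- Greedy colouring along `rank`, which is well founded and orders siblings by level first. Colour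
0 is reserved for the spine. -/
theorem exists_near_coloring (W : ℕ) : ∃ χ : ℤ × ℤ → ℕ,
    (∀ y, Spine y → χ y = 0) ∧ (∀ y, ¬ Spine y → χ y ≠ 0) ∧ (∀ y, χ y ≤ 6 * (2 * W + 1) + 1) ∧
    ∀ y y', ¬ Spine y → ¬ Spine y' → par y = par y' → rank y < rank y' → Near W y y' →
      χ y ≠ χ y' := by
  have hwf : WellFounded fun y y' : ℤ × ℤ => par y = par y' ∧ rank y < rank y' ∧ Near W y y' :=
    Subrelation.wf (r := InvImage (· < ·) rank) (fun h => h.2.1) (InvImage.wf _ wellFounded_lt)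
  obtain ⟨χ, h1, h2⟩ := hwf.exists_coloring (6 * (2 * W + 1)) fun y' => by
    obtain ⟨s, hs, hs'⟩ := exists_near_finset W y'
    exact ⟨s, hs, fun y h => hs' y h.1 h.2.2⟩
  refine ⟨fun y => if Spine y then 0 else χ y, fun y hy => if_pos hy, fun y hy => ?_, fun y => ?_,
    fun y y' hy hy' h3 h4 h5 => ?_⟩
  · dsimp only; rw [if_neg hy]; have := (h1 y).1; omega
  · dsimp only; split_ifs
    · omega
    · exact (h1 y).2
  · dsimp only; rw [if_neg hy, if_neg hy']; exact h2 _ _ ⟨h3, h4, h5⟩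

/-- The number of levels on which the digits of the block `s` separate. -/
def sepLevels (s : ℕ) : ℕ := 16 * 2 ^ s

/-- The base of the digits. -/
abbrev base : ℕ := 3 ^ 21

theorem eq_of_digits_eq {b N x y : ℕ} (hx : x < b ^ N) (hy : y < b ^ N)
    (h : ∀ i < N, x / b ^ i % b = y / b ^ i % b) : x = y := by
  have key : ∀ i ≤ N, x % b ^ i = y % b ^ i := by
    intro i
    induction i with
    | zero => intro _; simp [Nat.mod_one]
    | succ i ih =>
      intro hi
      rw [Nat.mod_pow_succ, Nat.mod_pow_succ, ih (by omega), h i (by omega)]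
  have := key _ le_rfl
  rwa [Nat.mod_eq_of_lt hx, Nat.mod_eq_of_lt hy] at this

/-- Block `s` consists of the digits `i` with `2 ^ s ≤ i + 1 < 2 ^ (s + 1)` and spells a colour for
the window `3 ^ (sepLevels s + 2)`. The first `t` digits contain a whole block of length comparable
to `t`, so agreement means equal colours and excludes nearness. -/
theorem exists_digits : ∃ dig : ℤ × ℤ → ℕ → Fin base, ∀ y y', ∀ t : ℕ, 1 ≤ t →
    (∀ i < t, dig y i = dig y' i) → (Spine y ↔ Spine y') ∧
      (¬ Spine y → par y = par y' → rank y < rank y' →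
        ∃ L, 4 * t ≤ L ∧ ¬ Near (3 ^ (L + 2)) y y') := by
  choose χ h1 h2 h3 h4 using fun s => exists_near_coloring (3 ^ (sepLevels s + 2))
  have hbase : 0 < base := by positivity
  refine ⟨fun y i => ⟨χ (Nat.log 2 (i + 1)) y / base ^ (i + 1 - 2 ^ Nat.log 2 (i + 1)) % base,
    Nat.mod_lt _ hbase⟩, fun y y' t ht hd => ?_⟩
  -- Block `s` is the last one completed within `t` digits: `2 ^ (s + 1) ≤ t + 1 < 2 ^ (s + 2)`. The
  -- upper bound gives `4 * t ≤ sepLevels s`.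
  obtain ⟨s, hs⟩ : ∃ s, Nat.log 2 (t + 1) = s + 1 :=
    Nat.exists_eq_succ_of_ne_zero (Nat.log_pos one_lt_two (by omega)).ne'
  have hs1 : 2 ^ (s + 1) ≤ t + 1 := by
    rw [← hs]; exact Nat.pow_log_le_self 2 (by omega)
  have hs2 : t + 1 < 2 ^ (s + 2) := by
    have := Nat.lt_pow_succ_log_self one_lt_two (t + 1)
    rwa [hs] at this
  have hdig : ∀ i < 2 ^ s, χ s y / base ^ i % base = χ s y' / base ^ i % base := by
    intro i hi
    have h2s : 0 < 2 ^ s := by positivity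
    have hlog : Nat.log 2 (2 ^ s + i - 1 + 1) = s := by
      rw [Nat.log_eq_iff (Or.inr ⟨one_lt_two, by omega⟩), pow_succ]; omega
    have := congrArg Fin.val (hd (2 ^ s + i - 1) (by rw [pow_succ] at hs1; omega))
    simp only [hlog] at this
    rwa [show 2 ^ s + i - 1 + 1 - 2 ^ s = i by omega] at this
  have hχ : χ s y = χ s y' := by
    have hlt : ∀ y, χ s y < base ^ 2 ^ s := by
      intro y
      refine (h3 s y).trans_lt ?_
      -- Colours stay below `3 ^ (16 * 2 ^ s + 5)`, and `16 * 2 ^ s + 5 ≤ 21 * 2 ^ s`; hence the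
      -- base `3 ^ 21`.
      have e1 : 6 * (2 * 3 ^ (sepLevels s + 2) + 1) + 1 < 3 ^ (sepLevels s + 5) := by
        have : 1 ≤ 3 ^ (sepLevels s + 2) := Nat.one_le_pow _ _ (by norm_num)
        rw [show sepLevels s + 5 = sepLevels s + 2 + 3 by ring, pow_add _ _ 3]
        omega
      refine e1.trans_le ?_
      rw [base, ← pow_mul]
      refine Nat.pow_le_pow_right (by norm_num) ?_
      have : 1 ≤ 2 ^ s := Nat.one_le_pow _ _ (by norm_num)
      unfold sepLevels
      omega
    exact eq_of_digits_eq (hlt y) (hlt y') hdig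
  have hsp : Spine y ↔ Spine y' := by
    by_cases hy : Spine y <;> by_cases hy' : Spine y' <;> simp only [hy, hy']
    · exact absurd (hχ.symm.trans (h1 s y hy)) (h2 s y' hy')
    · exact absurd (hχ.trans (h1 s y' hy')) (h2 s y hy)
  refine ⟨hsp, fun hy hp hr => ⟨sepLevels s, ?_, fun hc => h4 s y y' hy (hsp.not.1 hy) hp hr hc hχ⟩⟩
  unfold sepLevels
  rw [pow_add] at hs2
  omega

/-! ### Separation by walls of the other colour -/

theorem abs_sub_lt_of_up (i : ℕ) {a b : ℤ} (h : |up^[i] a - up^[i] b| ≤ 1) :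
    |a - b| < 2 * 3 ^ i := by
  induction i generalizing a b with
  | zero => simp only [Function.iterate_zero, id, pow_zero] at *; omega
  | succ i ih =>
    have := ih (a := up a) (b := up b) h
    rw [pow_succ]
    have h1 := eq_up a
    have h2 := eq_up b
    rw [abs_lt] at *
    constructor <;> omega

/-- Since `(κ, c)` is above a vertex on the run `n`, the ancestor of this run on level `κ` is `c` or
next to it. Following a descendant of `y` up or down to level `κ + i` gives a run with the same
ancestor. -/
theorem exists_onRun_near {K n κ c : ℤ} {i : ℕ} {y v w : ℤ × ℤ} (hv : OnRun K n v)
    (hyv : Above y v) (hy : y.1 ≤ κ + i) (hw : OnRun K n w) (hcw : Above (κ, c) w) :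
    ∃ j, (∃ u, OnRun (κ + i) j u ∧ Above y u) ∧ |up^[i] j - c| ≤ 1 := by
  have hK : κ ≤ K := le_of_not_gt fun h => hw.not_above_of_lt h hcw
  obtain ⟨e, rfl⟩ := Int.le.dest hK
  have hle : |up^[e] n - c| ≤ 1 := by
    by_contra h
    exact hw.not_above e (by omega) hcw
  rcases le_total e i with h | h
  · obtain ⟨b, rfl⟩ := Nat.exists_eq_add_of_le h
    obtain ⟨j, hj, hvj⟩ := hv.persist_iterate b
    refine ⟨j, ⟨v, ?_, hyv⟩, ?_⟩
    · push_cast; rwa [← add_assoc]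
    · rwa [Function.iterate_add_apply, hj]
  · obtain ⟨b, rfl⟩ := Nat.exists_eq_add_of_le h
    obtain ⟨u, hu, hyu⟩ := exists_onRun_above (k := κ + i) (n := n) b
      (by push_cast at hv; rwa [← add_assoc] at hv) hy hyv
    refine ⟨_, ⟨u, hu, hyu⟩, ?_⟩
    rwa [← Function.iterate_add_apply]

/-- The separating vertices, or walls, are the ancestors of the run `n'` on the `L` levels above
`y'`. They are above everything of their colour under that run. A wall above a vertex on the run `n`
would produce descendants of `y` within `3 ^ (L + 2)` runs of `y'`. -/
theorem separation_aux {L : ℕ} {y y' : ℤ × ℤ} (hp : par y = par y') (hle : y.1 ≤ y'.1)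
    (hN : ¬ Near (3 ^ (L + 2)) y y') {K n K' n' : ℤ} {v v' : ℤ × ℤ}
    (hv : OnRun K n v) (hyv : Above y v) (hv' : OnRun K' n' v') (hyv' : Above y' v') :
    ∃ S : Finset (ℤ × ℤ), S.card = L ∧ ∀ x ∈ S, (Even (x.1 + x.2) ↔ ¬ Even (y.1 + y.2)) ∧
      (∀ w, OnRun K n w → ¬ Above x w) ∧
      ∀ w, OnRun (K' - 1) (up n') w → (Even (w.1 + w.2) ↔ ¬ Even (y.1 + y.2)) → Above x w := by
  classical
  have hK' : y'.1 ≤ K' := hyv'.fst_le.trans hv'.fst_le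
  obtain ⟨a, rfl⟩ := Int.le.dest hK'
  set n₁ := up^[a] n' with hn₁
  have hn₁' : |n₁ - y'.2| ≤ 1 := by
    by_contra h
    exact hv'.not_above (k := y'.1) (m := y'.2) a (by rw [← hn₁]; omega) hyv'
  have hsep : ∀ i : ℕ, i ≤ L → ∀ K n v w, OnRun K n v → Above y v → OnRun K n w →
      ¬ Above (y'.1 - i, up^[i] n₁) w := by
    intro i hi K n v w hv hyv hw h
    obtain ⟨j, hj, hj'⟩ := exists_onRun_near (i := i) hv hyv (by omega) hw h
    refine hN ⟨j, ?_, by simpa using hj⟩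
    have h1 := abs_sub_lt_of_up i hj'
    have h2 : (3 : ℤ) ^ i ≤ 3 ^ L := pow_le_pow_right₀ (by norm_num) hi
    push_cast
    rw [pow_add]
    rw [abs_le] at *
    rw [abs_lt] at h1
    have : (1 : ℤ) ≤ 3 ^ L := one_le_pow₀ (by norm_num)
    constructor <;> linarith
  -- A wall of the colour of `y` would be above `v'`, hence strictly above `y'`, hence above the
  -- common parent and above `y`, contrary to `hsep`.
  have hcol : ∀ i : ℕ, 1 ≤ i → i ≤ L →
      (Even (y'.1 - i + up^[i] n₁) ↔ ¬ Even (y.1 + y.2)) := by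
    intro i hi hiL
    by_contra hcon
    have hyy' : Even (y.1 + y.2) ↔ Even (y'.1 + y'.2) := by rw [← even_par y, ← even_par y', hp]
    have hc : Even (v'.1 + v'.2) ↔ Even (y'.1 - i + up^[i + a] n') := by
      rw [hyv'.even_iff, Function.iterate_add_apply, ← hn₁, ← hyy']; tauto
    have h1 : Above (y'.1 - i, up^[i] n₁) v' := by
      have := OnRun.above (k := y'.1 - i) (n := n') (v := v') (i + a)
        (by push_cast; convert hv' using 1; ring) hc
      rwa [Function.iterate_add_apply] at this
    have h2 := (h1.total hyv' (by simp)).par_of_ne (by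
      intro h
      have := congrArg Prod.fst h
      simp only at this
      omega)
    rw [← hp] at h2
    exact hsep i hiL y.1 y.2 y y (OnRun.self _ _) (Above.refl y) (OnRun.self _ _) h2.of_par
  refine ⟨(Finset.Icc 1 L).image fun i : ℕ => ((y'.1 - i, up^[i] n₁) : ℤ × ℤ), ?_, ?_⟩
  · rw [Finset.card_image_of_injective, Nat.card_Icc]
    · omega
    · intro i j hij
      have := congrArg Prod.fst hij
      simp only at this
      omega
  · intro x hx
    obtain ⟨i, hi, rfl⟩ := Finset.mem_image.1 hx
    rw [Finset.mem_Icc] at hi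
    refine ⟨hcol i hi.1 hi.2, fun w hw => hsep i hi.2 K n v w hv hyv hw, fun w hw hc => ?_⟩
    obtain ⟨i, rfl⟩ := Nat.exists_eq_add_of_le' hi.1
    have e : up^[i + 1] n₁ = up^[i + a] (up n') := by
      rw [hn₁, ← Function.iterate_succ_apply, ← Function.iterate_add_apply]
      congr 2; omega
    have := OnRun.above (k := y'.1 - (i + 1 : ℕ)) (n := up n') (v := w) (i + a)
      (by push_cast; convert hw using 1; ring)
      (by rw [← e, hcol (i + 1) hi.1 hi.2]; exact hc)
    rwa [← e] at this

end TernaryForest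

namespace TernaryForest

/-! ### The `ℓ¹` distance between points of the forest -/

/-- The `ℓ¹` distance of two functions. -/
noncomputable def l1 {α : Type*} (f g : α → ℝ) : ℝ≥0∞ := ∑' y, ENNReal.ofReal |f y - g y|

theorem l1_comm {α : Type*} (f g : α → ℝ) : l1 f g = l1 g f := by
  simp only [l1, abs_sub_comm]

theorem l1_triangle {α : Type*} (f g h : α → ℝ) : l1 f h ≤ l1 f g + l1 g h := by
  rw [l1, l1, l1, ← ENNReal.tsum_add]
  refine ENNReal.tsum_le_tsum fun y => ?_
  rw [← ENNReal.ofReal_add (abs_nonneg _) (abs_nonneg _)]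
  exact ENNReal.ofReal_le_ofReal (abs_sub_le _ _ _)

theorem l1_self {α : Type*} (f : α → ℝ) : l1 f f = 0 := by simp [l1]

theorem l1_combination {α : Type*} (f g : α → ℝ) (b b' : ℝ) :
    l1 (fun y => b * f y + (1 - b) * g y) (fun y => b' * f y + (1 - b') * g y) =
      ENNReal.ofReal |b - b'| * l1 f g := by
  rw [l1, l1, ← ENNReal.tsum_mul_left]
  refine tsum_congr fun y => ?_
  rw [← ENNReal.ofReal_mul (abs_nonneg _), ← abs_mul]
  congr 2
  ring

open Classical in
/-- The indicator function of the vertices above `v`. -/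
noncomputable def ind (v y : ℤ × ℤ) : ℝ := if Above y v then 1 else 0

/-- The point at parameter `b` of the edge from `par v` to `v`, in terms of the vertices above
it. -/
noncomputable def pt (v : ℤ × ℤ) (b : ℝ) (y : ℤ × ℤ) : ℝ := b * ind v y + (1 - b) * ind (par v) y

theorem ind_of_above {v y : ℤ × ℤ} (h : Above y v) : ind v y = 1 := if_pos h

theorem ind_of_not_above {v y : ℤ × ℤ} (h : ¬ Above y v) : ind v y = 0 := if_neg h

theorem pt_of_above {v y : ℤ × ℤ} (h : Above y (par v)) (b : ℝ) : pt v b y = 1 := by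
  rw [pt, ind_of_above h, ind_of_above h.of_par]; ring

theorem pt_of_not_above {v y : ℤ × ℤ} (h : ¬ Above y v) (b : ℝ) : pt v b y = 0 := by
  rw [pt, ind_of_not_above h, ind_of_not_above fun h' => h h'.of_par]; ring

theorem pt_one (v : ℤ × ℤ) : pt v 1 = ind v := by ext y; simp [pt]

theorem pt_zero (v : ℤ × ℤ) : pt v 0 = ind (par v) := by ext y; simp [pt]

/-- The sets of vertices above `v` and above `par v` differ only by `v`. -/
theorem l1_ind_par_le (v : ℤ × ℤ) : l1 (ind v) (ind (par v)) ≤ 1 := by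
  rw [l1, tsum_eq_single v]
  · by_cases h : Above v (par v)
    · simp [ind_of_above h, ind_of_above (Above.refl v)]
    · simp [ind_of_not_above h, ind_of_above (Above.refl v)]
  · intro y hy
    by_cases h : Above y (par v)
    · simp [ind_of_above h, ind_of_above h.of_par]
    · simp [ind_of_not_above h,
        ind_of_not_above fun h' : Above y v => h (h'.par_of_ne (Ne.symm hy))]

theorem l1_ind_rpar_le {v : ℤ × ℤ} (h : dep v ≠ 0) : l1 (ind v) (ind (rpar v)) ≤ 1 := by
  rcases rpar_eq h with h | h
  · rw [h]; exact l1_ind_par_le v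
  · rw [l1_comm]
    nth_rw 2 [← h]
    exact l1_ind_par_le _

/-- The ancestor of depth `d` in the rooted forest. -/
def anc (d : ℕ) (v : ℤ × ℤ) : ℤ × ℤ := rpar^[dep v - d] v

theorem dep_anc {d : ℕ} {v : ℤ × ℤ} (h : d ≤ dep v) : dep (anc d v) = d := by
  rw [anc, dep_rpar_iterate _ (Nat.sub_le _ _)]; omega

theorem anc_self (v : ℤ × ℤ) : anc (dep v) v = v := by simp [anc]

theorem rpar_anc {d : ℕ} {v : ℤ × ℤ} (h : d + 1 ≤ dep v) : rpar (anc (d + 1) v) = anc d v := by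
  rw [anc, anc, ← Function.iterate_succ_apply' rpar]
  congr 2
  omega

theorem anc_rpar {d : ℕ} {v : ℤ × ℤ} (h : d + 1 ≤ dep v) : anc d (rpar v) = anc d v := by
  have := dep_rpar (v := v) (by omega)
  rw [anc, anc, ← Function.iterate_succ_apply]
  congr 2
  omega

theorem l1_ind_anc_le (v : ℤ × ℤ) {d : ℕ} (h : d ≤ dep v) :
    l1 (ind v) (ind (anc d v)) ≤ ENNReal.ofReal (dep v - d) := by
  obtain ⟨i, hi⟩ := Nat.exists_eq_add_of_le h
  induction i generalizing d with
  | zero =>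
    obtain rfl : d = dep v := by omega
    rw [anc_self, l1_self]; exact zero_le
  | succ i ih =>
    refine (l1_triangle _ (ind (anc (d + 1) v)) _).trans ?_
    have h2 := l1_ind_rpar_le (v := anc (d + 1) v) (by rw [dep_anc (by omega)]; omega)
    rw [rpar_anc (by omega)] at h2
    refine (add_le_add (ih (d := d + 1) (by omega) (by omega)) h2).trans ?_
    rw [← ENNReal.ofReal_one, ← ENNReal.ofReal_add _ zero_le_one]
    · refine ENNReal.ofReal_le_ofReal ?_
      push_cast; linarith
    · rw [sub_nonneg]; exact_mod_cast (show d + 1 ≤ dep v by omega)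

/-- The point at parameter `b` of the edge from `rpar v` to `v`. -/
noncomputable def rpt (v : ℤ × ℤ) (b : ℝ) (y : ℤ × ℤ) : ℝ := b * ind v y + (1 - b) * ind (rpar v) y

theorem l1_rpt_le {v : ℤ × ℤ} (h : dep v ≠ 0) (b b' : ℝ) :
    l1 (rpt v b) (rpt v b') ≤ ENNReal.ofReal |b - b'| := by
  unfold rpt
  rw [l1_combination]
  exact mul_le_of_le_one_right zero_le (l1_ind_rpar_le h)

theorem rpt_one (v : ℤ × ℤ) : rpt v 1 = ind v := by ext y; simp [rpt]

theorem rpt_zero (v : ℤ × ℤ) : rpt v 0 = ind (rpar v) := by ext y; simp [rpt]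

theorem l1_rpt_anc_le {v : ℤ × ℤ} {d : ℕ} (h : d + 1 ≤ dep v) {b : ℝ} (hb : 0 ≤ b) :
    l1 (rpt v b) (ind (anc d v)) ≤ ENNReal.ofReal (dep v - 1 + b - d) := by
  have h0 : dep v ≠ 0 := by omega
  have h1 := l1_rpt_le h0 b 0
  rw [rpt_zero, sub_zero, abs_of_nonneg hb] at h1
  have h2 := dep_rpar h0
  have h3 := l1_ind_anc_le (rpar v) (d := d) (by omega)
  rw [anc_rpar h] at h3
  refine (l1_triangle _ _ _).trans ((add_le_add h1 h3).trans ?_)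
  have h4 : (dep v : ℝ) = dep (rpar v) + 1 := by exact_mod_cast h2.symm
  have h5 : (d : ℝ) ≤ dep (rpar v) := by exact_mod_cast (show d ≤ dep (rpar v) by omega)
  rw [← ENNReal.ofReal_add hb (by linarith)]
  exact ENNReal.ofReal_le_ofReal (by linarith)

theorem l1_rpt_desc_le {v v' : ℤ × ℤ} (hv : dep v ≠ 0) (hv' : anc (dep v) v' = v)
    (hle : dep v ≤ dep v') {b b' : ℝ} (hb1 : b ≤ 1) (hb' : 0 ≤ b') :
    l1 (rpt v b) (rpt v' b') ≤ ENNReal.ofReal |dep v - 1 + b - (dep v' - 1 + b')| := by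
  rcases hle.eq_or_lt with h | h
  · rw [h, anc_self] at hv'
    subst hv'
    refine (l1_rpt_le hv _ _).trans (le_of_eq ?_)
    congr 2; ring
  · have h1 := l1_rpt_le hv b 1
    rw [rpt_one] at h1
    have h2 := l1_rpt_anc_le (v := v') (d := dep v) h hb'
    rw [hv', l1_comm] at h2
    refine (l1_triangle _ _ _).trans ((add_le_add h1 h2).trans ?_)
    have h3 : (dep v : ℝ) + 1 ≤ dep v' := by exact_mod_cast h
    rw [abs_of_nonpos (by linarith), ← ENNReal.ofReal_add (by linarith) (by linarith),
      abs_of_nonpos (by linarith)]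
    exact ENNReal.ofReal_le_ofReal (by linarith)

/-! ### Words of vertices -/

/-- Digits which separate the vertices with a common parent. -/
noncomputable def digit : ℤ × ℤ → ℕ → Fin base := exists_digits.choose

/-- The word of a vertex. Its letter of depth `a` consists of digits of the ancestors. -/
noncomputable def word (v : ℤ × ℤ) (a : ℕ) (j : Fin a) : Fin base := digit (anc (a - j) v) j

theorem word_rpar {v : ℤ × ℤ} {a : ℕ} (h : a + 1 ≤ dep v) : word (rpar v) a = word v a := by
  ext j
  rw [word, word, anc_rpar]
  omega

/-- Digit `t` of the ancestor of depth `d + 1` is spelled in the letter of depth `d + t + 1`, with a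
delay of `t` steps. -/
theorem word_ne {v v' : ℤ × ℤ} {d t : ℕ} (h : digit (anc (d + 1) v) t ≠ digit (anc (d + 1) v') t) :
    word v (d + t + 1) ≠ word v' (d + t + 1) := by
  intro he
  have := congrFun he ⟨t, by omega⟩
  simp only [word] at this
  rw [show d + t + 1 - t = d + 1 by omega] at this
  exact h this

/-- The common ancestors of two vertices: either one vertex is above the other one, or there is a
branch point. -/
theorem anc_cases {v v' : ℤ × ℤ} (hc : Even (v.1 + v.2) ↔ Even (v'.1 + v'.2)) :
    (dep v ≤ dep v' ∧ anc (dep v) v' = v) ∨ (dep v' ≤ dep v ∧ anc (dep v') v = v') ∨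
      ∃ d, d + 1 ≤ dep v ∧ d + 1 ≤ dep v' ∧ anc d v = anc d v' ∧ anc (d + 1) v ≠ anc (d + 1) v' := by
  classical
  have h0 : anc 0 v = anc 0 v' := eq_of_dep_eq_zero (dep_anc (Nat.zero_le _))
    (dep_anc (Nat.zero_le _)) (by rw [anc, anc, even_rpar_iterate, even_rpar_iterate]; exact hc)
  by_cases hd : ∃ d, d + 1 ≤ dep v ∧ d + 1 ≤ dep v' ∧ anc d v = anc d v' ∧
      anc (d + 1) v ≠ anc (d + 1) v'
  · exact Or.inr (Or.inr hd)
  · have key : ∀ d, d ≤ dep v → d ≤ dep v' → anc d v = anc d v' := by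
      intro d
      induction d with
      | zero => exact fun _ _ => h0
      | succ d ih =>
        intro h h'
        by_contra hne
        exact hd ⟨d, h, h', ih (by omega) (by omega), hne⟩
    rcases le_total (dep v) (dep v') with h | h
    · left; exact ⟨h, by rw [← key _ le_rfl h, anc_self]⟩
    · right; left; exact ⟨h, by rw [key _ h le_rfl, anc_self]⟩

end TernaryForest

/-! ### Late branching in one tree is paid for by the other tree. -/

namespace TernaryForest

/-- The edge from `par w` to `w` is adapted to the run `n` on level `K`. -/
def Adapted (K n : ℤ) (w : ℤ × ℤ) : Prop := OnRun K n w ∧ OnRun (K - 1) (up n) (par w)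

theorem card_le_l1 {L : ℕ} {y y' : ℤ × ℤ} (hp : par y = par y') (hle : y.1 ≤ y'.1)
    (hN : ¬ Near (3 ^ (L + 2)) y y') {K n K' n' : ℤ} {v v' w w' : ℤ × ℤ}
    (hv : OnRun K n v) (hyv : Above y v) (hv' : OnRun K' n' v') (hyv' : Above y' v')
    (hw : Adapted K n w) (hw' : Adapted K' n' w')
    (hc : Even (w'.1 + w'.2) ↔ ¬ Even (y.1 + y.2)) (c c' : ℝ) :
    (L : ℝ≥0∞) ≤ l1 (pt w c) (pt w' c') := by
  obtain ⟨S, rfl, hS⟩ := separation_aux hp hle hN hv hyv hv' hyv'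
  refine le_trans ?_ (ENNReal.sum_le_tsum S)
  rw [Finset.cast_card]
  refine Finset.sum_le_sum fun x hx => ?_
  obtain ⟨-, h1, h2⟩ := hS x hx
  rw [pt_of_not_above (h1 w hw.1), pt_of_above (h2 (par w') hw'.2 ((even_par w').trans hc))]
  simp

/-- One common digit tells spine vertices from the others, and spine vertices of equal depth and
colour coincide. So `y` and `y'` are siblings for `par` as well, and the walls between them apply,
taken in the order of `rank`. -/
theorem le_l1_of_digit_eq {d t : ℕ} {y y' : ℤ × ℤ} (ht : ∀ i < t, digit y i = digit y' i)
    (hdep : dep y = d + 1) (hdep' : dep y' = d + 1) (hpar : rpar y = rpar y') (hne : y ≠ y')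
    {K n K' n' : ℤ} {v v' w w' : ℤ × ℤ} (hv : OnRun K n v) (hv' : OnRun K' n' v')
    (hyv : ¬ Spine y → Above y v) (hyv' : ¬ Spine y' → Above y' v')
    (hw : Adapted K n w) (hw' : Adapted K' n' w')
    (hc : Even (w.1 + w.2) ↔ ¬ Even (y.1 + y.2)) (hc' : Even (w'.1 + w'.2) ↔ ¬ Even (y.1 + y.2))
    (c c' : ℝ) : (4 * t : ℝ≥0∞) ≤ l1 (pt w c) (pt w' c') := by
  rcases Nat.eq_zero_or_pos t with rfl | hpos
  · simp
  have hyy' : Even (y.1 + y.2) ↔ Even (y'.1 + y'.2) := by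
    rw [← even_rpar y, ← even_rpar y', hpar]
  have hsp := (exists_digits.choose_spec y y' t hpos ht).1
  have hns : ¬ Spine y := by
    intro hs
    have hs' := hsp.1 hs
    have e1 := hs.dep_eq
    have e2 := hs'.dep_eq
    rw [hdep] at e1
    rw [hdep'] at e2
    have h3 := hs.2
    have h4 := hs'.2
    rw [hs.1, hs'.1] at hyy'
    simp only [Int.even_iff] at hyy'
    exact hne (Prod.ext (by omega) (hs.1.trans hs'.1.symm))
  have hns' : ¬ Spine y' := hsp.not.1 hns
  rw [rpar_of_not_spine hns, rpar_of_not_spine hns'] at hpar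
  rcases rank_lt_or hpar hne with hr | hr
  · obtain ⟨L, hL, hN⟩ := (exists_digits.choose_spec y y' t hpos ht).2 hns hpar hr
    refine le_trans ?_ (card_le_l1 hpar (fst_le_of_rank_lt hpar hr) hN hv (hyv hns) hv' (hyv' hns')
      hw hw' hc' c c')
    exact_mod_cast hL
  · obtain ⟨L, hL, hN⟩ := (exists_digits.choose_spec y' y t hpos fun i hi => (ht i hi).symm).2 hns'
      hpar.symm hr
    rw [l1_comm]
    refine le_trans ?_ (card_le_l1 hpar.symm (fst_le_of_rank_lt hpar.symm hr) hN hv' (hyv' hns') hv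
      (hyv hns) hw' hw (by rw [← hyy']; exact hc) c' c)
    exact_mod_cast hL

/-! ### Realization of the forest by words -/

/-- A map from words and positions to a metric space as for the rays of an exponentially branching
tree. -/
structure WordMap (E : Type*) [PseudoEMetricSpace E] (R : ℕ) where
  /-- The ray belonging to a word. -/
  toFun : ((a : ℕ) → Fin a → Fin base) → ℝ → E
  edist_le : ∀ W s s', edist (toFun W s) (toFun W s') ≤ R * ENNReal.ofReal |s - s'|
  congr : ∀ W W' (i : ℕ), (∀ a ≤ i, W a = W' a) → ∀ s : ℝ, s ≤ i → toFun W s = toFun W' s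
  le_edist : ∀ W W' s s', 0 ≤ s → 0 ≤ s' →
    R * ENNReal.ofReal |s - s'| ≤ edist (toFun W s) (toFun W' s')
  le_edist_of_ne : ∀ W W' (i : ℕ), W (i + 1) ≠ W' (i + 1) → ∀ s s' : ℝ, i ≤ s → i ≤ s' →
    R * ENNReal.ofReal (s + s' - 2 * i) ≤ edist (toFun W s) (toFun W' s')

/-- The lower endpoint of an edge in the rooted forest. -/
def top (v : ℤ × ℤ) : ℤ × ℤ := if Spine v then par v else v

/-- The parameter of a point of an edge in the rooted forest. -/
noncomputable def topParam (v : ℤ × ℤ) (b : ℝ) : ℝ := if Spine v then 1 - b else b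

theorem dep_top (v : ℤ × ℤ) : dep (top v) ≠ 0 := by
  unfold top
  split_ifs with h
  · rw [h.dep_par]; omega
  · rw [dep_of_not_spine h]; omega

theorem even_top (v : ℤ × ℤ) : Even ((top v).1 + (top v).2) ↔ Even (v.1 + v.2) := by
  unfold top
  split_ifs
  · exact even_par v
  · rfl

theorem pt_eq_rpt (v : ℤ × ℤ) (b : ℝ) : pt v b = rpt (top v) (topParam v b) := by
  ext y
  unfold pt rpt top topParam
  split_ifs with h
  · rw [h.rpar_par]; ring
  · rw [rpar_of_not_spine h]

theorem topParam_mem {b : ℝ} (hb : b ∈ Set.Icc (0 : ℝ) 1) (v : ℤ × ℤ) :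
    topParam v b ∈ Set.Icc (0 : ℝ) 1 := by
  unfold topParam
  split_ifs
  · exact ⟨by linarith [hb.2], by linarith [hb.1]⟩
  · exact hb

theorem above_of_anc {v : ℤ × ℤ} {d : ℕ} (h : ¬ Spine (anc d (top v))) :
    Above (anc d (top v)) v := by
  obtain ⟨h1, h2⟩ := not_spine_of_rpar_iterate h
  have h3 : top v = v := by
    unfold top at h1 ⊢
    split_ifs at h1 ⊢ with hs
    · exact absurd hs.par h1
    · rfl
  exact ⟨dep (top v) - d, by rw [anc, h2, h3]⟩

variable {E : Type*} [PseudoEMetricSpace E] {R : ℕ}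

/-- The image of a vertex. -/
noncomputable def WordMap.vert (Φ : WordMap E R) (v : ℤ × ℤ) : E := Φ.toFun (word v) (dep v)

/-- The image of the point at parameter `b` of the edge from `par v` to `v`. -/
noncomputable def WordMap.edge (Φ : WordMap E R) (v : ℤ × ℤ) (b : ℝ) : E :=
  Φ.toFun (word (top v)) (dep (top v) - 1 + topParam v b)

theorem WordMap.toFun_rpar (Φ : WordMap E R) {v : ℤ × ℤ} (h : dep v ≠ 0) :
    Φ.toFun (word v) (dep v - 1) = Φ.vert (rpar v) := by
  have h1 := dep_rpar h
  have h2 : (dep v : ℝ) - 1 = dep (rpar v) := by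
    rw [← h1]; push_cast; ring
  rw [vert, h2]
  refine Φ.congr _ _ (dep (rpar v)) (fun a ha => (word_rpar ?_).symm) _ le_rfl
  omega

theorem WordMap.edge_zero (Φ : WordMap E R) (v : ℤ × ℤ) : Φ.edge v 0 = Φ.vert (par v) := by
  unfold edge topParam top
  split_ifs with h
  · rw [vert]; congr 1; ring
  · rw [add_zero, Φ.toFun_rpar (by rw [dep_of_not_spine h]; omega), rpar_of_not_spine h]

theorem WordMap.edge_one (Φ : WordMap E R) (v : ℤ × ℤ) : Φ.edge v 1 = Φ.vert v := by
  unfold edge topParam top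
  split_ifs with h
  · rw [sub_self, add_zero, Φ.toFun_rpar (by rw [h.dep_par]; omega), h.rpar_par]
  · rw [vert]; congr 1; ring

theorem WordMap.edist_edge_le (Φ : WordMap E R) (v : ℤ × ℤ) (b b' : ℝ) :
    edist (Φ.edge v b) (Φ.edge v b') ≤ R * ENNReal.ofReal |b - b'| := by
  refine (Φ.edist_le _ _ _).trans (le_of_eq ?_)
  unfold topParam
  split_ifs
  · rw [abs_sub_comm b b']; congr 3; ring
  · congr 3; ring

theorem l1_pt_ne_top {v v' : ℤ × ℤ} (hc : Even (v.1 + v.2) ↔ Even (v'.1 + v'.2)) {b b' : ℝ}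
    (hb : b ∈ Set.Icc (0 : ℝ) 1) (hb' : b' ∈ Set.Icc (0 : ℝ) 1) : l1 (pt v b) (pt v' b') ≠ ⊤ := by
  have key : ∀ v, ∀ b ∈ Set.Icc (0 : ℝ) 1, l1 (pt v b) (ind (anc 0 (top v))) ≠ ⊤ := by
    intro v b hb
    rw [pt_eq_rpt]
    refine ne_top_of_le_ne_top ENNReal.ofReal_ne_top (l1_rpt_anc_le (d := 0) ?_
      (topParam_mem hb v).1)
    have := dep_top v
    omega
  have h0 : anc 0 (top v) = anc 0 (top v') := eq_of_dep_eq_zero (dep_anc (Nat.zero_le _))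
    (dep_anc (Nat.zero_le _))
    (by rw [anc, anc, even_rpar_iterate, even_rpar_iterate, even_top, even_top]; exact hc)
  refine ne_top_of_le_ne_top (ENNReal.add_ne_top.2 ⟨key v b hb, ?_⟩) (l1_triangle _ _ _)
  rw [l1_comm, h0]
  exact key v' b' hb'

theorem ofReal_le_add_of_le {x y : ℝ} {t : ℕ} (h : x ≤ y + 2 * t) :
    2 * ENNReal.ofReal x ≤ 2 * ENNReal.ofReal y + 4 * t := by
  have h1 : ENNReal.ofReal x ≤ ENNReal.ofReal y + 2 * t := by
    refine (ENNReal.ofReal_le_ofReal h).trans (ENNReal.ofReal_add_le.trans (le_of_eq ?_))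
    rw [ENNReal.ofReal_mul zero_le_two, ENNReal.ofReal_natCast, ENNReal.ofReal_ofNat]
  refine (mul_le_mul_right h1 2).trans (le_of_eq ?_)
  ring

/-- In the forest the points are joined through a branch point of depth `d`, while the rays may
separate `t` steps later if `t` digits agree. This loses at most `2 * t`, and the points of the
other tree are then at ℓ¹ distance at least `4 * t`. -/
theorem WordMap.l1_le (Φ : WordMap E R) {K n K' n' : ℤ} {v v' w w' : ℤ × ℤ}
    (hv : Adapted K n v) (hv' : Adapted K' n' v') (hw : Adapted K n w) (hw' : Adapted K' n' w')
    (hc : Even (v.1 + v.2) ↔ Even (v'.1 + v'.2)) (hwc : Even (w.1 + w.2) ↔ ¬ Even (v.1 + v.2))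
    (hwc' : Even (w'.1 + w'.2) ↔ ¬ Even (v.1 + v.2)) {b b' : ℝ} (hb : b ∈ Set.Icc (0 : ℝ) 1)
    (hb' : b' ∈ Set.Icc (0 : ℝ) 1) (c c' : ℝ) :
    2 * (R * l1 (pt v b) (pt v' b')) ≤
      2 * edist (Φ.edge v b) (Φ.edge v' b') + R * l1 (pt w c) (pt w' c') := by
  have hβ := topParam_mem hb v
  have hβ' := topParam_mem hb' v'
  have hd := dep_top v
  have hd' := dep_top v'
  have hr : (1 : ℝ) ≤ dep (top v) := by exact_mod_cast Nat.one_le_iff_ne_zero.2 hd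
  have hr' : (1 : ℝ) ≤ dep (top v') := by exact_mod_cast Nat.one_le_iff_ne_zero.2 hd'
  rw [pt_eq_rpt v, pt_eq_rpt v']
  unfold edge
  set β := topParam v b
  set β' := topParam v' b'
  have hdist := Φ.le_edist (word (top v)) (word (top v')) (dep (top v) - 1 + β)
    (dep (top v') - 1 + β') (by linarith [hβ.1]) (by linarith [hβ'.1])
  rcases anc_cases (v := top v) (v' := top v') (by rw [even_top, even_top]; exact hc) with
    ⟨h1, h2⟩ | ⟨h1, h2⟩ | ⟨d, h1, h2, h3, h4⟩
  · refine le_trans ?_ le_self_add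
    refine mul_le_mul_right (le_trans ?_ hdist) 2
    exact mul_le_mul_right (l1_rpt_desc_le hd h2 h1 hβ.2 hβ'.1) _
  · refine le_trans ?_ le_self_add
    refine mul_le_mul_right (le_trans ?_ hdist) 2
    rw [l1_comm, abs_sub_comm]
    exact mul_le_mul_right (l1_rpt_desc_le hd' h2 h1 hβ'.2 hβ.1) _
  · have h5 : l1 (rpt (top v) β) (rpt (top v') β') ≤ ENNReal.ofReal
        (dep (top v) - 1 + β + (dep (top v') - 1 + β') - 2 * d) := by
      have e1 := l1_rpt_anc_le h1 hβ.1
      have e2 := l1_rpt_anc_le h2 hβ'.1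
      rw [l1_comm, ← h3] at e2
      refine (l1_triangle _ _ _).trans ((add_le_add e1 e2).trans ?_)
      have e3 : (d : ℝ) + 1 ≤ dep (top v) := by exact_mod_cast h1
      have e4 : (d : ℝ) + 1 ≤ dep (top v') := by exact_mod_cast h2
      rw [← ENNReal.ofReal_add (by linarith [hβ.1]) (by linarith [hβ'.1])]
      exact ENNReal.ofReal_le_ofReal (by linarith)
    obtain ⟨t, ht1, ht2⟩ : ∃ t : ℕ,
        (∀ i < t, digit (anc (d + 1) (top v)) i = digit (anc (d + 1) (top v')) i) ∧
        ∃ z : ℝ, R * ENNReal.ofReal z ≤ edist (Φ.toFun (word (top v)) (dep (top v) - 1 + β))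
          (Φ.toFun (word (top v')) (dep (top v') - 1 + β')) ∧
          dep (top v) - 1 + β + (dep (top v') - 1 + β') - 2 * d ≤ z + 2 * t := by
      classical
      by_cases hall : ∀ i < min (dep (top v)) (dep (top v')) - d,
          digit (anc (d + 1) (top v)) i = digit (anc (d + 1) (top v')) i
      -- The rays need not separate within the given depths. Then only the difference of the
      -- positions is used; the loss is twice the smaller distance to the branch point.
      · refine ⟨_, hall, _, hdist, ?_⟩
        rcases le_total (dep (top v)) (dep (top v')) with h | h
        · rw [min_eq_left h, Nat.cast_sub (by omega)]
          have := neg_abs_le (dep (top v) - 1 + β - (dep (top v') - 1 + β'))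
          linarith [hβ.2, hβ'.2]
        · rw [min_eq_right h, Nat.cast_sub (by omega)]
          have := le_abs_self (dep (top v) - 1 + β - (dep (top v') - 1 + β'))
          linarith [hβ.2, hβ'.2]
      · push Not at hall
        obtain ⟨t, ⟨ht1, ht2⟩, ht3⟩ : ∃ t, (t < min (dep (top v)) (dep (top v')) - d ∧
            digit (anc (d + 1) (top v)) t ≠ digit (anc (d + 1) (top v')) t) ∧
            ∀ i < t, digit (anc (d + 1) (top v)) i = digit (anc (d + 1) (top v')) i := by
          refine ⟨Nat.find hall, Nat.find_spec hall, fun i hi => ?_⟩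
          have h := Nat.find_min hall hi
          have hlt := (Nat.find_spec hall).1
          by_contra hne
          exact h ⟨by omega, hne⟩
        have e1 : ((d + t : ℕ) : ℝ) + 1 ≤ dep (top v) := by
          exact_mod_cast (show d + t + 1 ≤ dep (top v) by omega)
        have e2 : ((d + t : ℕ) : ℝ) + 1 ≤ dep (top v') := by
          exact_mod_cast (show d + t + 1 ≤ dep (top v') by omega)
        refine ⟨t, ht3, _, Φ.le_edist_of_ne _ _ (d + t) (word_ne ht2) _ _
          (by linarith [hβ.1]) (by linarith [hβ'.1]), ?_⟩
        push_cast
        linarith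
    obtain ⟨z, hz1, hz2⟩ := ht2
    have h6 := le_l1_of_digit_eq ht1 (dep_anc h1) (dep_anc h2)
      (by rw [rpar_anc h1, rpar_anc h2, h3]) h4 hv.1 hv'.1 above_of_anc above_of_anc hw hw'
      (by rw [anc, even_rpar_iterate, even_top]; exact hwc)
      (by rw [anc, even_rpar_iterate, even_top]; exact hwc') c c'
    calc 2 * (R * l1 (rpt (top v) β) (rpt (top v') β')) = R * (2 * l1 (rpt (top v) β)
          (rpt (top v') β')) := by ring
      _ ≤ R * (2 * ENNReal.ofReal z + 4 * t) :=
          mul_le_mul_right ((mul_le_mul_right h5 2).trans (ofReal_le_add_of_le hz2)) _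
      _ = 2 * (R * ENNReal.ofReal z) + R * (4 * t) := by ring
      _ ≤ _ := add_le_add (mul_le_mul_right hz1 2) (mul_le_mul_right h6 _)

/-- The two images of the forest determine the `ℓ¹` distances. -/
theorem WordMap.l1_add_le (Φ : WordMap E R) {K n K' n' : ℤ} {v v' w w' : ℤ × ℤ}
    (hv : Adapted K n v) (hv' : Adapted K' n' v') (hw : Adapted K n w) (hw' : Adapted K' n' w')
    (hc : Even (v.1 + v.2) ↔ Even (v'.1 + v'.2)) (hwc : Even (w.1 + w.2) ↔ ¬ Even (v.1 + v.2))
    (hwc' : Even (w'.1 + w'.2) ↔ ¬ Even (v.1 + v.2)) {b b' c c' : ℝ}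
    (hb : b ∈ Set.Icc (0 : ℝ) 1) (hb' : b' ∈ Set.Icc (0 : ℝ) 1) (hcc : c ∈ Set.Icc (0 : ℝ) 1)
    (hcc' : c' ∈ Set.Icc (0 : ℝ) 1) :
    R * (l1 (pt v b) (pt v' b') + l1 (pt w c) (pt w' c')) ≤
      2 * (edist (Φ.edge v b) (Φ.edge v' b') + edist (Φ.edge w c) (Φ.edge w' c')) := by
  have h1 := Φ.l1_le hv hv' hw hw' hc hwc hwc' hb hb' c c'
  have h2 := Φ.l1_le hw hw' hv hv' (by rw [hwc, hwc']) (by rw [hwc]; tauto) (by rw [hwc]; tauto)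
    hcc hcc' b b'
  have f1 := l1_pt_ne_top hc hb hb'
  have f2 := l1_pt_ne_top (v := w) (v' := w') (by rw [hwc, hwc']) hcc hcc'
  set x := l1 (pt v b) (pt v' b')
  set y := l1 (pt w c) (pt w' c')
  have h3 : R * (x + y) + R * (x + y) ≤
      2 * (edist (Φ.edge v b) (Φ.edge v' b') + edist (Φ.edge w c) (Φ.edge w' c')) +
        R * (x + y) := by
    calc R * (x + y) + R * (x + y) = 2 * (R * x) + 2 * (R * y) := by ring
      _ ≤ _ := add_le_add h1 h2
      _ = _ := by ring
  -- The term to be cancelled is finite because points of equal colour are joined to a common root.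
  exact (ENNReal.add_le_add_iff_right
    (ENNReal.mul_ne_top (ENNReal.natCast_ne_top R) (ENNReal.add_ne_top.2 ⟨f1, f2⟩))).1 h3

end TernaryForest

namespace TernaryForest

/-! ### Coordinates in a cell -/

/-- The position in the resting tree. -/
noncomputable def restPos (u y : ℝ) : ℝ := min y (3 - 6 * u)

/-- The rescaled horizontal coordinate. -/
noncomputable def xi (u y : ℝ) : ℝ := min 1 (6 * u / (3 - y))

/-- The position in the travel tree in terms of the rescaled coordinates. -/
noncomputable def travelAux (l ξ y : ℝ) : ℝ :=
  -- Interpolates between `y = 0`, a half-run of length `l` at constant speed, and `y = 1`, a path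
  -- from `-1` to `l + 1` whose parts `ξ ≤ 1 / 2` and `ξ ≥ 1 / 2` are the halves, of lengths 2 and
  -- `l`, of the outer child run.
  (1 - y) * (l * ξ) + y * (min (4 * ξ) (2 - l + 2 * l * ξ) - 1)

/-- The position in the travel tree. -/
noncomputable def travelPos (l u y : ℝ) : ℝ := travelAux l (xi u y) y

theorem restPos_mem {u y : ℝ} (hu : u ∈ Set.Icc (0 : ℝ) (1 / 2)) (hy : y ∈ Set.Icc (0 : ℝ) 1) :
    restPos u y ∈ Set.Icc (0 : ℝ) 1 :=
  ⟨le_min hy.1 (by linarith [hu.2]), (min_le_left _ _).trans hy.2⟩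

theorem xi_mem {u y : ℝ} (hu : 0 ≤ u) (hy : y ≤ 1) : xi u y ∈ Set.Icc (0 : ℝ) 1 :=
  ⟨le_min zero_le_one (div_nonneg (by linarith) (by linarith)), min_le_left _ _⟩

/-- The monotonicity of the position in the travel tree. -/
theorem travelAux_sub_mem {l ξ ξ' y : ℝ} (hl : l = 1 ∨ l = 2) (hy : y ∈ Set.Icc (0 : ℝ) 1)
    (h : ξ ≤ ξ') :
    travelAux l ξ' y - travelAux l ξ y ∈ Set.Icc (ξ' - ξ) (4 * (ξ' - ξ)) := by
  have hχ : min (4 * ξ') (2 - l + 2 * l * ξ') - min (4 * ξ) (2 - l + 2 * l * ξ) ∈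
      Set.Icc (2 * (ξ' - ξ)) (4 * (ξ' - ξ)) := by
    rcases hl with rfl | rfl <;>
      rcases min_cases (4 * ξ') (2 - _ + 2 * _ * ξ') with ⟨e, h1⟩ | ⟨e, h1⟩ <;>
      rcases min_cases (4 * ξ) (2 - _ + 2 * _ * ξ) with ⟨e', h2⟩ | ⟨e', h2⟩ <;>
      rw [e, e'] <;> constructor <;> linarith
  have e : travelAux l ξ' y - travelAux l ξ y = (1 - y) * (l * (ξ' - ξ)) +
      y * (min (4 * ξ') (2 - l + 2 * l * ξ') - min (4 * ξ) (2 - l + 2 * l * ξ)) := by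
    unfold travelAux; ring
  have h1 : l * (ξ' - ξ) ∈ Set.Icc (ξ' - ξ) (2 * (ξ' - ξ)) := by
    rcases hl with rfl | rfl <;> constructor <;> linarith
  rw [e]
  have hy0 := hy.1
  have hy1 := sub_nonneg.2 hy.2
  constructor
  · nlinarith [mul_le_mul_of_nonneg_left h1.1 hy1, mul_le_mul_of_nonneg_left hχ.1 hy0]
  · nlinarith [mul_le_mul_of_nonneg_left h1.2 hy1, mul_le_mul_of_nonneg_left hχ.2 hy0]

theorem travelAux_zero {l : ℝ} (hl : l = 1 ∨ l = 2) (y : ℝ) : travelAux l 0 y = -y := by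
  rcases hl with rfl | rfl <;> norm_num [travelAux]

theorem travelAux_one {l : ℝ} (hl : l = 1 ∨ l = 2) (y : ℝ) : travelAux l 1 y = l + y := by
  rcases hl with rfl | rfl <;> norm_num [travelAux] <;> ring

theorem abs_travelAux_sub_le {l ξ ξ' y y' : ℝ} (hl : l = 1 ∨ l = 2) (hy : y ∈ Set.Icc (0 : ℝ) 1)
    (hξ' : ξ' ∈ Set.Icc (0 : ℝ) 1) :
    |travelAux l ξ y - travelAux l ξ' y'| ≤ 4 * |ξ - ξ'| + 3 * |y - y'| := by
  have h1 : |travelAux l ξ y - travelAux l ξ' y| ≤ 4 * |ξ - ξ'| := by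
    rcases le_total ξ ξ' with h | h
    · have := travelAux_sub_mem hl hy h
      rw [abs_sub_comm, abs_sub_comm ξ, abs_of_nonneg (by linarith [this.1]),
        abs_of_nonneg (by linarith)]
      exact this.2
    · have := travelAux_sub_mem hl hy h
      rw [abs_of_nonneg (by linarith [this.1]), abs_of_nonneg (by linarith)]
      exact this.2
  have h2 : |travelAux l ξ' y - travelAux l ξ' y'| ≤ 3 * |y - y'| := by
    have e : travelAux l ξ' y - travelAux l ξ' y' =
        (min (4 * ξ') (2 - l + 2 * l * ξ') - 1 - l * ξ') * (y - y') := by unfold travelAux; ring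
    rw [e, abs_mul]
    refine mul_le_mul_of_nonneg_right ?_ (abs_nonneg _)
    rw [abs_le]
    have h3 := hξ'.1
    have h4 := hξ'.2
    rcases hl with rfl | rfl <;>
      rcases min_cases (4 * ξ') (2 - _ + 2 * _ * ξ') with ⟨e, h1⟩ | ⟨e, h1⟩ <;>
      rw [e] <;> constructor <;> linarith
  exact (abs_sub_le _ (travelAux l ξ' y) _).trans (add_le_add h1 h2)

theorem abs_xi_sub_le_left {u u' y : ℝ} (hy : y ≤ 1) : |xi u y - xi u' y| ≤ 3 * |u - u'| := by
  refine (abs_min_sub_min_le_max _ _ _ _).trans ?_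
  rw [sub_self, abs_zero, max_eq_right (abs_nonneg _), ← sub_div, abs_div,
    abs_of_pos (show (0 : ℝ) < 3 - y by linarith), div_le_iff₀ (by linarith), ← mul_sub, abs_mul,
    abs_of_pos (show (0 : ℝ) < 6 by norm_num)]
  nlinarith [abs_nonneg (u - u')]

theorem abs_xi_sub_le_right {u y y' : ℝ} (hu : u ∈ Set.Icc (0 : ℝ) (1 / 2)) (hy : y ≤ 1)
    (hy' : y' ≤ 1) : |xi u y - xi u y'| ≤ |y - y'| := by
  refine (abs_min_sub_min_le_max _ _ _ _).trans ?_
  have h1 : (0 : ℝ) < 3 - y := by linarith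
  have h2 : (0 : ℝ) < 3 - y' := by linarith
  rw [sub_self, abs_zero, max_eq_right (abs_nonneg _), div_sub_div _ _ h1.ne' h2.ne',
    show 6 * u * (3 - y') - (3 - y) * (6 * u) = 6 * u * (y - y') by ring, abs_div,
    abs_of_pos (mul_pos h1 h2), div_le_iff₀ (mul_pos h1 h2), abs_mul,
    abs_of_nonneg (by linarith [hu.1]), mul_comm]
  refine mul_le_mul_of_nonneg_left ?_ (abs_nonneg _)
  nlinarith [hu.2]

theorem abs_travelPos_sub_le_left {l u u' y : ℝ} (hl : l = 1 ∨ l = 2) (hu' : 0 ≤ u')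
    (hy : y ∈ Set.Icc (0 : ℝ) 1) : |travelPos l u y - travelPos l u' y| ≤ 12 * |u - u'| := by
  have h1 := abs_travelAux_sub_le (y' := y) (ξ := xi u y) hl hy (xi_mem hu' hy.2)
  have h2 := abs_xi_sub_le_left (u := u) (u' := u') hy.2
  rw [sub_self, abs_zero] at h1
  unfold travelPos
  linarith

theorem abs_travelPos_sub_le_right {l u y y' : ℝ} (hl : l = 1 ∨ l = 2)
    (hu : u ∈ Set.Icc (0 : ℝ) (1 / 2)) (hy : y ∈ Set.Icc (0 : ℝ) 1) (hy' : y' ≤ 1) :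
    |travelPos l u y - travelPos l u y'| ≤ 7 * |y - y'| := by
  have h1 := abs_travelAux_sub_le (y' := y') (ξ := xi u y) hl hy (xi_mem hu.1 hy')
  have h2 := abs_xi_sub_le_right hu hy.2 hy'
  unfold travelPos
  linarith

theorem abs_restPos_sub_le (u u' y y' : ℝ) :
    |restPos u y - restPos u' y'| ≤ |y - y'| + 6 * |u - u'| := by
  refine (abs_min_sub_min_le_max _ _ _ _).trans (max_le ?_ ?_)
  · linarith [abs_nonneg (u - u')]
  · rw [show 3 - 6 * u - (3 - 6 * u') = (-6) * (u - u') by ring, abs_mul]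
    norm_num

theorem travelPos_mem {l u y : ℝ} (hl : l = 1 ∨ l = 2) (hu : 0 ≤ u) (hy : y ∈ Set.Icc (0 : ℝ) 1) :
    travelPos l u y ∈ Set.Icc (-y) (l + y) := by
  have hx := xi_mem hu hy.2
  have h1 := (travelAux_sub_mem hl hy hx.1).1
  have h2 := (travelAux_sub_mem hl hy hx.2).1
  rw [travelAux_zero hl] at h1
  rw [travelAux_one hl] at h2
  unfold travelPos
  constructor <;> linarith [hx.1, hx.2]

theorem travelPos_zero {l : ℝ} (hl : l = 1 ∨ l = 2) (y : ℝ) : travelPos l 0 y = -y := by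
  unfold travelPos xi; simp [travelAux_zero hl]

/-- Beyond the slanted line `y = 3 - 6 * u` lies the region of the middle third: there the travel
position depends only on `y`, and the rest position varies with `u`. -/
theorem xi_eq_one {u y : ℝ} (hy : y ≤ 1) (h : 3 - 6 * u ≤ y) : xi u y = 1 :=
  min_eq_left ((le_div_iff₀ (by linarith)).2 (by linarith))

theorem travelPos_of_le {l u y : ℝ} (hl : l = 1 ∨ l = 2) (hy : y ≤ 1) (h : 3 - 6 * u ≤ y) :
    travelPos l u y = l + y := by
  rw [travelPos, xi_eq_one hy h, travelAux_one hl]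

/-- The two regions of a cell. -/
theorem cell_cases {l u y : ℝ} (hl : l = 1 ∨ l = 2) (hy : y ≤ 1) :
    (3 - 6 * u ≤ y ∧ restPos u y = 3 - 6 * u ∧ travelPos l u y = l + y) ∨
      (restPos u y = y ∧ 6 * u = xi u y * (3 - y)) := by
  rcases le_total (3 - 6 * u) y with h | h
  · exact Or.inl ⟨h, min_eq_right h, travelPos_of_le hl hy h⟩
  · right
    refine ⟨min_eq_left h, ?_⟩
    have h3 : (0 : ℝ) < 3 - y := by linarith
    rw [xi, min_eq_right ((div_le_one h3).2 (by linarith)), div_mul_cancel₀ _ h3.ne']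

/-- The positions determine the point of the cell. -/
theorem abs_sub_le_of_pos {l u u' y y' δ : ℝ} (hl : l = 1 ∨ l = 2) (hu : 0 ≤ u) (hu' : 0 ≤ u')
    (hy : y ∈ Set.Icc (0 : ℝ) 1) (hy' : y' ∈ Set.Icc (0 : ℝ) 1)
    (ha : |travelPos l u y - travelPos l u' y'| ≤ δ) (hb : |restPos u y - restPos u' y'| ≤ δ) :
    |u - u'| ≤ 3 * δ ∧ |y - y'| ≤ δ := by
  have hδ : 0 ≤ δ := (abs_nonneg _).trans ha
  -- The first point lies before the slanted line, the second beyond it, where the travel position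
  -- is `l + y'`.
  have mixed : ∀ u u' y y', 0 ≤ u → y ∈ Set.Icc (0 : ℝ) 1 →
      restPos u y = y → 6 * u = xi u y * (3 - y) → 3 - 6 * u' ≤ y' → restPos u' y' = 3 - 6 * u' →
      travelPos l u' y' = l + y' → |travelPos l u y - travelPos l u' y'| ≤ δ →
      |restPos u y - restPos u' y'| ≤ δ → |u - u'| ≤ 3 * δ ∧ |y - y'| ≤ δ := by
    intro u u' y y' hu hy h1 h2 h3 h4 h5 ha hb
    rw [h1, h4] at hb
    rw [h5] at ha
    have hx := xi_mem hu hy.2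
    have h6 := (travelAux_sub_mem hl hy hx.2).1
    rw [travelAux_one hl, ← travelPos] at h6
    rw [abs_le] at ha hb
    have h7 : 1 - xi u y ≤ 2 * δ := by linarith
    have h8 : 3 - y - 6 * u ≤ 6 * δ := by
      rw [h2]
      nlinarith [hy.1, hx.2]
    have h9 : 0 ≤ 3 - y - 6 * u := by
      rw [h2]
      nlinarith [hy.2, hx.2]
    constructor <;> rw [abs_le] <;> constructor <;> linarith [hx.2]
  rcases cell_cases (u := u) hl hy.2 with ⟨h1, h2, h3⟩ | ⟨h1, h2⟩ <;>
    rcases cell_cases (u := u') hl hy'.2 with ⟨h1', h2', h3'⟩ | ⟨h1', h2'⟩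
  · rw [h3, h3'] at ha
    rw [h2, h2'] at hb
    rw [abs_le] at ha hb
    refine ⟨abs_le.2 ⟨?_, ?_⟩, abs_le.2 ⟨?_, ?_⟩⟩ <;> linarith
  · have := mixed u' u y' y hu' hy' h1' h2' h1 h2 h3 (by rwa [abs_sub_comm])
      (by rwa [abs_sub_comm])
    rwa [abs_sub_comm, abs_sub_comm y'] at this
  · exact mixed u u' y y' hu hy h1 h2 h1' h2' h3' ha hb
  · rw [h1, h1'] at hb
    have hx := xi_mem hu hy.2
    have hx' := xi_mem hu' hy'.2
    have h5 := abs_travelAux_sub_le (y' := y) (ξ := xi u' y') hl hy' hx'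
    have h7 : |travelAux l (xi u y) y - travelAux l (xi u' y') y| ≤ 4 * δ := by
      refine (abs_sub_le _ (travelAux l (xi u' y') y') _).trans ?_
      rw [sub_self, abs_zero, abs_sub_comm y'] at h5
      unfold travelPos at ha
      linarith
    have h8 : |xi u y - xi u' y'| ≤ 4 * δ := by
      refine le_trans ?_ h7
      rcases le_total (xi u y) (xi u' y') with h | h
      · have := (travelAux_sub_mem hl hy h).1
        rw [abs_sub_comm, abs_of_nonneg (by linarith), abs_sub_comm, abs_of_nonneg (by linarith)]
        exact this
      · have := (travelAux_sub_mem hl hy h).1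
        rw [abs_of_nonneg (by linarith), abs_of_nonneg (by linarith)]
        exact this
    refine ⟨?_, hb⟩
    have h9 : 6 * (u - u') = (xi u y - xi u' y') * (3 - y) + xi u' y' * (y' - y) := by
      linear_combination h2 - h2'
    have h10 : |(xi u y - xi u' y') * (3 - y)| ≤ 4 * δ * 3 := by
      rw [abs_mul]
      refine mul_le_mul h8 ?_ (abs_nonneg _) (by linarith)
      rw [abs_of_nonneg (by linarith [hy.2])]
      linarith [hy.1]
    have h11 : |xi u' y' * (y' - y)| ≤ 1 * δ := by
      rw [abs_mul, abs_sub_comm y']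
      refine mul_le_mul ?_ hb (abs_nonneg _) zero_le_one
      rw [abs_of_nonneg hx'.1]
      exact hx'.2
    rw [abs_le] at *
    constructor <;> linarith

/-- Points whose positions are close to the center line. -/
theorem center_le_of_pos {l u y δ : ℝ} (hl : l = 1 ∨ l = 2) (hu : u ∈ Set.Icc (0 : ℝ) (1 / 2))
    (hy : y ∈ Set.Icc (0 : ℝ) 1) (hb : restPos u y ≤ δ) (ha : l - δ ≤ travelPos l u y) :
    1 / 2 - u ≤ 2 * δ ∧ |y - max (travelPos l u y - l) 0| ≤ δ := by
  rcases cell_cases (u := u) hl hy.2 with ⟨h1, h2, h3⟩ | ⟨h1, h2⟩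
  · have hδ : 0 ≤ δ := (restPos_mem hu hy).1.trans hb
    rw [h2] at hb
    rw [h3, add_sub_cancel_left, max_eq_left hy.1, sub_self, abs_zero]
    exact ⟨by linarith, hδ⟩
  · rw [h1] at hb
    have hx := xi_mem hu.1 hy.2
    have h6 := (travelAux_sub_mem hl hy hx.2).1
    rw [travelAux_one hl, ← travelPos] at h6
    refine ⟨?_, ?_⟩
    · have : 1 - xi u y ≤ 2 * δ := by linarith
      nlinarith [hy.1, hx.2, hx.1]
    · have h7 := (travelPos_mem hl hu.1 hy).2
      rw [abs_le]
      have h8 := le_max_right (travelPos l u y - l) 0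
      have h9 : max (travelPos l u y - l) 0 ≤ y := max_le (by linarith) hy.1
      constructor <;> linarith [hy.1]

/-- Points whose positions are close to the boundary of the half-run. -/
theorem boundary_le_of_pos {l l' u u' y y' δ : ℝ} (hl : l = 1 ∨ l = 2) (hl' : l' = 1 ∨ l' = 2)
    (hu : u ∈ Set.Icc (0 : ℝ) (1 / 2)) (hu' : u' ∈ Set.Icc (0 : ℝ) (1 / 2))
    (hy : y ∈ Set.Icc (0 : ℝ) 1) (hy' : y' ∈ Set.Icc (0 : ℝ) 1) (hδ : δ < 1)
    (ha : |restPos u y + travelPos l' u' y'| ≤ δ) (hb : |restPos u' y' + travelPos l u y| ≤ δ) :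
    u ≤ δ ∧ u' ≤ δ ∧ |y - y'| ≤ δ := by
  have r := (restPos_mem hu hy).1
  have r' := (restPos_mem hu' hy').1
  rw [abs_le] at ha hb
  rcases cell_cases (u := u) hl hy.2 with ⟨h1, h2, h3⟩ | ⟨h1, h2⟩
  · rcases hl with rfl | rfl <;> linarith [hy.1]
  rcases cell_cases (u := u') hl' hy'.2 with ⟨h1', h2', h3'⟩ | ⟨h1', h2'⟩
  · rcases hl' with rfl | rfl <;> linarith [hy'.1]
  have hx := xi_mem hu.1 hy.2
  have hx' := xi_mem hu'.1 hy'.2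
  have h6 := (travelAux_sub_mem hl hy hx.1).1
  have h6' := (travelAux_sub_mem hl' hy' hx'.1).1
  rw [travelAux_zero hl, ← travelPos] at h6
  rw [travelAux_zero hl', ← travelPos] at h6'
  rw [h1] at ha
  rw [h1'] at hb
  refine ⟨?_, ?_, abs_le.2 ⟨?_, ?_⟩⟩
  · nlinarith [hy.1, hx.1, hx'.1]
  · nlinarith [hy'.1, hx.1, hx'.1]
  · linarith [hx.1]
  · linarith [hx'.1]

end TernaryForest

namespace TernaryForest

/-! ### The path in the travel tree -/

/-- The edges of the path in the travel tree. -/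
def travelEdge (k m ε j : ℤ) : ℤ × ℤ :=
  if j < 0 then (k + 1, 3 * m + 2 * ε) else if j = 0 then (k, m + ε) else
    if j < hl m ε then
      if par (par (k, m + ε)) = cen k m then par (k, m + ε) else cen k m
    else (k + 1, 3 * m)

/-- The parameter on the edges of the path in the travel tree. -/
noncomputable def travelParam (k m ε j : ℤ) (a : ℝ) : ℝ :=
  if j < 0 then -a else if j = 0 then 1 - a else
    if j < hl m ε then if par (par (k, m + ε)) = cen k m then 2 - a else a - 1
    else a - hl m ε

section

variable {k m ε j : ℤ}

theorem travelEdge_neg (hj : j < 0) : travelEdge k m ε j = (k + 1, 3 * m + 2 * ε) := if_pos hj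

theorem travelParam_neg (hj : j < 0) (a : ℝ) : travelParam k m ε j a = -a := if_pos hj

theorem travelEdge_zero : travelEdge k m ε 0 = (k, m + ε) := by simp [travelEdge]

theorem travelParam_zero (a : ℝ) : travelParam k m ε 0 a = 1 - a := by simp [travelParam]

theorem travelEdge_up (h2 : hl m ε = 2) (h : par (par (k, m + ε)) = cen k m) :
    travelEdge k m ε 1 = par (k, m + ε) := by simp [travelEdge, h2, h]

theorem travelParam_up (h2 : hl m ε = 2) (h : par (par (k, m + ε)) = cen k m) (a : ℝ) :
    travelParam k m ε 1 a = 2 - a := by simp [travelParam, h2, h]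

theorem travelEdge_down (h2 : hl m ε = 2) (h : par (par (k, m + ε)) ≠ cen k m) :
    travelEdge k m ε 1 = cen k m := by simp [travelEdge, h2, h]

theorem travelParam_down (h2 : hl m ε = 2) (h : par (par (k, m + ε)) ≠ cen k m) (a : ℝ) :
    travelParam k m ε 1 a = a - 1 := by simp [travelParam, h2, h]

theorem one_le_hl (hε : ε = 1 ∨ ε = -1) : (1 : ℤ) ≤ hl m ε := by
  rcases hl_eq m ε hε with h | h <;> rw [h] <;> norm_num

theorem travelEdge_last (hε : ε = 1 ∨ ε = -1) (hj : hl m ε ≤ j) :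
    travelEdge k m ε j = (k + 1, 3 * m) := by
  have := one_le_hl (m := m) hε
  rw [travelEdge, if_neg (by omega), if_neg (by omega), if_neg (by omega)]

theorem travelParam_last (hε : ε = 1 ∨ ε = -1) (hj : hl m ε ≤ j) (a : ℝ) :
    travelParam k m ε j a = a - hl m ε := by
  have := one_le_hl (m := m) hε
  rw [travelParam, if_neg (by omega), if_neg (by omega), if_neg (by omega)]

/-- The pieces of the path in the travel tree. -/
theorem travel_cases (hε : ε = 1 ∨ ε = -1) (j : ℤ) : j < 0 ∨ j = 0 ∨ hl m ε ≤ j ∨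
    (hl m ε = 2 ∧ j = 1) := by
  rcases hl_eq m ε hε with h | h <;> omega

theorem adapted_travelEdge (hε : ε = 1 ∨ ε = -1) (k m j : ℤ) :
    Adapted (k + 1) (3 * m + ε) (travelEdge k m ε j) := by
  have hup : up (3 * m + ε) = m := up_mul_add hε m
  have hε' : -ε = 1 ∨ -ε = -1 := by omega
  rw [Adapted, add_sub_cancel_right, hup]
  rcases travel_cases (m := m) hε j with h | rfl | h | ⟨h2, rfl⟩
  · rw [travelEdge_neg h, par_outer hε]
    have := OnRun.corner hε (k + 1) (3 * m + ε)
    rw [add_assoc, ← two_mul] at this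
    exact ⟨this, .corner hε _ _⟩
  · rw [travelEdge_zero]
    have := OnRun.par_corner hε (k + 1) (3 * m + ε)
    rw [add_assoc, ← two_mul, par_outer hε] at this
    exact ⟨this, .par_corner hε _ _⟩
  · rw [travelEdge_last hε h, par_middle]
    have := OnRun.corner hε' (k + 1) (3 * m + ε)
    rw [add_neg_cancel_right] at this
    exact ⟨this, .cen _ _⟩
  · by_cases h : par (par (k, m + ε)) = cen k m
    · rw [travelEdge_up h2 h, h]
      have := OnRun.cen (k + 1) (3 * m + ε)
      rw [cen_child hε] at this
      exact ⟨this, .cen _ _⟩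
    · have h' := (hl_eq_two_dir m ε hε h2 k).resolve_left h
      rw [travelEdge_down h2 h, h']
      have := OnRun.par_corner hε' (k + 1) (3 * m + ε)
      rw [add_neg_cancel_right, par_middle] at this
      exact ⟨this, .par_corner hε _ _⟩

theorem adapted_rest (hε : ε = 1 ∨ ε = -1) (k m : ℤ) :
    Adapted (k + 1) (3 * m + ε) (k + 1, 3 * m + ε) := by
  refine ⟨.self _ _, ?_⟩
  rw [par_child hε, add_sub_cancel_right, up_mul_add hε]
  exact .self _ _

theorem even_travelEdge (hε : ε = 1 ∨ ε = -1) (k m j : ℤ) :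
    Even ((travelEdge k m ε j).1 + (travelEdge k m ε j).2) ↔ ¬ Even (k + m) := by
  have h1 : Even (k + (m + ε)) ↔ ¬ Even (k + m) := by simp only [Int.even_iff]; omega
  rcases travel_cases (m := m) hε j with h | rfl | h | ⟨h2, rfl⟩
  · rw [travelEdge_neg h]; simp only [Int.even_iff]; omega
  · rw [travelEdge_zero]; exact h1
  · rw [travelEdge_last hε h]; simp only [Int.even_iff]; omega
  · by_cases h : par (par (k, m + ε)) = cen k m
    · rw [travelEdge_up h2 h, even_par]; exact h1
    · rw [travelEdge_down h2 h, even_cen]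

theorem travelParam_mem (hε : ε = 1 ∨ ε = -1) {a : ℝ} (h1 : -1 ≤ a) (h2 : a ≤ hl m ε + 1) :
    travelParam k m ε ⌊a⌋ a ∈ Set.Icc (0 : ℝ) 1 := by
  have f1 := Int.floor_le a
  have f2 := Int.lt_floor_add_one a
  rcases travel_cases (m := m) hε ⌊a⌋ with h | h | h | ⟨h', h⟩
  · rw [travelParam_neg h]
    have : a < 0 := by
      have : ((⌊a⌋ : ℤ) : ℝ) + 1 ≤ 0 := by exact_mod_cast h
      linarith
    constructor <;> linarith
  · rw [h] at f1 f2 ⊢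
    rw [travelParam_zero]
    push_cast at f1 f2
    constructor <;> linarith
  · rw [travelParam_last hε h]
    have : (hl m ε : ℝ) ≤ ⌊a⌋ := by exact_mod_cast h
    constructor <;> linarith
  · rw [h] at f1 f2 ⊢
    push_cast at f1 f2
    by_cases h : par (par (k, m + ε)) = cen k m
    · rw [travelParam_up h' h]; constructor <;> linarith
    · rw [travelParam_down h' h]; constructor <;> linarith

end

variable {E : Type*} [PseudoEMetricSpace E] {R : ℕ} (Φ : WordMap E R)

/-- The image of the path in the travel tree. -/
noncomputable def WordMap.travel (k m ε : ℤ) (a : ℝ) : E :=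
  Φ.edge (travelEdge k m ε ⌊a⌋) (travelParam k m ε ⌊a⌋ a)

theorem WordMap.travel_match {ε : ℤ} (hε : ε = 1 ∨ ε = -1) (k m j : ℤ) :
    Φ.edge (travelEdge k m ε j) (travelParam k m ε j (j + 1)) =
      Φ.edge (travelEdge k m ε (j + 1)) (travelParam k m ε (j + 1) (j + 1)) := by
  rcases travel_cases (m := m) hε j with h | rfl | h | ⟨h2, rfl⟩
  · rcases (show j + 1 < 0 ∨ j = -1 by omega) with h' | rfl
    · rw [travelEdge_neg h, travelEdge_neg h', travelParam_neg h, travelParam_neg h']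
    · rw [travelEdge_neg h, travelParam_neg h, neg_add_cancel, travelEdge_zero, travelParam_zero]
      push_cast
      rw [neg_add_cancel, neg_zero, sub_zero, Φ.edge_zero, Φ.edge_one, par_outer hε]
  · rw [travelEdge_zero, travelParam_zero]
    push_cast
    simp only [zero_add]
    rw [sub_self, Φ.edge_zero]
    rcases hl_eq m ε hε with h1 | h2
    · rw [travelEdge_last hε (by rw [h1]; rfl), travelParam_last hε (by rw [h1]; rfl), h1,
        Nat.cast_one, sub_self, Φ.edge_zero, par_middle, par_corner_of_hl_eq_one m ε hε h1]
    · by_cases h : par (par (k, m + ε)) = cen k m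
      · rw [travelEdge_up h2 h, travelParam_up h2 h, show (2 : ℝ) - 1 = 1 by norm_num, Φ.edge_one]
      · rw [travelEdge_down h2 h, travelParam_down h2 h, sub_self, Φ.edge_zero,
          (hl_eq_two_dir m ε hε h2 k).resolve_left h]
  · rw [travelEdge_last hε h, travelEdge_last hε (by omega), travelParam_last hε h,
      travelParam_last hε (by omega)]
  · push_cast
    rw [travelEdge_last hε (by omega : (hl m ε : ℤ) ≤ 2),
      travelParam_last hε (by omega : (hl m ε : ℤ) ≤ 2), h2, Nat.cast_ofNat,
      show (1 : ℝ) + 1 - 2 = 0 by norm_num, Φ.edge_zero, par_middle]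
    by_cases h : par (par (k, m + ε)) = cen k m
    · rw [travelEdge_up h2 h, travelParam_up h2 h, show (2 : ℝ) - (1 + 1) = 0 by norm_num,
        Φ.edge_zero, h]
    · rw [travelEdge_down h2 h, travelParam_down h2 h, add_sub_cancel_right, Φ.edge_one]

theorem WordMap.travel_eq {ε : ℤ} (hε : ε = 1 ∨ ε = -1) (k m : ℤ) {j : ℤ} {a : ℝ} (h1 : j ≤ a)
    (h2 : a ≤ j + 1) :
    Φ.travel k m ε a = Φ.edge (travelEdge k m ε j) (travelParam k m ε j a) := by
  rcases h2.lt_or_eq with h | h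
  · rw [travel, Int.floor_eq_iff.2 ⟨h1, h⟩]
  · have : ⌊a⌋ = j + 1 := by rw [h, Int.floor_add_one, Int.floor_intCast]
    rw [travel, this, h, Φ.travel_match hε]

theorem WordMap.travel_of_nonpos {ε : ℤ} (hε : ε = 1 ∨ ε = -1) (k m : ℤ) {a : ℝ} (h : a ≤ 0) :
    Φ.travel k m ε a = Φ.edge (k + 1, 3 * m + 2 * ε) (-a) := by
  rcases h.lt_or_eq with h | rfl
  · have : ⌊a⌋ < 0 := Int.floor_lt.2 (by simpa using h)
    rw [travel, travelEdge_neg this, travelParam_neg this]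
  · rw [Φ.travel_eq hε k m (j := -1) (by norm_num) (by norm_num), travelEdge_neg (by norm_num),
      travelParam_neg (by norm_num)]

theorem WordMap.travel_of_le_one {ε : ℤ} (hε : ε = 1 ∨ ε = -1) (k m : ℤ) {a : ℝ} (h0 : 0 ≤ a)
    (h1 : a ≤ 1) : Φ.travel k m ε a = Φ.edge (k, m + ε) (1 - a) := by
  rw [Φ.travel_eq hε k m (j := 0) (by simpa using h0) (by simpa using h1), travelEdge_zero,
    travelParam_zero]

theorem WordMap.travel_up {ε : ℤ} (hε : ε = 1 ∨ ε = -1) {k m : ℤ} (h2 : hl m ε = 2)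
    (h : par (par (k, m + ε)) = cen k m) {a : ℝ} (h0 : 1 ≤ a) (h1 : a ≤ 2) :
    Φ.travel k m ε a = Φ.edge (par (k, m + ε)) (2 - a) := by
  rw [Φ.travel_eq hε k m (j := 1) (by simpa using h0) (by norm_num; exact h1), travelEdge_up h2 h,
    travelParam_up h2 h]

theorem WordMap.travel_down {ε : ℤ} (hε : ε = 1 ∨ ε = -1) {k m : ℤ} (h2 : hl m ε = 2)
    (h : par (par (k, m + ε)) ≠ cen k m) {a : ℝ} (h0 : 1 ≤ a) (h1 : a ≤ 2) :
    Φ.travel k m ε a = Φ.edge (cen k m) (a - 1) := by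
  rw [Φ.travel_eq hε k m (j := 1) (by simpa using h0) (by norm_num; exact h1),
    travelEdge_down h2 h, travelParam_down h2 h]

theorem WordMap.travel_of_hl_le {ε : ℤ} (hε : ε = 1 ∨ ε = -1) (k m : ℤ) {a : ℝ}
    (h : hl m ε ≤ a) : Φ.travel k m ε a = Φ.edge (k + 1, 3 * m) (a - hl m ε) := by
  have h' : (hl m ε : ℤ) ≤ ⌊a⌋ := Int.le_floor.2 (by exact_mod_cast h)
  rw [travel, travelEdge_last hε h', travelParam_last hε h']

theorem abs_travelParam_sub (k m ε j : ℤ) (a a' : ℝ) :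
    |travelParam k m ε j a - travelParam k m ε j a'| = |a - a'| := by
  unfold travelParam
  split_ifs
  · rw [abs_sub_comm a]; congr 1; ring
  · rw [abs_sub_comm a]; congr 1; ring
  · rw [abs_sub_comm a]; congr 1; ring
  · congr 1; ring
  · congr 1; ring

theorem WordMap.edist_travel_le {ε : ℤ} (hε : ε = 1 ∨ ε = -1) (k m : ℤ) (a a' : ℝ) :
    edist (Φ.travel k m ε a) (Φ.travel k m ε a') ≤ R * ENNReal.ofReal |a - a'| :=
  edist_glue_le (fun j a => Φ.edge (travelEdge k m ε j) (travelParam k m ε j a)) R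
    (fun j z _ z' _ => (Φ.edist_edge_le _ _ _).trans (by rw [abs_travelParam_sub]))
    (fun j => Φ.travel_match hε k m j) a a'

/-! ### The maps on the cells -/

/-- The edge and the parameter of a point of a cell in the tree of colour `c`. -/
noncomputable def cellLoc (c k m ε : ℤ) (u y : ℝ) : (ℤ × ℤ) × ℝ :=
  if Even (k + m + c) then ((k + 1, 3 * m + ε), restPos u y) else
    (travelEdge k m ε ⌊travelPos (hl m ε) u y⌋,
      travelParam k m ε ⌊travelPos (hl m ε) u y⌋ (travelPos (hl m ε) u y))

/-- The image of a point of a cell in the tree of colour `c`. -/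
noncomputable def WordMap.cell (c k m ε : ℤ) (u y : ℝ) : E :=
  Φ.edge (cellLoc c k m ε u y).1 (cellLoc c k m ε u y).2

variable {c k m ε : ℤ}

theorem WordMap.cell_rest (h : Even (k + m + c)) (u y : ℝ) :
    Φ.cell c k m ε u y = Φ.edge (k + 1, 3 * m + ε) (restPos u y) := by
  rw [cell, cellLoc, if_pos h]

theorem WordMap.cell_travel (h : ¬ Even (k + m + c)) (u y : ℝ) :
    Φ.cell c k m ε u y = Φ.travel k m ε (travelPos (hl m ε) u y) := by
  rw [cell, cellLoc, if_neg h]; rfl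

theorem hl_cast_eq (hε : ε = 1 ∨ ε = -1) : (hl m ε : ℝ) = 1 ∨ (hl m ε : ℝ) = 2 := by
  rcases hl_eq m ε hε with h | h <;> simp [h]

theorem mul_ofReal_le {x z : ℝ} {C : ℕ} (h : x ≤ C * z) :
    (R : ℝ≥0∞) * ENNReal.ofReal x ≤ (R * C : ℕ) * ENNReal.ofReal z := by
  push_cast
  rw [mul_assoc]
  refine mul_le_mul_right ((ENNReal.ofReal_le_ofReal h).trans ?_) _
  rw [ENNReal.ofReal_mul (Nat.cast_nonneg C), ENNReal.ofReal_natCast]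

theorem WordMap.edist_cell_le_left (hε : ε = 1 ∨ ε = -1) {u u' y : ℝ} (hu' : 0 ≤ u')
    (hy : y ∈ Set.Icc (0 : ℝ) 1) :
    edist (Φ.cell c k m ε u y) (Φ.cell c k m ε u' y) ≤ (R * 12 : ℕ) * ENNReal.ofReal |u - u'| := by
  by_cases h : Even (k + m + c)
  · rw [Φ.cell_rest h, Φ.cell_rest h]
    refine (Φ.edist_edge_le _ _ _).trans (mul_ofReal_le ?_)
    have := abs_restPos_sub_le u u' y y
    rw [sub_self, abs_zero] at this
    push_cast
    linarith [abs_nonneg (u - u')]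
  · rw [Φ.cell_travel h, Φ.cell_travel h]
    refine (Φ.edist_travel_le hε _ _ _ _).trans (mul_ofReal_le ?_)
    exact_mod_cast abs_travelPos_sub_le_left (hl_cast_eq hε) hu' hy

theorem WordMap.edist_cell_le_right (hε : ε = 1 ∨ ε = -1) {u y y' : ℝ}
    (hu : u ∈ Set.Icc (0 : ℝ) (1 / 2)) (hy : y ∈ Set.Icc (0 : ℝ) 1) (hy' : y' ≤ 1) :
    edist (Φ.cell c k m ε u y) (Φ.cell c k m ε u y') ≤ (R * 7 : ℕ) * ENNReal.ofReal |y - y'| := by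
  by_cases h : Even (k + m + c)
  · rw [Φ.cell_rest h, Φ.cell_rest h]
    refine (Φ.edist_edge_le _ _ _).trans (mul_ofReal_le ?_)
    have := abs_restPos_sub_le u u y y'
    rw [sub_self, abs_zero] at this
    push_cast
    linarith [abs_nonneg (y - y')]
  · rw [Φ.cell_travel h, Φ.cell_travel h]
    refine (Φ.edist_travel_le hε _ _ _ _).trans (mul_ofReal_le ?_)
    exact_mod_cast abs_travelPos_sub_le_right (hl_cast_eq hε) hu hy hy'

theorem WordMap.cell_center {y : ℝ} (hy : y ∈ Set.Icc (0 : ℝ) 1) :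
    Φ.cell c k m 1 (1 / 2) y = Φ.cell c k m (-1) (1 / 2) y := by
  by_cases h : Even (k + m + c)
  · have : restPos (1 / 2) y = 0 := by rw [restPos]; norm_num [hy.1]
    rw [Φ.cell_rest h, Φ.cell_rest h, this, Φ.edge_zero, Φ.edge_zero, par_child (by omega),
      par_child (by omega)]
  · have key : ∀ ε : ℤ, (ε = 1 ∨ ε = -1) →
        Φ.cell c k m ε (1 / 2) y = Φ.edge (k + 1, 3 * m) y := by
      intro ε hε
      have := travelPos_of_le (hl_cast_eq (m := m) hε) hy.2 (u := 1 / 2) (by linarith [hy.1])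
      rw [Φ.cell_travel h, this, Φ.travel_of_hl_le hε _ _ (by linarith [hy.1]),
        add_sub_cancel_left]
    rw [key 1 (by omega), key (-1) (by omega)]

/-- Adjacent runs have opposite colours, so rest and travel are exchanged at the boundary: position
`-y` on the travel path of the neighbour lies on the very edge where this run rests at position `y`.
-/
theorem WordMap.cell_boundary_rest (h : Even (k + m + c)) (hε : ε = 1 ∨ ε = -1) {y : ℝ}
    (hy : y ∈ Set.Icc (0 : ℝ) 1) : Φ.cell c k m ε 0 y = Φ.cell c k (m + ε) (-ε) 0 y := by
  have h' : ¬ Even (k + (m + ε) + c) := by simp only [Int.even_iff] at *; omega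
  have hε' : -ε = 1 ∨ -ε = -1 := by omega
  have e1 : restPos 0 y = y := by rw [restPos, min_eq_left]; linarith [hy.2]
  rw [Φ.cell_rest h, Φ.cell_travel h', travelPos_zero (hl_cast_eq hε'),
    Φ.travel_of_nonpos hε' _ _ (by linarith [hy.1]), e1, neg_neg]
  congr 2
  ring

theorem WordMap.cell_boundary (hε : ε = 1 ∨ ε = -1) {y : ℝ}
    (hy : y ∈ Set.Icc (0 : ℝ) 1) : Φ.cell c k m ε 0 y = Φ.cell c k (m + ε) (-ε) 0 y := by
  by_cases h : Even (k + m + c)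
  · exact Φ.cell_boundary_rest h hε hy
  · have := Φ.cell_boundary_rest (c := c) (k := k) (m := m + ε) (ε := -ε)
      (by simp only [Int.even_iff] at *; omega) (by omega) hy
    rw [this]
    simp

end TernaryForest

/-! ### Matching of consecutive layers. -/

namespace TernaryForest

section

variable {E : Type*} [PseudoEMetricSpace E] {R : ℕ} (Φ : WordMap E R) {c k m ε : ℤ}

theorem restPos_zero {u : ℝ} (hu : u ≤ 1 / 2) : restPos u 0 = 0 := min_eq_left (by linarith)

theorem travelPos_level_zero {l u : ℝ} (hu : u ≤ 1 / 2) : travelPos l u 0 = 2 * l * u := by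
  have : xi u 0 = 2 * u := by
    rw [xi, min_eq_right] <;> linarith
  rw [travelPos, this, travelAux]; ring

theorem travelPos_level_one {l u : ℝ} (hu : u ≤ 1 / 3) :
    travelPos l u 1 = min (12 * u) (2 - l + 6 * l * u) - 1 := by
  have : xi u 1 = 3 * u := by
    rw [xi, min_eq_right] <;> linarith
  rw [travelPos, this, travelAux]
  ring_nf

/-- The transition between two layers, far from the center line of the upper run. -/
theorem WordMap.cell_one_outer (hε : ε = 1 ∨ ε = -1) {u : ℝ} (h0 : 0 ≤ u) (h1 : u ≤ 1 / 6) :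
    Φ.cell c k m ε u 1 = Φ.cell c (k + 1) (3 * m + ε) ε (3 * u) 0 := by
  by_cases h : Even (k + m + c)
  · have h' : Even (k + 1 + (3 * m + ε) + c) := by simp only [Int.even_iff] at *; omega
    have e1 : restPos u 1 = 1 := min_eq_left (by linarith)
    rw [Φ.cell_rest h, Φ.cell_rest h', e1, restPos_zero (by linarith), Φ.edge_one, Φ.edge_zero,
      par_child hε]
  · have h' : ¬ Even (k + 1 + (3 * m + ε) + c) := by simp only [Int.even_iff] at *; omega
    have h2 : hl (3 * m + ε) ε = 2 := hl_outer hε m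
    have e1 : travelPos (hl m ε) u 1 = 12 * u - 1 := by
      rw [travelPos_level_one (by linarith), min_eq_left]
      rcases hl_cast_eq (m := m) hε with h | h <;> rw [h] <;> linarith
    have e2 : par (k + 1, 3 * m + ε + ε) = (k, m + ε) := by
      rw [add_assoc, ← two_mul, par_outer hε]
    rw [Φ.cell_travel h, Φ.cell_travel h', e1, travelPos_level_zero (by linarith), h2,
      Nat.cast_ofNat, show (2 : ℝ) * 2 * (3 * u) = 12 * u by ring]
    rcases le_total (12 * u) 1 with h3 | h3
    · rw [Φ.travel_of_nonpos hε _ _ (by linarith), Φ.travel_of_le_one hε _ _ (by linarith) h3,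
        neg_sub, add_assoc, ← two_mul]
    · rw [Φ.travel_of_le_one hε _ _ (by linarith) (by linarith),
        Φ.travel_up hε h2 (by rw [e2, cen_child hε]) h3 (by linarith), e2]
      congr 1
      ring

/-- The transition between two layers, in the middle part of the upper half-run. -/
theorem WordMap.cell_one_inner (hε : ε = 1 ∨ ε = -1) {u : ℝ} (h0 : 1 / 6 ≤ u) (h1 : u ≤ 1 / 3) :
    Φ.cell c k m ε u 1 = Φ.cell c (k + 1) (3 * m + ε) (-ε) (1 - 3 * u) 0 := by
  have hε' : -ε = 1 ∨ -ε = -1 := by omega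
  by_cases h : Even (k + m + c)
  · have h' : Even (k + 1 + (3 * m + ε) + c) := by simp only [Int.even_iff] at *; omega
    have e1 : restPos u 1 = 1 := min_eq_left (by linarith)
    rw [Φ.cell_rest h, Φ.cell_rest h', e1, restPos_zero (by linarith), Φ.edge_one, Φ.edge_zero,
      par_child hε']
  · have h' : ¬ Even (k + 1 + (3 * m + ε) + c) := by simp only [Int.even_iff] at *; omega
    have hh : hl (3 * m + ε) (-ε) = hl m ε := hl_inner hε m
    have e1 : travelPos (hl m ε) u 1 = 1 - hl m ε + 6 * hl m ε * u := by
      rw [travelPos_level_one (by linarith), min_eq_right]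
      · ring
      rcases hl_cast_eq (m := m) hε with h | h <;> rw [h] <;> linarith
    have e2 : par (k + 1, 3 * m + ε + -ε) = cen k m := by
      rw [add_neg_cancel_right, par_middle]
    have e3 := cen_child hε k m
    rw [Φ.cell_travel h, Φ.cell_travel h', e1, travelPos_level_zero (by linarith), hh]
    rcases hl_eq m ε hε with h1' | h2
    · rw [h1', Nat.cast_one, Φ.travel_of_hl_le hε _ _ (by rw [h1']; push_cast; linarith),
        Φ.travel_of_le_one hε' _ _ (by linarith) (by linarith), h1', Nat.cast_one,
        add_neg_cancel_right]
      congr 1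
      ring
    · rw [h2, Nat.cast_ofNat]
      rcases le_total (2 * 2 * (1 - 3 * u)) 1 with h3 | h3
      · rw [Φ.travel_of_hl_le hε _ _ (by rw [h2]; push_cast; linarith),
          Φ.travel_of_le_one hε' _ _ (by linarith) h3, h2, Nat.cast_ofNat, add_neg_cancel_right]
        congr 1
        ring
      · by_cases hup : par (par (k, m + ε)) = cen k m
        · rw [Φ.travel_up hε h2 hup (by linarith) (by linarith),
            Φ.travel_down hε' (hh.trans h2) (by rw [e2, e3]; exact not_up_and_down hup) h3
              (by linarith), e3]
          congr 1
          ring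
        · rw [Φ.travel_down hε h2 hup (by linarith) (by linarith),
            Φ.travel_up hε' (hh.trans h2) (by
              rw [e2, e3]; exact (hl_eq_two_dir m ε hε h2 k).resolve_left hup) h3 (by linarith), e2]
          congr 1
          ring

/-- The transition between two layers, near the center line of the upper run. -/
theorem WordMap.cell_one_center (hε : ε = 1 ∨ ε = -1) {u : ℝ} (h0 : 1 / 3 ≤ u) (h1 : u ≤ 1 / 2) :
    Φ.cell c k m ε u 1 = Φ.cell c (k + 1) (3 * m) ε (3 * u - 1) 0 := by
  have e1 := travelPos_of_le (u := u) (hl_cast_eq (m := m) hε) le_rfl (by linarith)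
  by_cases h : Even (k + m + c)
  · have h' : ¬ Even (k + 1 + 3 * m + c) := by simp only [Int.even_iff] at *; omega
    have e2 : restPos u 1 = 3 - 6 * u := min_eq_right (by linarith)
    rw [Φ.cell_rest h, Φ.cell_travel h', e2, travelPos_level_zero (by linarith), hl_mul,
      Nat.cast_one, Φ.travel_of_le_one hε _ _ (by linarith) (by linarith)]
    congr 1
    ring
  · have h' : Even (k + 1 + 3 * m + c) := by simp only [Int.even_iff] at *; omega
    rw [Φ.cell_travel h, Φ.cell_rest h', e1, restPos_zero (by linarith),
      Φ.travel_of_hl_le hε _ _ (by linarith), add_sub_cancel_left, Φ.edge_one, Φ.edge_zero,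
      par_child hε]

end

/-! ### Layers -/

/-- The run of a half-unit interval. -/
def halfRun (j : ℤ) : ℤ := (j + 1) / 2

/-- The side of a half-unit interval. -/
def halfSide (j : ℤ) : ℤ := if Even j then 1 else -1

/-- The horizontal coordinate in the cell. -/
noncomputable def halfCoord (j : ℤ) (Z : ℝ) : ℝ := 1 / 2 - halfSide j * (Z / 2 - halfRun j)

theorem halfSide_eq (j : ℤ) : halfSide j = 1 ∨ halfSide j = -1 := by
  unfold halfSide; split_ifs <;> simp

theorem half_cases (j : ℤ) : (∃ m, j = 2 * m ∧ halfRun j = m ∧ halfSide j = 1 ∧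
      ∀ Z, halfCoord j Z = 1 / 2 - (Z / 2 - m)) ∨
    ∃ m, j = 2 * m - 1 ∧ halfRun j = m ∧ halfSide j = -1 ∧
      ∀ Z, halfCoord j Z = 1 / 2 + (Z / 2 - m) := by
  rcases Int.even_or_odd' j with ⟨m, rfl | rfl⟩
  · left
    have h1 : halfRun (2 * m) = m := by unfold halfRun; omega
    have h2 : halfSide (2 * m) = 1 := if_pos (even_two_mul m)
    refine ⟨m, rfl, h1, h2, fun Z => ?_⟩
    rw [halfCoord, h1, h2]; simp
  · right
    have h1 : halfRun (2 * m + 1) = m + 1 := by unfold halfRun; omega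
    have h2 : halfSide (2 * m + 1) = -1 := if_neg (by simp)
    refine ⟨m + 1, by ring, h1, h2, fun Z => ?_⟩
    rw [halfCoord, h1, h2]; push_cast; ring

theorem halfCoord_mem {j : ℤ} {Z : ℝ} (hZ : Z ∈ Set.Icc (j : ℝ) (j + 1)) :
    halfCoord j Z ∈ Set.Icc (0 : ℝ) (1 / 2) := by
  obtain ⟨h1, h2⟩ := hZ
  rcases half_cases j with ⟨m, rfl, -, -, h⟩ | ⟨m, rfl, -, -, h⟩ <;> rw [h] <;> push_cast at h1 h2 <;>
    constructor <;> linarith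

theorem abs_halfCoord_sub (j : ℤ) (Z Z' : ℝ) :
    |halfCoord j Z - halfCoord j Z'| = |Z - Z'| / 2 := by
  rcases half_cases j with ⟨m, -, -, -, h⟩ | ⟨m, -, -, -, h⟩ <;> rw [h, h]
  · rw [show 1 / 2 - (Z / 2 - m) - (1 / 2 - (Z' / 2 - m)) = -((Z - Z') / 2) by ring, abs_neg,
      abs_div, abs_two]
  · rw [show 1 / 2 + (Z / 2 - m) - (1 / 2 + (Z' / 2 - m)) = (Z - Z') / 2 by ring,
      abs_div, abs_two]

/-- The edge and the parameter of a point of a layer in the tree of colour `c`. -/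
noncomputable def layerLoc (c k : ℤ) (X y : ℝ) : (ℤ × ℤ) × ℝ :=
  cellLoc c k (halfRun ⌊2 * X⌋) (halfSide ⌊2 * X⌋) (halfCoord ⌊2 * X⌋ (2 * X)) y

section

variable {E : Type*} [PseudoEMetricSpace E] {R : ℕ} (Φ : WordMap E R)

/-- The image of a point of a layer in the tree of colour `c`. -/
noncomputable def WordMap.layer (c k : ℤ) (X y : ℝ) : E :=
  Φ.edge (layerLoc c k X y).1 (layerLoc c k X y).2

/-- The floor of `2 * X` selects one half-run; at a common endpoint the other description is equally
valid by `cell_boundary` and `cell_center`. -/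
theorem WordMap.layer_eq (c k m : ℤ) {ε : ℤ} (hε : ε = 1 ∨ ε = -1) {X u y : ℝ} (h0 : 0 ≤ u)
    (h1 : u ≤ 1 / 2) (hX : X = m + ε * (1 / 2 - u)) (hy : y ∈ Set.Icc (0 : ℝ) 1) :
    Φ.layer c k X y = Φ.cell c k m ε u y := by
  have key : ∀ j : ℤ, ⌊2 * X⌋ = j →
      Φ.layer c k X y = Φ.cell c k (halfRun j) (halfSide j) (halfCoord j (2 * X)) y := by
    rintro j rfl; rfl
  rcases hε with rfl | rfl
  · rcases h0.eq_or_lt with rfl | h0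
    · have hX' : 2 * X = (2 * m + 1 : ℤ) := by rw [hX]; push_cast; ring
      rw [key (2 * m + 1) (by rw [hX', Int.floor_intCast])]
      rcases half_cases (2 * m + 1) with ⟨m', e, -⟩ | ⟨m', e, e1, e2, e3⟩
      · omega
      · obtain rfl : m' = m + 1 := by omega
        rw [e1, e2, e3, Φ.cell_boundary (by omega) hy, hX']
        congr 1
        push_cast; ring
    · have hX' : 2 * X = 2 * m + 1 - 2 * u := by rw [hX]; push_cast; ring
      rw [key (2 * m) (Int.floor_eq_iff.2 ⟨by push_cast; linarith, by push_cast; linarith⟩)]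
      rcases half_cases (2 * m) with ⟨m', e, e1, e2, e3⟩ | ⟨m', e, -⟩
      · obtain rfl : m' = m := by omega
        rw [e1, e2, e3, hX']
        congr 1
        ring
      · omega
  · rcases h1.eq_or_lt with rfl | h1
    · have hX' : 2 * X = (2 * m : ℤ) := by rw [hX]; push_cast; ring
      rw [key (2 * m) (by rw [hX', Int.floor_intCast])]
      rcases half_cases (2 * m) with ⟨m', e, e1, e2, e3⟩ | ⟨m', e, -⟩
      · obtain rfl : m' = m := by omega
        rw [e1, e2, e3, ← Φ.cell_center hy, hX']
        congr 1
        push_cast; ring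
      · omega
    · have hX' : 2 * X = 2 * m - 1 + 2 * u := by rw [hX]; push_cast; ring
      rw [key (2 * m - 1) (Int.floor_eq_iff.2 ⟨by push_cast; linarith, by push_cast; linarith⟩)]
      rcases half_cases (2 * m - 1) with ⟨m', e, -⟩ | ⟨m', e, e1, e2, e3⟩
      · omega
      · obtain rfl : m' = m := by omega
        rw [e1, e2, e3, hX']
        congr 1
        ring

theorem floor_two_mul_mem (X : ℝ) :
    2 * X ∈ Set.Icc ((⌊2 * X⌋ : ℤ) : ℝ) ((⌊2 * X⌋ : ℤ) + 1) :=
  ⟨Int.floor_le _, (Int.lt_floor_add_one _).le⟩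

theorem WordMap.edist_layer_le_left (c k : ℤ) (X X' : ℝ) {y : ℝ} (hy : y ∈ Set.Icc (0 : ℝ) 1) :
    edist (Φ.layer c k X y) (Φ.layer c k X' y) ≤ (R * 12 : ℕ) * ENNReal.ofReal |X - X'| := by
  have := edist_glue_le
    -- As a function of `Z = 2 * X` the cell coordinate has slope `1 / 2`, so the constant 12 of a
    -- cell becomes 6.
    (fun j Z => Φ.cell c k (halfRun j) (halfSide j) (halfCoord j Z) y) (R * 6 : ℕ)
    (fun j Z hZ Z' hZ' => by
      refine (Φ.edist_cell_le_left (halfSide_eq j) (halfCoord_mem hZ').1 hy).trans ?_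
      rw [abs_halfCoord_sub, show R * 12 = R * 6 * 2 by ring, Nat.cast_mul, mul_assoc]
      refine mul_le_mul_right (le_of_eq ?_) _
      rw [Nat.cast_ofNat, ← ENNReal.ofReal_ofNat 2, ← ENNReal.ofReal_mul zero_le_two]
      congr 1
      ring)
    (fun j => by
      have e : ∀ i : ℤ, (i = j ∨ i = j + 1) →
          Φ.cell c k (halfRun i) (halfSide i) (halfCoord i (j + 1)) y =
            Φ.layer c k ((j + 1) / 2) y := by
        intro i hi
        have hmem : halfCoord i (j + 1) ∈ Set.Icc (0 : ℝ) (1 / 2) := by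
          refine halfCoord_mem ?_
          rcases hi with rfl | rfl <;> push_cast <;> constructor <;> linarith
        refine (Φ.layer_eq c k _ (halfSide_eq i) hmem.1 hmem.2 ?_ hy).symm
        rw [halfCoord]
        rcases halfSide_eq i with h | h <;> rw [h] <;> push_cast <;> ring
      exact (e j (Or.inl rfl)).trans (e (j + 1) (Or.inr rfl)).symm) (2 * X) (2 * X')
  refine le_trans this (le_of_eq ?_)
  rw [← mul_sub, abs_mul, abs_two, ENNReal.ofReal_mul zero_le_two, ← mul_assoc,
    ENNReal.ofReal_ofNat]
  congr 1
  push_cast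
  ring

theorem WordMap.edist_layer_le_right (c k : ℤ) (X : ℝ) {y y' : ℝ} (hy : y ∈ Set.Icc (0 : ℝ) 1)
    (hy' : y' ∈ Set.Icc (0 : ℝ) 1) :
    edist (Φ.layer c k X y) (Φ.layer c k X y') ≤ (R * 7 : ℕ) * ENNReal.ofReal |y - y'| :=
  Φ.edist_cell_le_right (halfSide_eq _) (halfCoord_mem (floor_two_mul_mem X)) hy hy'.2

theorem exists_cell (X : ℝ) : ∃ m ε : ℤ, (ε = 1 ∨ ε = -1) ∧ ∃ u ∈ Set.Icc (0 : ℝ) (1 / 2),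
    X = m + ε * (1 / 2 - u) ∧ ∀ c k y, layerLoc c k X y = cellLoc c k m ε u y := by
  refine ⟨_, _, halfSide_eq _, _, halfCoord_mem (floor_two_mul_mem X), ?_, fun _ _ _ => rfl⟩
  rw [halfCoord]
  rcases halfSide_eq ⌊2 * X⌋ with h | h <;> rw [h] <;> push_cast <;> ring

/-- At `u = 1 / 6` and `u = 1 / 3` the half-run splits into the outer and the inner half of an outer
third and one half of the middle third, each a half-run of the next level. -/
theorem WordMap.layer_one (c k : ℤ) (X : ℝ) : Φ.layer c k X 1 = Φ.layer c (k + 1) (3 * X) 0 := by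
  obtain ⟨m, ε, hε, u, ⟨h0, h1⟩, hX, -⟩ := exists_cell X
  have hε' : -ε = 1 ∨ -ε = -1 := by omega
  have m0 : (0 : ℝ) ∈ Set.Icc (0 : ℝ) 1 := by simp
  rw [Φ.layer_eq c k m hε h0 h1 hX (by simp)]
  rcases le_total u (1 / 6) with h2 | h2
  · rw [Φ.cell_one_outer hε h0 h2]
    refine (Φ.layer_eq _ _ _ hε (by linarith) (by linarith) ?_ m0).symm
    rw [hX]; push_cast; ring
  rcases le_total u (1 / 3) with h3 | h3
  · rw [Φ.cell_one_inner hε h2 h3]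
    refine (Φ.layer_eq _ _ _ hε' (by linarith) (by linarith) ?_ m0).symm
    rw [hX]; push_cast; ring
  · rw [Φ.cell_one_center hε h3 h1]
    refine (Φ.layer_eq _ _ _ hε (by linarith) (by linarith) ?_ m0).symm
    rw [hX]; push_cast; ring

/-! ### The maps of the hyperbolic plane -/

/-- The image of the point with horizontal coordinate `x` and height `3 ^ (-t)` in the tree of
colour `c`. -/
noncomputable def WordMap.plane (c : ℤ) (x t : ℝ) : E :=
  Φ.layer c ⌊t⌋ (x * 3 ^ ⌊t⌋) (t - (⌊t⌋ : ℝ))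

theorem sub_floor_mem (t : ℝ) : t - (⌊t⌋ : ℝ) ∈ Set.Icc (0 : ℝ) 1 :=
  ⟨by linarith [Int.floor_le t], by linarith [Int.lt_floor_add_one t]⟩

theorem WordMap.edist_plane_le_vertical (c : ℤ) (x t t' : ℝ) :
    edist (Φ.plane c x t) (Φ.plane c x t') ≤ (R * 7 : ℕ) * ENNReal.ofReal |t - t'| :=
  edist_glue_le (fun k t => Φ.layer c k (x * 3 ^ k) (t - (k : ℝ))) (R * 7 : ℕ)
    (fun k t ht t' ht' => by
      refine (Φ.edist_layer_le_right c k _ ⟨by linarith [ht.1], by linarith [ht.2]⟩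
        ⟨by linarith [ht'.1], by linarith [ht'.2]⟩).trans (le_of_eq ?_)
      congr 3
      ring)
    (fun k => by
      rw [add_sub_cancel_left, Φ.layer_one, zpow_add_one₀ three_ne_zero]
      push_cast
      rw [sub_self]
      congr 1
      ring) t t'

theorem zpow_floor_le (t : ℝ) : (3 : ℝ) ^ ⌊t⌋ ≤ 3 ^ t := by
  rw [← Real.rpow_intCast]
  exact Real.rpow_le_rpow_of_exponent_le (by norm_num) (Int.floor_le t)

theorem WordMap.edist_plane_le_horizontal (c : ℤ) (x x' t : ℝ) :
    edist (Φ.plane c x t) (Φ.plane c x' t) ≤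
      (R * 12 : ℕ) * ENNReal.ofReal (|x - x'| * 3 ^ t) := by
  refine (Φ.edist_layer_le_left c _ _ _ (sub_floor_mem t)).trans ?_
  refine mul_le_mul_right (ENNReal.ofReal_le_ofReal ?_) _
  rw [← sub_mul, abs_mul, abs_of_pos (zpow_pos (by norm_num : (0 : ℝ) < 3) _)]
  exact mul_le_mul_of_nonneg_left (zpow_floor_le t) (abs_nonneg _)

end

end TernaryForest

namespace TernaryForest

/-! ### Potentials -/

theorem ind_eq (v y : ℤ × ℤ) : ind v y = ind (par v) y + if v = y then 1 else 0 := by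
  have hv : ¬ Above v (par v) := fun h => by
    have h1 := h.fst_le
    have h2 := par_fst_lt v
    omega
  by_cases h : v = y
  · subst h
    rw [ind_of_above (Above.refl v), ind_of_not_above hv, if_pos rfl, zero_add]
  · by_cases h' : Above y (par v)
    · rw [ind_of_above h', ind_of_above h'.of_par, if_neg h, add_zero]
    · rw [ind_of_not_above h', ind_of_not_above fun h1 : Above y v => h' (h1.par_of_ne h), if_neg h,
        add_zero]

theorem pt_eq (w : ℤ × ℤ) (b : ℝ) (y : ℤ × ℤ) :
    pt w b y = ind (par w) y + if w = y then b else 0 := by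
  rw [pt, ind_eq]
  split_ifs <;> ring

theorem ind_mem (v y : ℤ × ℤ) : ind v y ∈ Set.Icc (0 : ℝ) 1 := by
  unfold ind
  split_ifs <;> simp

theorem pt_nonneg {w : ℤ × ℤ} {b : ℝ} (hb : b ∈ Set.Icc (0 : ℝ) 1) (y : ℤ × ℤ) : 0 ≤ pt w b y :=
  add_nonneg (mul_nonneg hb.1 (ind_mem _ _).1) (mul_nonneg (by linarith [hb.2]) (ind_mem _ _).1)

/-- A signed sum of the values at the vertices in a finite set. -/
noncomputable def pot (S : Finset (ℤ × ℤ)) (s : ℤ × ℤ → ℝ) (f : ℤ × ℤ → ℝ) : ℝ :=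
  ∑ y ∈ S, s y * f y

/-- The sign of a vertex, which is `0` outside of the finite set. -/
noncomputable def sgn (S : Finset (ℤ × ℤ)) (s : ℤ × ℤ → ℝ) (v : ℤ × ℤ) : ℝ :=
  if v ∈ S then s v else 0

section

variable {S : Finset (ℤ × ℤ)} {s : ℤ × ℤ → ℝ}

theorem pot_add (f g : ℤ × ℤ → ℝ) : pot S s (f + g) = pot S s f + pot S s g := by
  simp [pot, mul_add, Finset.sum_add_distrib]

theorem pot_pt (w : ℤ × ℤ) (b : ℝ) : pot S s (pt w b) = pot S s (ind (par w)) + sgn S s w * b := by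
  simp only [pot, pt_eq, mul_add, Finset.sum_add_distrib, sgn]
  congr 1
  simp only [mul_ite, mul_zero, Finset.sum_ite_eq]
  split_ifs <;> simp

theorem pot_ind (w : ℤ × ℤ) : pot S s (ind w) = pot S s (ind (par w)) + sgn S s w := by
  rw [← pt_one, pot_pt, mul_one]

end

/-- The `ℓ¹` distance of `f` and `g` is at most `δ`. -/
def Close (f g : ℤ × ℤ → ℝ) (δ : ℝ) : Prop := ∀ S : Finset (ℤ × ℤ), ∑ y ∈ S, |f y - g y| ≤ δ

theorem Close.symm {f g : ℤ × ℤ → ℝ} {δ : ℝ} (h : Close f g δ) : Close g f δ := fun S => by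
  simp only [abs_sub_comm (g _)]; exact h S

theorem Close.nonneg {f g : ℤ × ℤ → ℝ} {δ : ℝ} (h : Close f g δ) : 0 ≤ δ := by
  simpa using h ∅

theorem Close.abs_sub_le {f g : ℤ × ℤ → ℝ} {δ : ℝ} (h : Close f g δ) (y : ℤ × ℤ) :
    |f y - g y| ≤ δ := by
  simpa using h {y}

/-- Signs of modulus at most 1 give a functional of norm at most 1 for ℓ¹; suitable signs read off a
position in a cell. -/
theorem Close.abs_pot_sub_le {f g : ℤ × ℤ → ℝ} {δ : ℝ} (h : Close f g δ) {S : Finset (ℤ × ℤ)}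
    {s : ℤ × ℤ → ℝ} (hs : ∀ y ∈ S, |s y| ≤ 1) : |pot S s f - pot S s g| ≤ δ := by
  rw [pot, pot, ← Finset.sum_sub_distrib]
  refine (Finset.abs_sum_le_sum_abs _ _).trans (le_trans (Finset.sum_le_sum fun y hy => ?_) (h S))
  rw [← mul_sub, abs_mul]
  exact mul_le_of_le_one_left (abs_nonneg _) (hs y hy)

/-! ### Points of a cell -/

/-- The point of the travel tree, in terms of the vertices above it. -/
noncomputable def travelPt (k m ε : ℤ) (a : ℝ) : ℤ × ℤ → ℝ :=
  pt (travelEdge k m ε ⌊a⌋) (travelParam k m ε ⌊a⌋ a)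

/-- The pair of points of the two trees, in terms of the vertices above them. -/
noncomputable def cellPt (k m ε : ℤ) (u y : ℝ) : ℤ × ℤ → ℝ :=
  pt (k + 1, 3 * m + ε) (restPos u y) + travelPt k m ε (travelPos (hl m ε) u y)

variable {k m ε : ℤ}

/-- The sign of the middle edge of the path in the travel tree, in the direction of the path. -/
noncomputable def midSgn (S : Finset (ℤ × ℤ)) (s : ℤ × ℤ → ℝ) (k m ε : ℤ) : ℝ :=
  if par (par (k, m + ε)) = cen k m then -sgn S s (par (k, m + ε)) else sgn S s (cen k m)

/-- Each clamp measures how much of one edge of the path has been traversed, and its sign records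
whether the edge is climbed or descended. -/
theorem pot_travelPt (S : Finset (ℤ × ℤ)) (s : ℤ × ℤ → ℝ) (hε : ε = 1 ∨ ε = -1) (k m : ℤ) (a : ℝ) :
    pot S s (travelPt k m ε a) = pot S s (ind (k, m + ε)) -
      sgn S s (k + 1, 3 * m + 2 * ε) * min a 0 - sgn S s (k, m + ε) * max 0 (min a 1) +
      midSgn S s k m ε * max 0 (min (a - 1) (hl m ε - 1)) +
      sgn S s (k + 1, 3 * m) * max (a - hl m ε) 0 := by
  have f1 := Int.floor_le a
  have f2 := Int.lt_floor_add_one a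
  have q1 := pot_ind (S := S) (s := s) (k, m + ε)
  have hl1 : (1 : ℝ) ≤ hl m ε := by exact_mod_cast one_le_hl hε
  rw [travelPt, pot_pt]
  rcases travel_cases (m := m) hε ⌊a⌋ with h | h | h | ⟨h2, h⟩
  · have ha : a < 0 := by
      have : ((⌊a⌋ : ℤ) : ℝ) + 1 ≤ 0 := by exact_mod_cast h
      linarith
    rw [travelEdge_neg h, travelParam_neg h, par_outer hε, min_eq_left ha.le,
      min_eq_left (by linarith), max_eq_left ha.le,
      max_eq_left ((min_le_left _ _).trans (by linarith)), max_eq_right (by linarith)]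
    ring
  · rw [h] at f1 f2
    push_cast at f1 f2
    rw [h, travelEdge_zero, travelParam_zero, q1, min_eq_right f1, min_eq_left (by linarith),
      max_eq_right f1, max_eq_left ((min_le_left _ _).trans (by linarith)),
      max_eq_right (by linarith)]
    ring
  · have ha : (hl m ε : ℝ) ≤ a := by
      have : (hl m ε : ℝ) ≤ ⌊a⌋ := by exact_mod_cast h
      linarith
    rw [travelEdge_last hε h, travelParam_last hε h, par_middle, min_eq_right (by linarith),
      min_eq_right (by linarith), max_eq_right zero_le_one, min_eq_right (by linarith),
      max_eq_right (by linarith), max_eq_left (by linarith), q1, midSgn]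
    rcases hl_eq m ε hε with h1 | h2
    · rw [h1, par_corner_of_hl_eq_one m ε hε h1]; push_cast; ring
    · split_ifs with hup
      · have := pot_ind (S := S) (s := s) (par (k, m + ε))
        rw [this, hup, h2]; push_cast; ring
      · have := pot_ind (S := S) (s := s) (cen k m)
        rw [this, (hl_eq_two_dir m ε hε h2 k).resolve_left hup, h2]; push_cast; ring
  · rw [h] at f1 f2
    push_cast at f1 f2
    rw [h, h2, min_eq_right (by linarith), min_eq_right f1, max_eq_right zero_le_one, Nat.cast_ofNat,
      min_eq_left (by linarith), max_eq_right (by linarith), max_eq_right (by linarith), q1, midSgn]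
    split_ifs with hup
    · have := pot_ind (S := S) (s := s) (par (k, m + ε))
      rw [travelEdge_up h2 hup, travelParam_up h2 hup, this, hup]; ring
    · rw [travelEdge_down h2 hup, travelParam_down h2 hup,
        (hl_eq_two_dir m ε hε h2 k).resolve_left hup]; ring

/-- The potential of the corner in terms of the potential of the center. -/
theorem pot_corner (S : Finset (ℤ × ℤ)) (s : ℤ × ℤ → ℝ) (hε : ε = 1 ∨ ε = -1) (k m : ℤ) :
    pot S s (ind (k, m + ε)) = pot S s (ind (cen k m)) + sgn S s (k, m + ε) -
      midSgn S s k m ε * (hl m ε - 1) := by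
  have h1 := pot_travelPt S s hε k m (hl m ε)
  have hl1 : (1 : ℝ) ≤ hl m ε := by exact_mod_cast one_le_hl hε
  have e : ⌊(hl m ε : ℝ)⌋ = hl m ε := Int.floor_natCast _
  rw [travelPt, e, travelEdge_last hε le_rfl, travelParam_last hε le_rfl, sub_self, pt_zero,
    par_middle, min_eq_right (by linarith), min_eq_right hl1, max_eq_right zero_le_one, min_self,
    max_eq_right (by linarith), max_self] at h1
  linarith

theorem pot_cellPt (S : Finset (ℤ × ℤ)) (s : ℤ × ℤ → ℝ) (hε : ε = 1 ∨ ε = -1) (k m : ℤ) (u y : ℝ) :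
    pot S s (cellPt k m ε u y) = pot S s (ind (k, m)) + pot S s (ind (k, m + ε)) +
      sgn S s (k + 1, 3 * m + ε) * restPos u y -
      sgn S s (k + 1, 3 * m + 2 * ε) * min (travelPos (hl m ε) u y) 0 -
      sgn S s (k, m + ε) * max 0 (min (travelPos (hl m ε) u y) 1) +
      midSgn S s k m ε * max 0 (min (travelPos (hl m ε) u y - 1) (hl m ε - 1)) +
      sgn S s (k + 1, 3 * m) * max (travelPos (hl m ε) u y - hl m ε) 0 := by
  rw [cellPt, pot_add, pot_pt, pot_travelPt S s hε, par_child hε]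
  ring

theorem cellPt_nonneg (hε : ε = 1 ∨ ε = -1) {u y : ℝ} (hu : u ∈ Set.Icc (0 : ℝ) (1 / 2))
    (hy : y ∈ Set.Icc (0 : ℝ) 1) (x : ℤ × ℤ) : 0 ≤ pt (k + 1, 3 * m + ε) (restPos u y) x ∧
      0 ≤ travelPt k m ε (travelPos (hl m ε) u y) x := by
  have h := travelPos_mem (hl_cast_eq (m := m) hε) hu.1 hy
  exact ⟨pt_nonneg (restPos_mem hu hy) x, pt_nonneg (travelParam_mem hε (by linarith [h.1, hy.2])
    (by linarith [h.2, hy.2])) x⟩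

theorem cellPt_eq_zero (hε : ε = 1 ∨ ε = -1) {x : ℤ × ℤ}
    (hx : ∀ w, OnRun (k + 1) (3 * m + ε) w → ¬ Above x w) (u y : ℝ) : cellPt k m ε u y x = 0 := by
  rw [cellPt, Pi.add_apply, travelPt, pt_of_not_above (hx _ (adapted_rest hε k m).1),
    pt_of_not_above (hx _ (adapted_travelEdge hε k m _).1), add_zero]

/-- The ancestors of the run are above the point in one forest or the other, according to their
colour; so they record the position at all larger scales. -/
theorem one_le_cellPt (hε : ε = 1 ∨ ε = -1) {u y : ℝ} (hu : u ∈ Set.Icc (0 : ℝ) (1 / 2))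
    (hy : y ∈ Set.Icc (0 : ℝ) 1) (i : ℕ) : 1 ≤ cellPt k m ε u y (k - i, up^[i] m) := by
  obtain ⟨h1, h2⟩ := cellPt_nonneg (k := k) (m := m) hε hu hy (k - i, up^[i] m)
  have key : ∀ w, Adapted (k + 1) (3 * m + ε) w →
      (Even (w.1 + w.2) ↔ Even (k - i + up^[i] m)) → Above (k - i, up^[i] m) (par w) := by
    rintro w ⟨-, hw⟩ hc
    rw [add_sub_cancel_right, up_mul_add hε] at hw
    exact OnRun.above i (by rwa [sub_add_cancel]) ((even_par w).trans hc)
  rw [cellPt, Pi.add_apply]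
  by_cases hc : Even (k + m) ↔ Even (k - i + up^[i] m)
  · have := pt_of_above (key _ (adapted_rest hε k m) (by
      rw [← hc]; simp only [Int.even_iff]; omega)) (restPos u y)
    linarith
  · have : travelPt k m ε (travelPos (hl m ε) u y) (k - i, up^[i] m) = 1 :=
      pt_of_above (key _ (adapted_travelEdge hε k m _) (by rw [even_travelEdge hε]; tauto)) _
    linarith

theorem cellPt_eq_zero_of_two_le (hε : ε = 1 ∨ ε = -1) (i : ℕ) {κ n : ℤ} (hκ : κ + i = k)
    (hn : 2 ≤ |up^[i] m - n|) (u y : ℝ) : cellPt k m ε u y (κ, n) = 0 := by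
  refine cellPt_eq_zero hε (fun w hw => OnRun.not_above (n := 3 * m + ε) (i + 1) ?_ ?_) u y
  · push_cast; rwa [← add_assoc, hκ]
  · rwa [Function.iterate_succ_apply, up_mul_add hε]

theorem cellPt_eq_zero_of_lt (hε : ε = 1 ∨ ε = -1) {x : ℤ × ℤ} (hx : k + 1 < x.1) (u y : ℝ) :
    cellPt k m ε u y x = 0 :=
  cellPt_eq_zero hε (fun _ hw => hw.not_above_of_lt hx) u y

/-- The next level is reached only close to the lower boundary of the layer. -/
theorem cellPt_le (hε : ε = 1 ∨ ε = -1) {u y : ℝ} (hu : u ∈ Set.Icc (0 : ℝ) (1 / 2))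
    (hy : y ∈ Set.Icc (0 : ℝ) 1) {x : ℤ × ℤ} (hx : x.1 = k + 1) : cellPt k m ε u y x ≤ y := by
  have hpar : ∀ w : ℤ × ℤ, OnRun (k + 1) (3 * m + ε) w → ind (par w) x = 0 := by
    intro w hw
    refine ind_of_not_above fun h => ?_
    have h1 := h.fst_le
    have h2 := hw.fst_le
    have h3 := par_fst_lt w
    omega
  have ha := travelPos_mem (hl_cast_eq (m := m) hε) hu.1 hy
  have hb : restPos u y ≤ y := min_le_left _ _
  rw [cellPt, Pi.add_apply, travelPt, pt_eq, pt_eq, hpar _ (adapted_rest hε k m).1,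
    hpar _ (adapted_travelEdge hε k m _).1, zero_add, zero_add]
  by_cases h1 : ((k + 1, 3 * m + ε) : ℤ × ℤ) = x
  · rw [if_pos h1, if_neg, add_zero]
    · exact hb
    · rintro rfl
      have h3 := even_travelEdge hε k m ⌊travelPos (hl m ε) u y⌋
      rw [← h1] at h3
      simp only [Int.even_iff] at h3
      omega
  · rw [if_neg h1, zero_add]
    split_ifs with h2
    · set a := travelPos (hl m ε) u y
      rcases travel_cases (m := m) hε ⌊a⌋ with h | h | h | ⟨h', h⟩
      · rw [travelParam_neg h]; linarith [ha.1]
      · rw [h, travelEdge_zero] at h2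
        rw [← h2] at hx
        simp at hx
      · rw [travelParam_last hε h]; linarith [ha.2]
      · exfalso
        rw [h] at h2
        by_cases hup : par (par (k, m + ε)) = cen k m
        · rw [travelEdge_up h' hup] at h2
          have := par_fst_lt (k, m + ε)
          rw [h2] at this
          simp only at this
          omega
        · rw [travelEdge_down h' hup] at h2
          have := cen_fst_lt k m
          rw [h2] at this
          omega
    · exact hy.1

end TernaryForest

namespace TernaryForest

variable {S : Finset (ℤ × ℤ)} {s : ℤ × ℤ → ℝ} {k m ε : ℤ}

theorem sgn_of_mem {v : ℤ × ℤ} (h : v ∈ S) : sgn S s v = s v := if_pos h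

theorem sgn_of_notMem {v : ℤ × ℤ} (h : v ∉ S) : sgn S s v = 0 := if_neg h

theorem sgn_self (v : ℤ × ℤ) : sgn {v} 1 v = 1 := sgn_of_mem (Finset.mem_singleton_self v)

theorem sgn_singleton_of_ne {v x : ℤ × ℤ} (h : v ≠ x) : sgn {x} s v = 0 :=
  sgn_of_notMem (by simpa using h)

theorem midSgn_eq_zero (h : ∀ v ∈ S, k ≤ v.1) : midSgn S s k m ε = 0 := by
  unfold midSgn
  split_ifs
  · rw [sgn_of_notMem, neg_zero]
    intro hv
    have h1 := h _ hv
    have h2 := par_fst_lt (k, m + ε)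
    simp only at h2
    omega
  · refine sgn_of_notMem fun hv => ?_
    have h1 := h _ hv
    have h2 := cen_fst_lt k m
    omega

theorem ne_of_fst {v w : ℤ × ℤ} (h : v.1 ≠ w.1) : v ≠ w := fun e => h (congrArg Prod.fst e)

theorem ne_of_snd {v w : ℤ × ℤ} (h : v.2 ≠ w.2) : v ≠ w := fun e => h (congrArg Prod.snd e)

theorem clamp_sum {l : ℝ} (hl : 1 ≤ l) (a : ℝ) :
    min a 0 + max 0 (min a 1) + max 0 (min (a - 1) (l - 1)) + max (a - l) 0 = a := by
  rcases le_total a 0 with h | h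
  · rw [min_eq_left h, min_eq_left (by linarith), max_eq_left h,
      max_eq_left ((min_le_left _ _).trans (by linarith)), max_eq_right (by linarith)]
    ring
  rcases le_total a 1 with h1 | h1
  · rw [min_eq_right h, min_eq_left h1, max_eq_right h,
      max_eq_left ((min_le_left _ _).trans (by linarith)), max_eq_right (by linarith)]
    ring
  rcases le_total a l with h2 | h2
  · rw [min_eq_right h, min_eq_right h1, max_eq_right zero_le_one, min_eq_left (by linarith),
      max_eq_right (by linarith), max_eq_right (by linarith)]
    ring
  · rw [min_eq_right h, min_eq_right h1, max_eq_right zero_le_one, min_eq_right (by linarith),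
      max_eq_right (by linarith), max_eq_left (by linarith)]
    ring

theorem abs_one_le {S : Finset (ℤ × ℤ)} : ∀ y ∈ S, |(1 : ℤ × ℤ → ℝ) y| ≤ 1 := by simp

/-! ### Points of the same cell -/

/-- With sign `+1` on the edges that the path descends and `-1` on those it climbs, the signed sum
is the travel position up to a constant. -/
theorem Close.same_cell (hε : ε = 1 ∨ ε = -1) {u y u' y' δ : ℝ}
    (h : Close (cellPt k m ε u y) (cellPt k m ε u' y') δ) :
    |travelPos (hl m ε) u y - travelPos (hl m ε) u' y'| ≤ δ ∧
      |restPos u y - restPos u' y'| ≤ δ := by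
  have hl1 : (1 : ℝ) ≤ hl m ε := by exact_mod_cast one_le_hl hε
  have hn := par_fst_lt (k, m + ε)
  have hc := cen_fst_lt k m
  simp only at hn
  constructor
  · let mid := if par (par (k, m + ε)) = cen k m then par (k, m + ε) else cen k m
    let S : Finset (ℤ × ℤ) := {(k + 1, 3 * m + 2 * ε), (k, m + ε), (k + 1, 3 * m), mid}
    let s : ℤ × ℤ → ℝ := fun v => if v = (k + 1, 3 * m) ∨
      (v = mid ∧ par (par (k, m + ε)) ≠ cen k m) then 1 else -1
    have hmid : mid.1 < k := by simp only [mid]; split_ifs <;> assumption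
    have e1 : sgn S s (k + 1, 3 * m + 2 * ε) = -1 := by
      rw [sgn_of_mem (by simp [S])]
      refine if_neg ?_
      rintro (h | ⟨h, -⟩)
      · exact ne_of_snd (by simp only; omega) h
      · exact ne_of_fst (by simp only; omega) h
    have e2 : sgn S s (k, m + ε) = -1 := by
      rw [sgn_of_mem (by simp [S])]
      refine if_neg ?_
      rintro (h | ⟨h, -⟩) <;> exact ne_of_fst (by simp only; omega) h
    have e3 : sgn S s (k + 1, 3 * m) = 1 := by
      rw [sgn_of_mem (by simp [S])]
      exact if_pos (Or.inl rfl)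
    have e4 : sgn S s (k + 1, 3 * m + ε) = 0 := by
      refine sgn_of_notMem ?_
      simp only [S, Finset.mem_insert, Finset.mem_singleton, not_or]
      refine ⟨ne_of_snd ?_, ne_of_fst ?_, ne_of_snd ?_, ne_of_fst ?_⟩ <;> simp only <;> omega
    have e5 : midSgn S s k m ε = 1 := by
      have hmem : mid ∈ S := by simp [S]
      unfold midSgn
      split_ifs with hup
      · have e : mid = par (k, m + ε) := if_pos hup
        rw [← e, sgn_of_mem hmem, neg_eq_iff_eq_neg]
        refine if_neg ?_
        rintro (h | ⟨-, h⟩)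
        · exact ne_of_fst (by simp only; omega) h
        · exact h hup
      · have e : mid = cen k m := if_neg hup
        rw [← e, sgn_of_mem hmem]
        exact if_pos (Or.inr ⟨rfl, hup⟩)
    have := h.abs_pot_sub_le (S := S) (s := s) (fun v _ => by simp only [s]; split_ifs <;> simp)
    rw [pot_cellPt _ _ hε, pot_cellPt _ _ hε, e1, e2, e3, e4, e5] at this
    have c1 := clamp_sum hl1 (travelPos (hl m ε) u y)
    have c2 := clamp_sum hl1 (travelPos (hl m ε) u' y')
    refine le_trans (le_of_eq (congrArg _ ?_)) this
    linarith
  · have := h.abs_pot_sub_le (S := {(k + 1, 3 * m + ε)}) (s := 1) abs_one_le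
    rw [pot_cellPt _ _ hε, pot_cellPt _ _ hε, sgn_self,
      sgn_singleton_of_ne (v := (k + 1, 3 * m + 2 * ε)) (ne_of_snd (by simp only; omega)),
      sgn_singleton_of_ne (v := (k, m + ε)) (ne_of_fst (by simp only; omega)),
      sgn_singleton_of_ne (v := (k + 1, 3 * m)) (ne_of_snd (by simp only; omega)),
      midSgn_eq_zero (by simp)] at this
    refine le_trans (le_of_eq (congrArg _ ?_)) this
    ring

/-! ### Points of opposite halves of a run -/

/-- Based at the vertex and the centre of the run, which both halves share, so that these terms
cancel between opposite halves. -/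
theorem pot_cellPt_center (S : Finset (ℤ × ℤ)) (s : ℤ × ℤ → ℝ) (hε : ε = 1 ∨ ε = -1) (k m : ℤ)
    (u y : ℝ) :
    pot S s (cellPt k m ε u y) = pot S s (ind (k, m)) + pot S s (ind (cen k m)) +
      sgn S s (k + 1, 3 * m + ε) * restPos u y -
      sgn S s (k + 1, 3 * m + 2 * ε) * min (travelPos (hl m ε) u y) 0 +
      sgn S s (k, m + ε) * (1 - max 0 (min (travelPos (hl m ε) u y) 1)) -
      midSgn S s k m ε *
        ((hl m ε - 1) - max 0 (min (travelPos (hl m ε) u y - 1) (hl m ε - 1))) +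
      sgn S s (k + 1, 3 * m) * max (travelPos (hl m ε) u y - hl m ε) 0 := by
  rw [pot_cellPt S s hε, pot_corner S s hε]
  ring

theorem Close.opposite_rest (hε : ε = 1 ∨ ε = -1) {u y u' y' δ : ℝ}
    (h : Close (cellPt k m ε u y) (cellPt k m (-ε) u' y') δ) : restPos u y ≤ δ := by
  have hε' : -ε = 1 ∨ -ε = -1 := by omega
  have := h.abs_pot_sub_le (S := {(k + 1, 3 * m + ε)}) (s := 1) abs_one_le
  rw [pot_cellPt_center _ _ hε, pot_cellPt_center _ _ hε', sgn_self,
    sgn_singleton_of_ne (v := (k + 1, 3 * m + 2 * ε)) (ne_of_snd (by simp only; omega)),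
    sgn_singleton_of_ne (v := (k + 1, 3 * m + -ε)) (ne_of_snd (by simp only; omega)),
    sgn_singleton_of_ne (v := (k + 1, 3 * m + 2 * -ε)) (ne_of_snd (by simp only; omega)),
    sgn_singleton_of_ne (v := (k, m + ε)) (ne_of_fst (by simp only; omega)),
    sgn_singleton_of_ne (v := (k, m + -ε)) (ne_of_fst (by simp only; omega)),
    sgn_singleton_of_ne (v := (k + 1, 3 * m)) (ne_of_snd (by simp only; omega)),
    midSgn_eq_zero (by simp), midSgn_eq_zero (by simp)] at this
  refine le_trans (le_trans (le_abs_self _) (le_of_eq (congrArg _ ?_))) this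
  ring

theorem Close.opposite_center (hε : ε = 1 ∨ ε = -1) {u y u' y' δ : ℝ}
    (h : Close (cellPt k m ε u y) (cellPt k m (-ε) u' y') δ) :
    |max (travelPos (hl m ε) u y - hl m ε) 0 -
      max (travelPos (hl m (-ε)) u' y' - hl m (-ε)) 0| ≤ δ := by
  have hε' : -ε = 1 ∨ -ε = -1 := by omega
  have := h.abs_pot_sub_le (S := {(k + 1, 3 * m)}) (s := 1) abs_one_le
  rw [pot_cellPt_center _ _ hε, pot_cellPt_center _ _ hε', sgn_self,
    sgn_singleton_of_ne (v := (k + 1, 3 * m + 2 * ε)) (ne_of_snd (by simp only; omega)),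
    sgn_singleton_of_ne (v := (k + 1, 3 * m + ε)) (ne_of_snd (by simp only; omega)),
    sgn_singleton_of_ne (v := (k + 1, 3 * m + -ε)) (ne_of_snd (by simp only; omega)),
    sgn_singleton_of_ne (v := (k + 1, 3 * m + 2 * -ε)) (ne_of_snd (by simp only; omega)),
    sgn_singleton_of_ne (v := (k, m + ε)) (ne_of_fst (by simp only; omega)),
    sgn_singleton_of_ne (v := (k, m + -ε)) (ne_of_fst (by simp only; omega)),
    midSgn_eq_zero (by simp), midSgn_eq_zero (by simp)] at this
  refine le_trans (le_of_eq (congrArg _ ?_)) this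
  ring

/-- Before the center line, the path of one half-run is separated from the other half-run. -/
theorem Close.opposite_travel (hε : ε = 1 ∨ ε = -1) {u y u' y' δ : ℝ} (hδ : δ < 1)
    (h : Close (cellPt k m ε u y) (cellPt k m (-ε) u' y') δ) :
    hl m ε - δ ≤ travelPos (hl m ε) u y := by
  have hε' : -ε = 1 ∨ -ε = -1 := by omega
  have hn := par_fst_lt (k, m + ε)
  have hn' := par_fst_lt (k, m + -ε)
  have hc := cen_fst_lt k m
  simp only at hn hn'
  set a := travelPos (hl m ε) u y
  rcases hl_eq m ε hε with h1 | h2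
  · have := h.abs_pot_sub_le (S := {(k, m + ε)}) (s := 1) abs_one_le
    rw [pot_cellPt_center _ _ hε, pot_cellPt_center _ _ hε', sgn_self,
      sgn_singleton_of_ne (v := (k + 1, 3 * m + 2 * ε)) (ne_of_fst (by simp only; omega)),
      sgn_singleton_of_ne (v := (k + 1, 3 * m + ε)) (ne_of_fst (by simp only; omega)),
      sgn_singleton_of_ne (v := (k + 1, 3 * m + -ε)) (ne_of_fst (by simp only; omega)),
      sgn_singleton_of_ne (v := (k + 1, 3 * m + 2 * -ε)) (ne_of_fst (by simp only; omega)),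
      sgn_singleton_of_ne (v := (k + 1, 3 * m)) (ne_of_fst (by simp only; omega)),
      sgn_singleton_of_ne (v := (k, m + -ε)) (ne_of_snd (by simp only; omega)),
      midSgn_eq_zero (by simp), midSgn_eq_zero (by simp)] at this
    have h3 : 1 - max 0 (min a 1) ≤ δ :=
      le_trans (le_trans (le_abs_self _) (le_of_eq (congrArg _ (by ring)))) this
    rw [h1, Nat.cast_one]
    rcases max_cases 0 (min a 1) with ⟨e, -⟩ | ⟨e, -⟩ <;> rw [e] at h3
    · linarith
    · linarith [min_le_left a 1]
  -- Tests with the lower vertex `x` of the middle edge. This works if the other half does not use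
  -- `x` for its middle edge or has no middle edge.
  · have key : ∀ x : ℤ × ℤ, x.1 < k → |midSgn {x} 1 k m ε| = 1 →
        midSgn {x} 1 k m (-ε) * ((hl m (-ε) : ℝ) - 1) = 0 → hl m ε - δ ≤ a := by
      intro x hx hm1 hm2
      have hm3 : midSgn {x} 1 k m (-ε) * ((hl m (-ε) : ℝ) - 1 -
          max 0 (min (travelPos (hl m (-ε)) u' y' - 1) ((hl m (-ε) : ℝ) - 1))) = 0 := by
        rcases mul_eq_zero.1 hm2 with h | h
        · rw [h, zero_mul]
        · rw [h, max_eq_left (min_le_right _ _), sub_zero, mul_zero]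
      have := h.abs_pot_sub_le (S := {x}) (s := 1) abs_one_le
      rw [pot_cellPt_center _ _ hε, pot_cellPt_center _ _ hε', hm3,
        sgn_singleton_of_ne (v := (k + 1, 3 * m + 2 * ε)) (ne_of_fst (by simp only; omega)),
        sgn_singleton_of_ne (v := (k + 1, 3 * m + ε)) (ne_of_fst (by simp only; omega)),
        sgn_singleton_of_ne (v := (k + 1, 3 * m + -ε)) (ne_of_fst (by simp only; omega)),
        sgn_singleton_of_ne (v := (k + 1, 3 * m + 2 * -ε)) (ne_of_fst (by simp only; omega)),
        sgn_singleton_of_ne (v := (k + 1, 3 * m)) (ne_of_fst (by simp only; omega)),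
        sgn_singleton_of_ne (v := (k, m + ε)) (ne_of_fst (by simp only; omega)),
        sgn_singleton_of_ne (v := (k, m + -ε)) (ne_of_fst (by simp only; omega))] at this
      have h3 : |midSgn {x} 1 k m ε * (hl m ε - 1 - max 0 (min (a - 1) (hl m ε - 1)))| ≤ δ := by
        rw [← abs_neg]
        exact le_trans (le_of_eq (congrArg _ (by ring))) this
      rw [abs_mul, hm1, one_mul] at h3
      have h4 := (le_abs_self _).trans h3
      rw [h2] at h4 ⊢
      push_cast at h4 ⊢
      rcases max_cases 0 (min (a - 1) ((2 : ℝ) - 1)) with ⟨e, -⟩ | ⟨e, -⟩ <;> rw [e] at h4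
      · linarith
      · linarith [min_le_left (a - 1) ((2 : ℝ) - 1)]
    by_cases hup : par (par (k, m + ε)) = cen k m
    · refine key (par (k, m + ε)) hn ?_ ?_
      · rw [midSgn, if_pos hup, sgn_self]; simp
      · rw [midSgn]
        split_ifs with hup'
        · rw [sgn_singleton_of_ne, neg_zero, zero_mul]
          intro e
          exact center_up m ε hε h2 k hup (e ▸ Above.refl _)
        · rw [sgn_singleton_of_ne, zero_mul]
          intro e
          have := par_fst_lt (par (k, m + ε))
          rw [hup, e] at this
          exact lt_irrefl _ this
    · have hdown := (hl_eq_two_dir m ε hε h2 k).resolve_left hup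
      refine key (cen k m) hc ?_ ?_
      · rw [midSgn, if_neg hup, sgn_self]; simp
      · rw [midSgn]
        split_ifs with hup'
        · rw [sgn_singleton_of_ne, neg_zero, zero_mul]
          intro e
          have := par_fst_lt (par (k, m + -ε))
          rw [hup', e] at this
          exact lt_irrefl _ this
        · rcases hl_eq m (-ε) hε' with h1 | h2'
          · rw [h1]; simp
          -- If both halves descended to the centre, the centre would be above its own parent by
          -- `center_down`.
          · exfalso
            have e := (hl_eq_two_dir m (-ε) hε' h2' k).resolve_left hup'
            have h3 := (center_down m ε hε h2 k hdown).fst_le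
            have h4 := par_fst_lt (cen k m)
            rw [e] at h4
            omega

/-! ### Points of adjacent runs -/

/-- The second point starts its travel on the edge on which the first one rests, and matching points
have opposite positions. A travel position above 1 would already give a difference of at least 1. -/
theorem Close.adjacent_pos (hε : ε = 1 ∨ ε = -1) {u y u' y' δ : ℝ} (hδ : δ < 1 / 2)
    (hu : u ∈ Set.Icc (0 : ℝ) (1 / 2)) (hy : y ∈ Set.Icc (0 : ℝ) 1)
    (h : Close (cellPt k m ε u y) (cellPt k (m + ε) (-ε) u' y') δ) :
    |restPos u y + travelPos (hl (m + ε) (-ε)) u' y'| ≤ δ := by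
  have hε' : -ε = 1 ∨ -ε = -1 := by omega
  set a := travelPos (hl (m + ε) (-ε)) u' y'
  let S : Finset (ℤ × ℤ) := {(k + 1, 3 * m + ε), (k, m)}
  have hmem : ∀ v : ℤ × ℤ, v ∈ S ↔ v = (k + 1, 3 * m + ε) ∨ v = (k, m) := by simp [S]
  have hnot : ∀ v : ℤ × ℤ, v ≠ (k + 1, 3 * m + ε) → v ≠ (k, m) → sgn S 1 v = 0 :=
    fun v h1 h2 => sgn_of_notMem (by rw [hmem]; tauto)
  have hS : ∀ v ∈ S, k ≤ v.1 := by
    intro v hv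
    rcases (hmem v).1 hv with rfl | rfl <;> simp
  have := h.abs_pot_sub_le (S := S) (s := 1) abs_one_le
  rw [pot_cellPt _ _ hε, pot_cellPt _ _ hε', midSgn_eq_zero hS, midSgn_eq_zero hS,
    show m + ε + -ε = m by ring, show 3 * (m + ε) + 2 * -ε = 3 * m + ε by ring,
    sgn_of_mem (v := (k + 1, 3 * m + ε)) ((hmem _).2 (Or.inl rfl)),
    sgn_of_mem (v := (k, m)) ((hmem _).2 (Or.inr rfl)),
    hnot (k + 1, 3 * m + 2 * ε) (ne_of_snd (by simp only; omega)) (ne_of_fst (by simp only; omega)),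
    hnot (k, m + ε) (ne_of_fst (by simp only; omega)) (ne_of_snd (by simp only; omega)),
    hnot (k + 1, 3 * m) (ne_of_snd (by simp only; omega)) (ne_of_fst (by simp only; omega)),
    hnot (k + 1, 3 * (m + ε) + -ε) (ne_of_snd (by simp only; omega))
      (ne_of_fst (by simp only; omega)),
    hnot (k + 1, 3 * (m + ε)) (ne_of_snd (by simp only; omega))
      (ne_of_fst (by simp only; omega))] at this
  have h2 : |restPos u y + (min a 0 + max 0 (min a 1))| ≤ δ := by
    refine le_trans (le_of_eq (congrArg _ ?_)) this
    simp only [Pi.one_apply]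
    ring
  have hb := restPos_mem hu hy
  have h3 : min a 0 + max 0 (min a 1) = min a 1 := by
    rcases le_total a 0 with h | h
    · rw [min_eq_left h, min_eq_left (by linarith), max_eq_left h, add_zero]
    · rw [min_eq_right h, zero_add, max_eq_right (le_min h zero_le_one)]
  rw [h3] at h2
  rwa [min_eq_left] at h2
  by_contra hcon
  rw [min_eq_right (not_le.1 hcon).le] at h2
  have := (le_abs_self _).trans h2
  linarith [hb.1]

/-- Points of adjacent runs which are not in the half-runs next to each other. -/
theorem Close.one_le_of_far {ε' : ℤ} (hε : ε = 1 ∨ ε = -1) (hε' : ε' = 1 ∨ ε' = -1) {u y u' y' δ : ℝ}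
    (hu : u ∈ Set.Icc (0 : ℝ) (1 / 2)) (hy : y ∈ Set.Icc (0 : ℝ) 1)
    (h : Close (cellPt k m ε' u y) (cellPt k (m + ε) ε u' y') δ) : 1 ≤ δ := by
  have h1 := one_le_cellPt (k := k) (m := m) hε' hu hy 0
  have h2 : cellPt k (m + ε) ε u' y' (k, m) = 0 := by
    have e : ∀ f : ℤ × ℤ → ℝ, pot {(k, m)} 1 f = f (k, m) := fun f => by simp [pot]
    have h0 : ∀ n, n ≠ m → ind (k, n) (k, m) = 0 := fun n hn =>
      ind_of_not_above fun h => hn (congrArg Prod.snd (h.eq_of_fst_le le_rfl))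
    rw [← e (cellPt k (m + ε) ε u' y'), pot_cellPt _ _ hε, e, e, h0 _ (by omega), h0 _ (by omega), midSgn_eq_zero (by simp),
      sgn_singleton_of_ne (v := (k + 1, 3 * (m + ε) + ε)) (ne_of_fst (by simp only; omega)),
      sgn_singleton_of_ne (v := (k + 1, 3 * (m + ε) + 2 * ε)) (ne_of_fst (by simp only; omega)),
      sgn_singleton_of_ne (v := (k + 1, 3 * (m + ε))) (ne_of_fst (by simp only; omega)),
      sgn_singleton_of_ne (v := (k, m + ε + ε)) (ne_of_snd (by simp only; omega))]
    ring
  have h3 := h.abs_sub_le (k, m)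
  simp only [Nat.cast_zero, sub_zero, Function.iterate_zero, id] at h1
  rw [h2, sub_zero] at h3
  exact h1.trans ((le_abs_self _).trans h3)

/-- The two points of the forest determine the point of a layer. -/
theorem Close.same_layer {m' ε' : ℤ} (hε : ε = 1 ∨ ε = -1) (hε' : ε' = 1 ∨ ε' = -1)
    {u y u' y' δ : ℝ} (hu : u ∈ Set.Icc (0 : ℝ) (1 / 2)) (hy : y ∈ Set.Icc (0 : ℝ) 1)
    (hu' : u' ∈ Set.Icc (0 : ℝ) (1 / 2)) (hy' : y' ∈ Set.Icc (0 : ℝ) 1) (hδ : δ < 1 / 2)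
    (h : Close (cellPt k m ε u y) (cellPt k m' ε' u' y') δ) :
    |(m + ε * (1 / 2 - u)) - (m' + ε' * (1 / 2 - u'))| ≤ 4 * δ ∧ |y - y'| ≤ 3 * δ := by
  have hδ0 := h.nonneg
  have habs : |(ε : ℝ)| = 1 := by rcases hε with h | h <;> rw [h] <;> simp
  rcases lt_or_ge |m' - m| 2 with hm | hm
  · by_cases hmm : m' = m
    · subst hmm
      rcases (show ε' = ε ∨ ε' = -ε by omega) with rfl | rfl
      · obtain ⟨ha, hb⟩ := h.same_cell hε
        obtain ⟨h1, h2⟩ := abs_sub_le_of_pos (hl_cast_eq hε) hu.1 hu'.1 hy hy' ha hb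
        refine ⟨?_, by linarith⟩
        rw [show (m' : ℝ) + ε' * (1 / 2 - u) - (m' + ε' * (1 / 2 - u')) = ε' * (u' - u) by ring,
          abs_mul, habs, one_mul, abs_sub_comm]
        linarith
      · have hs : Close (cellPt k m' (-ε) u' y') (cellPt k m' (- -ε) u y) δ := by
          rw [neg_neg]; exact h.symm
        obtain ⟨h1, h2⟩ := center_le_of_pos (hl_cast_eq hε) hu hy (h.opposite_rest hε)
          (h.opposite_travel hε (by linarith))
        obtain ⟨h1', h2'⟩ := center_le_of_pos (hl_cast_eq hε') hu' hy'
          (hs.opposite_rest hε') (hs.opposite_travel hε' (by linarith))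
        have h3 := h.opposite_center hε
        constructor
        · push_cast
          rw [show (m' : ℝ) + ε * (1 / 2 - u) - (m' + -ε * (1 / 2 - u')) =
            ε * ((1 / 2 - u) + (1 / 2 - u')) by ring, abs_mul, habs, one_mul,
            abs_of_nonneg (by linarith [hu.2, hu'.2])]
          linarith
        · rw [abs_le] at *
          constructor <;> linarith
    · obtain ⟨η, hη, rfl⟩ : ∃ η, (η = 1 ∨ η = -1) ∧ m' = m + η :=
        ⟨m' - m, by rw [abs_lt] at hm; omega, by ring⟩
      by_cases h1 : ε' = η
      · subst h1
        linarith [h.one_le_of_far hε' hε hu hy]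
      by_cases h2 : ε = -η
      · subst h2
        have hs : Close (cellPt k (m + η) ε' u' y') (cellPt k (m + η + -η) (-η) u y) δ := by
          rw [add_neg_cancel_right]; exact h.symm
        linarith [hs.one_le_of_far hε hε' hu' hy']
      obtain rfl : η = ε := by omega
      obtain rfl : ε' = -η := by omega
      have e : m + η + -η = m := by ring
      have hs : Close (cellPt k (m + η) (-η) u' y') (cellPt k (m + η + -η) (- -η) u y) δ := by
        rw [e, neg_neg]; exact h.symm
      have h3 := h.adjacent_pos hε hδ hu hy
      have h4 := hs.adjacent_pos hε' hδ hu' hy'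
      rw [neg_neg, e] at h4
      obtain ⟨g1, g2, g3⟩ := boundary_le_of_pos (hl_cast_eq hε) (hl_cast_eq hε') hu hu' hy hy'
        (by linarith) h3 h4
      refine ⟨?_, by linarith⟩
      push_cast
      rw [show (m : ℝ) + η * (1 / 2 - u) - (m + η + -η * (1 / 2 - u')) = -(η * (u + u')) by ring,
        abs_neg, abs_mul, habs, one_mul, abs_of_nonneg (by linarith [hu.1, hu'.1])]
      linarith
  · exfalso
    have h1 := one_le_cellPt (k := k) (m := m) hε hu hy 0
    have h2 := cellPt_eq_zero_of_two_le (k := k) (m := m') hε' 0 (κ := k) (by simp) (n := m) hm u' y'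
    have h3 := h.abs_sub_le (k, m)
    simp only [Nat.cast_zero, sub_zero, Function.iterate_zero, id] at h1
    rw [h2, sub_zero] at h3
    linarith [(le_abs_self _).trans h3]

/-! ### Points of different layers -/

/-- The `k - k' - 1` vertices of the ancestral runs on levels `k' + 2` to `k` have value at least 1
for the first point and 0 for the second. -/
theorem Close.level_le {k' m' ε' : ℤ} (hε : ε = 1 ∨ ε = -1) (hε' : ε' = 1 ∨ ε' = -1)
    {u y u' y' δ : ℝ} (hu : u ∈ Set.Icc (0 : ℝ) (1 / 2)) (hy : y ∈ Set.Icc (0 : ℝ) 1)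
    (h : Close (cellPt k m ε u y) (cellPt k' m' ε' u' y') δ) : (k : ℝ) - k' - 1 ≤ δ := by
  rcases le_total k (k' + 1) with hk | hk
  · have : (k : ℝ) ≤ k' + 1 := by exact_mod_cast hk
    linarith [h.nonneg]
  · obtain ⟨N, rfl⟩ := Int.le.dest hk
    have h1 := h ((Finset.range N).image fun i : ℕ => ((k' + 1 + N - i, up^[i] m) : ℤ × ℤ))
    rw [Finset.sum_image (fun i _ j _ hij => by
      have := congrArg Prod.fst hij
      simp only at this
      omega)] at h1
    have h2 : ∀ i ∈ Finset.range N, (1 : ℝ) ≤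
        |cellPt (k' + 1 + N) m ε u y (k' + 1 + N - i, up^[i] m) -
          cellPt k' m' ε' u' y' (k' + 1 + N - i, up^[i] m)| := by
      intro i hi
      rw [Finset.mem_range] at hi
      rw [cellPt_eq_zero_of_lt hε' (by simp only; omega), sub_zero]
      exact (one_le_cellPt hε hu hy i).trans (le_abs_self _)
    have h3 := (Finset.sum_le_sum h2).trans h1
    simp only [Finset.sum_const, Finset.card_range, nsmul_eq_mul, mul_one] at h3
    push_cast
    linarith

/-- The vertex of the lower run has value at least 1 for the second point, but at most `y` for the
first, by `cellPt_le`. -/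
theorem Close.next_level {m' ε' : ℤ} (hε : ε = 1 ∨ ε = -1) (hε' : ε' = 1 ∨ ε' = -1)
    {u y u' y' δ : ℝ} (hu : u ∈ Set.Icc (0 : ℝ) (1 / 2)) (hy : y ∈ Set.Icc (0 : ℝ) 1)
    (hu' : u' ∈ Set.Icc (0 : ℝ) (1 / 2)) (hy' : y' ∈ Set.Icc (0 : ℝ) 1)
    (h : Close (cellPt k m ε u y) (cellPt (k + 1) m' ε' u' y') δ) : 1 - y ≤ δ := by
  have h1 := one_le_cellPt (k := k + 1) (m := m') hε' hu' hy' 0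
  have h2 := cellPt_le (k := k) (m := m) hε hu hy (x := (k + 1, m')) rfl
  have h3 := h.symm.abs_sub_le (k + 1, m')
  simp only [Nat.cast_zero, sub_zero, Function.iterate_zero, id] at h1
  linarith [(le_abs_self _).trans h3]

/-- The runs of two points have neighbouring ancestors on a level which is not too far up. -/
theorem Close.exists_ancestor {k' m' ε' : ℤ} (hε : ε = 1 ∨ ε = -1) (hε' : ε' = 1 ∨ ε' = -1)
    {u y u' y' δ : ℝ} (hu : u ∈ Set.Icc (0 : ℝ) (1 / 2)) (hy : y ∈ Set.Icc (0 : ℝ) 1)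
    (hk : k' ≤ k) (h : Close (cellPt k m ε u y) (cellPt k' m' ε' u' y') δ) :
    ∃ i j : ℕ, k - i = k' - j ∧ |up^[i] m - up^[j] m'| ≤ 1 ∧ (i : ℝ) ≤ 2 * δ + 1 ∧
      (j : ℝ) ≤ 2 * δ + 1 := by
  obtain ⟨e, rfl⟩ := Int.le.dest hk
  have he := h.level_le hε hε' hu hy
  push_cast at he
  have hδ := h.nonneg
  have hfl := Nat.floor_le hδ
  have hlt := Nat.lt_floor_add_one δ
  by_contra hcon
  push Not at hcon
  -- Otherwise the ancestral runs on `⌊δ⌋₊ + 1` common levels are not even adjacent, and each level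
  -- contributes a difference of at least 1.
  have hfar : ∀ j ∈ Finset.range (⌊δ⌋₊ + 1), 2 ≤ |up^[j] m' - up^[e + j] m| := by
    intro j hj
    rw [Finset.mem_range] at hj
    by_contra hlt
    have hj' : (j : ℝ) ≤ δ := by
      have : (j : ℝ) ≤ ⌊δ⌋₊ := by exact_mod_cast Nat.lt_succ_iff.1 hj
      linarith
    have := hcon (e + j) j (by push_cast; ring) (by rw [abs_sub_comm]; omega)
      (by push_cast; linarith)
    linarith
  have h1 := h ((Finset.range (⌊δ⌋₊ + 1)).image fun j : ℕ =>
    ((k' + e - (e + j : ℕ), up^[e + j] m) : ℤ × ℤ))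
  rw [Finset.sum_image (fun i _ j _ hij => by
    have := congrArg Prod.fst hij
    simp only at this
    omega)] at h1
  have h2 : ∀ j ∈ Finset.range (⌊δ⌋₊ + 1), (1 : ℝ) ≤
      |cellPt (k' + e) m ε u y (k' + e - (e + j : ℕ), up^[e + j] m) -
        cellPt k' m' ε' u' y' (k' + e - (e + j : ℕ), up^[e + j] m)| := by
    intro j hj
    rw [cellPt_eq_zero_of_two_le hε' j (by push_cast; ring) (hfar j hj), sub_zero]
    exact (one_le_cellPt hε hu hy (e + j)).trans (le_abs_self _)
  have h3 := (Finset.sum_le_sum h2).trans h1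
  simp only [Finset.sum_const, Finset.card_range, nsmul_eq_mul, mul_one] at h3
  push_cast at h3
  linarith

end TernaryForest

/-! ### From the two trees back to the hyperbolic plane. -/

namespace TernaryForest

section

variable {c k m ε : ℤ} {u y : ℝ}

theorem adapted_cellLoc (hε : ε = 1 ∨ ε = -1) (c k m : ℤ) (u y : ℝ) :
    Adapted (k + 1) (3 * m + ε) (cellLoc c k m ε u y).1 := by
  unfold cellLoc
  split_ifs
  · exact adapted_rest hε k m
  · exact adapted_travelEdge hε k m _

theorem even_cellLoc (hε : ε = 1 ∨ ε = -1) (c k m : ℤ) (u y : ℝ) :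
    Even ((cellLoc c k m ε u y).1.1 + (cellLoc c k m ε u y).1.2) ↔ Even c := by
  unfold cellLoc
  split_ifs with h
  · simp only [Int.even_iff] at *; omega
  · rw [even_travelEdge hε]; simp only [Int.even_iff] at *; omega

theorem cellLoc_snd_mem (hε : ε = 1 ∨ ε = -1) (c k m : ℤ) (hu : u ∈ Set.Icc (0 : ℝ) (1 / 2))
    (hy : y ∈ Set.Icc (0 : ℝ) 1) : (cellLoc c k m ε u y).2 ∈ Set.Icc (0 : ℝ) 1 := by
  unfold cellLoc
  split_ifs
  · exact restPos_mem hu hy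
  · have h := travelPos_mem (hl_cast_eq (m := m) hε) hu.1 hy
    exact travelParam_mem hε (by linarith [h.1, hy.2]) (by linarith [h.2, hy.2])

theorem cellPt_eq (k m ε : ℤ) (u y : ℝ) : cellPt k m ε u y =
    pt (cellLoc 0 k m ε u y).1 (cellLoc 0 k m ε u y).2 +
      pt (cellLoc 1 k m ε u y).1 (cellLoc 1 k m ε u y).2 := by
  unfold cellPt travelPt cellLoc
  by_cases h : Even (k + m)
  · rw [if_pos (by simpa using h), if_neg (by simp only [Int.even_iff] at *; omega)]
  · rw [if_neg (by simpa using h), if_pos (by simp only [Int.even_iff] at *; omega), add_comm]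

theorem l1_add_add_le (f f' g g' : ℤ × ℤ → ℝ) : l1 (f + g) (f' + g') ≤ l1 f f' + l1 g g' := by
  rw [l1, l1, l1, ← ENNReal.tsum_add]
  refine ENNReal.tsum_le_tsum fun y => ?_
  rw [← ENNReal.ofReal_add (abs_nonneg _) (abs_nonneg _)]
  refine ENNReal.ofReal_le_ofReal ?_
  rw [Pi.add_apply, Pi.add_apply, add_sub_add_comm]
  exact abs_add_le _ _

theorem close_of_l1_le {f g : ℤ × ℤ → ℝ} {δ : ℝ} (hδ : 0 ≤ δ) (h : l1 f g ≤ ENNReal.ofReal δ) :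
    Close f g δ := fun S => by
  rw [← ENNReal.ofReal_le_ofReal_iff hδ, ENNReal.ofReal_sum_of_nonneg fun _ _ => abs_nonneg _]
  exact (ENNReal.sum_le_tsum S).trans h

variable {E : Type*} [PseudoEMetricSpace E] {R : ℕ} (Φ : WordMap E R)

theorem WordMap.close_cellPt (hR : 0 < R) {k' m' ε' : ℤ} (hε : ε = 1 ∨ ε = -1)
    (hε' : ε' = 1 ∨ ε' = -1) {u' y' d : ℝ} (hu : u ∈ Set.Icc (0 : ℝ) (1 / 2))
    (hy : y ∈ Set.Icc (0 : ℝ) 1) (hu' : u' ∈ Set.Icc (0 : ℝ) (1 / 2))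
    (hy' : y' ∈ Set.Icc (0 : ℝ) 1) (hd : 0 ≤ d)
    (h : edist (Φ.cell 0 k m ε u y) (Φ.cell 0 k' m' ε' u' y') +
      edist (Φ.cell 1 k m ε u y) (Φ.cell 1 k' m' ε' u' y') ≤ ENNReal.ofReal d) :
    Close (cellPt k m ε u y) (cellPt k' m' ε' u' y') (2 * d) := by
  refine close_of_l1_le (by linarith) ?_
  rw [cellPt_eq, cellPt_eq]
  refine (l1_add_add_le _ _ _ _).trans ?_
  have h1 := Φ.l1_add_le (adapted_cellLoc hε 0 k m u y) (adapted_cellLoc hε' 0 k' m' u' y')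
    (adapted_cellLoc hε 1 k m u y) (adapted_cellLoc hε' 1 k' m' u' y')
    (by rw [even_cellLoc hε, even_cellLoc hε'])
    (by rw [even_cellLoc hε, even_cellLoc hε]; decide)
    (by rw [even_cellLoc hε, even_cellLoc hε']; decide)
    (cellLoc_snd_mem hε 0 k m hu hy) (cellLoc_snd_mem hε' 0 k' m' hu' hy')
    (cellLoc_snd_mem hε 1 k m hu hy) (cellLoc_snd_mem hε' 1 k' m' hu' hy')
  have h2 : (1 : ℝ≥0∞) ≤ R := by exact_mod_cast hR
  refine (le_mul_of_one_le_left zero_le h2).trans (h1.trans ?_)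
  rw [ENNReal.ofReal_mul zero_le_two, ENNReal.ofReal_ofNat]
  exact mul_le_mul_right h 2

end

/-! ### The hyperbolic plane -/

/-- The point of the hyperbolic plane with horizontal coordinate `x` and height `3 ^ (-t)`. -/
noncomputable def hpt (x t : ℝ) : UpperHalfPlane := ⟨⟨x, 3 ^ (-t)⟩, by positivity⟩

theorem dist_hpt_vertical (x t t' : ℝ) : dist (hpt x t) (hpt x t') ≤ 2 * |t - t'| := by
  have h0 : Real.log 3 ≤ 2 := by
    have := Real.log_le_sub_one_of_pos (show (0 : ℝ) < 3 by norm_num)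
    linarith
  have h1 : (0 : ℝ) ≤ Real.log 3 := Real.log_nonneg (by norm_num)
  have e : ∀ t, Real.log (hpt x t).im = -t * Real.log 3 := fun t =>
    Real.log_rpow (by norm_num) (-t)
  rw [UpperHalfPlane.dist_of_re_eq (by rfl), e, e, Real.dist_eq,
    show -t * Real.log 3 - -t' * Real.log 3 = Real.log 3 * (t' - t) by ring, abs_mul,
    abs_of_nonneg h1, abs_sub_comm]
  exact mul_le_mul_of_nonneg_right h0 (abs_nonneg _)

theorem dist_hpt_horizontal (x x' t : ℝ) : dist (hpt x t) (hpt x' t) ≤ |x - x'| * 3 ^ t := by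
  have h1 := UpperHalfPlane.sinh_half_dist (hpt x t) (hpt x' t)
  have h2 : (0 : ℝ) < 3 ^ (-t) := by positivity
  have e1 : dist (hpt x t : ℂ) (hpt x' t) = |x - x'| := by
    rw [Complex.dist_of_im_eq (by rfl)]; rfl
  have e2 : √((hpt x t).im * (hpt x' t).im) = 3 ^ (-t) := Real.sqrt_mul_self h2.le
  rw [e1, e2] at h1
  have h3 := Real.self_le_sinh_iff.2 (show 0 ≤ dist (hpt x t) (hpt x' t) / 2 by positivity)
  rw [h1, Real.rpow_neg (by norm_num)] at h3
  have h4 : |x - x'| / (2 * ((3 : ℝ) ^ t)⁻¹) = |x - x'| * 3 ^ t / 2 := by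
    have : (3 : ℝ) ^ t ≠ 0 := by positivity
    field_simp
  linarith

/-- The coordinates of a point in its cell. -/
theorem exists_cell_of_point (x t : ℝ) : ∃ m ε : ℤ, (ε = 1 ∨ ε = -1) ∧
    ∃ u ∈ Set.Icc (0 : ℝ) (1 / 2), x * 3 ^ ⌊t⌋ = m + ε * (1 / 2 - u) ∧
      ∀ {E : Type*} [PseudoEMetricSpace E] {R : ℕ} (Φ : WordMap E R) (c : ℤ),
        Φ.plane c x t = Φ.cell c ⌊t⌋ m ε u (t - (⌊t⌋ : ℝ)) := by
  obtain ⟨m, ε, hε, u, hu, hX, h⟩ := exists_cell (x * 3 ^ ⌊t⌋)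
  refine ⟨m, ε, hε, u, hu, hX, fun Φ c => ?_⟩
  rw [WordMap.plane, WordMap.layer, WordMap.cell, h]

/-- Rounding adds an error of at most 1 before the division by 3, and `(1 / 2 + 1) / 3 = 1 / 2`. -/
theorem abs_sub_up_iterate_le {k m : ℤ} {x : ℝ} (h : |x * 3 ^ k - m| ≤ 1 / 2) (i : ℕ) :
    |x * 3 ^ (k - i) - (up^[i] m : ℤ)| ≤ 1 / 2 := by
  induction i with
  | zero => simpa using h
  | succ i ih =>
    rw [Function.iterate_succ_apply']
    set n := up^[i] m
    have h3 : x * (3 : ℝ) ^ (k - i) = 3 * (x * 3 ^ (k - (i + 1 : ℕ))) := by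
      rw [show k - i = k - (i + 1 : ℕ) + 1 by push_cast; ring, zpow_add_one₀ three_ne_zero]
      ring
    rw [h3] at ih
    have h4 : (|(n : ℝ) - 3 * up n|) ≤ 1 := by
      have : |n - 3 * up n| ≤ 1 := by
        rw [abs_le]; rcases eq_up n with h | h | h <;> omega
      exact_mod_cast this
    rw [abs_le] at *
    constructor <;> linarith

section

variable {k m ε k' m' ε' : ℤ} {u u' δ x x' t t' : ℝ}

/-- Both points climb at most `2 * δ + 2` levels, at cost 2 per level, to neighbouring ancestral
runs; crossing over there costs at most 2. -/
theorem Close.dist_le_coarse_of_le (hε : ε = 1 ∨ ε = -1) (hε' : ε' = 1 ∨ ε' = -1)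
    (hu : u ∈ Set.Icc (0 : ℝ) (1 / 2)) (hu' : u' ∈ Set.Icc (0 : ℝ) (1 / 2))
    (hx : x * 3 ^ ⌊t⌋ = m + ε * (1 / 2 - u)) (hx' : x' * 3 ^ ⌊t'⌋ = m' + ε' * (1 / 2 - u'))
    (hle : ⌊t'⌋ ≤ ⌊t⌋)
    (h : Close (cellPt ⌊t⌋ m ε u (t - (⌊t⌋ : ℝ))) (cellPt ⌊t'⌋ m' ε' u' (t' - (⌊t'⌋ : ℝ))) δ) :
    dist (hpt x t) (hpt x' t') ≤ 8 * δ + 10 := by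
  obtain ⟨i, j, hij, hm, hi, hj⟩ := h.exists_ancestor hε hε' hu (sub_floor_mem t) hle
  have hX : ∀ {x : ℝ} {k m ε : ℤ} {u : ℝ}, (ε = 1 ∨ ε = -1) → u ∈ Set.Icc (0 : ℝ) (1 / 2) →
      x * 3 ^ k = m + ε * (1 / 2 - u) → |x * 3 ^ k - m| ≤ 1 / 2 := by
    intro x k m ε u hε hu h
    rw [h, add_sub_cancel_left, abs_le]
    rcases hε with rfl | rfl <;> push_cast <;> constructor <;> linarith [hu.1, hu.2]
  have h1 := abs_sub_up_iterate_le (hX hε hu hx) i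
  have h2 := abs_sub_up_iterate_le (hX hε' hu' hx') j
  rw [← hij] at h2
  set κ : ℤ := ⌊t⌋ - i
  have hκ : (κ : ℝ) = ⌊t⌋ - i := by push_cast [κ]; ring
  have hκ' : (κ : ℝ) = ⌊t'⌋ - j := by rw [hij]; push_cast; ring
  have hm' : |((up^[i] m : ℤ) : ℝ) - (up^[j] m' : ℤ)| ≤ 1 := by exact_mod_cast hm
  have h3 : |x - x'| * 3 ^ (κ : ℝ) ≤ 2 := by
    rw [Real.rpow_intCast, ← abs_of_pos (zpow_pos (by norm_num : (0 : ℝ) < 3) κ), ← abs_mul,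
      sub_mul]
    rw [abs_le] at *
    constructor <;> linarith
  have d1 := dist_hpt_vertical x t κ
  have d2 := dist_hpt_horizontal x x' κ
  have d3 := dist_hpt_vertical x' κ t'
  have f1 := Int.floor_le t
  have f2 := Int.lt_floor_add_one t
  have f1' := Int.floor_le t'
  have f2' := Int.lt_floor_add_one t'
  have i0 : (0 : ℝ) ≤ i := Nat.cast_nonneg i
  have j0 : (0 : ℝ) ≤ j := Nat.cast_nonneg j
  rw [abs_of_nonneg (by linarith)] at d1
  rw [abs_of_nonpos (by linarith)] at d3
  have := dist_triangle4 (hpt x t) (hpt x κ) (hpt x' κ) (hpt x' t')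
  linarith

theorem Close.dist_le_coarse (hε : ε = 1 ∨ ε = -1) (hε' : ε' = 1 ∨ ε' = -1)
    (hu : u ∈ Set.Icc (0 : ℝ) (1 / 2)) (hu' : u' ∈ Set.Icc (0 : ℝ) (1 / 2))
    (hx : x * 3 ^ ⌊t⌋ = m + ε * (1 / 2 - u)) (hx' : x' * 3 ^ ⌊t'⌋ = m' + ε' * (1 / 2 - u'))
    (h : Close (cellPt ⌊t⌋ m ε u (t - (⌊t⌋ : ℝ))) (cellPt ⌊t'⌋ m' ε' u' (t' - (⌊t'⌋ : ℝ))) δ)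
    (hδ : 1 / 2 ≤ δ) : dist (hpt x t) (hpt x' t') ≤ 28 * δ := by
  rcases le_total ⌊t'⌋ ⌊t⌋ with hle | hle
  · linarith [h.dist_le_coarse_of_le hε hε' hu hu' hx hx' hle]
  · rw [dist_comm]
    linarith [h.symm.dist_le_coarse_of_le hε' hε hu' hu hx' hx hle]

theorem Close.dist_le_same_layer (hε : ε = 1 ∨ ε = -1) (hε' : ε' = 1 ∨ ε' = -1)
    (hu : u ∈ Set.Icc (0 : ℝ) (1 / 2)) (hu' : u' ∈ Set.Icc (0 : ℝ) (1 / 2))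
    (hx : x * 3 ^ ⌊t⌋ = m + ε * (1 / 2 - u)) (hx' : x' * 3 ^ ⌊t'⌋ = m' + ε' * (1 / 2 - u'))
    (heq : ⌊t'⌋ = ⌊t⌋)
    (h : Close (cellPt ⌊t⌋ m ε u (t - (⌊t⌋ : ℝ))) (cellPt ⌊t'⌋ m' ε' u' (t' - (⌊t'⌋ : ℝ))) δ) :
    dist (hpt x t) (hpt x' t') ≤ 28 * δ := by
  rcases le_or_gt (1 / 2) δ with hδ | hδ
  · exact h.dist_le_coarse hε hε' hu hu' hx hx' hδ
  have hy' := sub_floor_mem t'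
  rw [heq] at h hx' hy'
  obtain ⟨h1, h2⟩ := h.same_layer hε hε' hu (sub_floor_mem t) hu' hy' hδ
  rw [← hx, ← hx', ← sub_mul, abs_mul, abs_of_pos (zpow_pos (by norm_num : (0 : ℝ) < 3) _)] at h1
  rw [sub_sub_sub_cancel_right] at h2
  have h3 : |x - x'| * 3 ^ t ≤ 12 * δ := by
    have : (3 : ℝ) ^ t ≤ 3 * 3 ^ ⌊t⌋ := by
      rw [mul_comm, ← zpow_add_one₀ three_ne_zero, ← Real.rpow_intCast]
      refine Real.rpow_le_rpow_of_exponent_le (by norm_num) ?_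
      push_cast
      exact (Int.lt_floor_add_one t).le
    nlinarith [mul_le_mul_of_nonneg_left this (abs_nonneg (x - x'))]
  have d1 := dist_hpt_horizontal x x' t
  have d2 := dist_hpt_vertical x' t t'
  have := dist_triangle (hpt x t) (hpt x' t) (hpt x' t')
  linarith [h.nonneg]

end

section

variable {E : Type*} [PseudoEMetricSpace E] {R : ℕ} (Φ : WordMap E R)

/-- The sum of the distances of the images in the two trees. -/
noncomputable def WordMap.planeDist (x t x' t' : ℝ) : ℝ≥0∞ :=
  edist (Φ.plane 0 x t) (Φ.plane 0 x' t') + edist (Φ.plane 1 x t) (Φ.plane 1 x' t')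

theorem WordMap.planeDist_comm (x t x' t' : ℝ) :
    Φ.planeDist x t x' t' = Φ.planeDist x' t' x t := by
  rw [planeDist, planeDist, edist_comm, edist_comm (Φ.plane 1 x t)]

theorem WordMap.dist_le_of_floor_eq (hR : 0 < R) {x t x' t' d : ℝ} (hd : 0 ≤ d)
    (h : Φ.planeDist x t x' t' ≤ ENNReal.ofReal d) (heq : ⌊t'⌋ = ⌊t⌋) :
    dist (hpt x t) (hpt x' t') ≤ 56 * d := by
  obtain ⟨m, ε, hε, u, hu, hx, hΦ⟩ := exists_cell_of_point x t
  obtain ⟨m', ε', hε', u', hu', hx', hΦ'⟩ := exists_cell_of_point x' t'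
  rw [planeDist, hΦ, hΦ, hΦ', hΦ'] at h
  have := (Φ.close_cellPt hR hε hε' hu (sub_floor_mem t) hu' (sub_floor_mem t') hd
    h).dist_le_same_layer hε hε' hu hu' hx hx' heq
  linarith

/-- Close points in different layers are in adjacent ones, and the higher point is within `2 * d` of
the common boundary. Moving it there changes each image by at most `14 * R * d` and reduces to a
single layer, whence `56 * (1 + 28 * R) + 4 = 60 + 1568 * R`. -/
theorem WordMap.dist_le_of_floor_le (hR : 0 < R) {x t x' t' d : ℝ} (hd : 0 ≤ d)
    (h : Φ.planeDist x t x' t' ≤ ENNReal.ofReal d) (hle : ⌊t⌋ ≤ ⌊t'⌋) :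
    dist (hpt x t) (hpt x' t') ≤ (60 + 1568 * R) * d := by
  have hRd : 0 ≤ (R : ℝ) * d := by positivity
  rcases hle.eq_or_lt with heq | hlt
  · have := Φ.dist_le_of_floor_eq hR hd h heq.symm
    linarith
  obtain ⟨m, ε, hε, u, hu, hx, hΦ⟩ := exists_cell_of_point x t
  obtain ⟨m', ε', hε', u', hu', hx', hΦ'⟩ := exists_cell_of_point x' t'
  have h' := h
  rw [planeDist, hΦ, hΦ, hΦ', hΦ'] at h'
  have hc := Φ.close_cellPt hR hε hε' hu (sub_floor_mem t) hu' (sub_floor_mem t') hd h'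
  rcases le_or_gt (1 / 2) (2 * d) with hδ | hδ
  · have := hc.dist_le_coarse hε hε' hu hu' hx hx' hδ
    linarith
  have hfl : ⌊t'⌋ = ⌊t⌋ + 1 := by
    have h1 := hc.symm.level_le hε' hε hu' (sub_floor_mem t')
    have h2 : ((⌊t'⌋ : ℤ) : ℝ) < (⌊t⌋ + 2 : ℤ) := by push_cast; linarith
    have h3 : ⌊t'⌋ < ⌊t⌋ + 2 := by exact_mod_cast h2
    omega
  have hgap : 1 - (t - (⌊t⌋ : ℝ)) ≤ 2 * d := by
    have hy' := sub_floor_mem t'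
    rw [hfl] at hc hy'
    exact hc.next_level hε hε' hu (sub_floor_mem t) hu' hy'
  set t₁ : ℝ := ((⌊t⌋ + 1 : ℤ) : ℝ) with ht₁
  have hf₁ : ⌊t₁⌋ = ⌊t⌋ + 1 := Int.floor_intCast _
  have habs : |t₁ - t| ≤ 2 * d := by
    rw [ht₁, abs_of_nonneg] <;> push_cast
    · linarith
    · linarith [Int.lt_floor_add_one t]
  have hplane : Φ.planeDist x t₁ x' t' ≤ ENNReal.ofReal ((1 + 28 * R) * d) := by
    have key : ∀ c, edist (Φ.plane c x t₁) (Φ.plane c x' t') ≤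
        ENNReal.ofReal (14 * R * d) + edist (Φ.plane c x t) (Φ.plane c x' t') := by
      intro c
      refine (edist_triangle _ (Φ.plane c x t) _).trans (add_le_add ?_ le_rfl)
      refine (Φ.edist_plane_le_vertical c x t₁ t).trans ?_
      rw [← ENNReal.ofReal_natCast, ← ENNReal.ofReal_mul (Nat.cast_nonneg _)]
      refine ENNReal.ofReal_le_ofReal ?_
      push_cast
      nlinarith [mul_le_mul_of_nonneg_left habs (Nat.cast_nonneg (α := ℝ) R)]
    calc Φ.planeDist x t₁ x' t' ≤ _ := add_le_add (key 0) (key 1)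
      _ = ENNReal.ofReal (14 * R * d) + ENNReal.ofReal (14 * R * d) + Φ.planeDist x t x' t' := by
        rw [planeDist]; ring
      _ ≤ ENNReal.ofReal (14 * R * d) + ENNReal.ofReal (14 * R * d) + ENNReal.ofReal d :=
        add_le_add le_rfl h
      _ = _ := by
        rw [← ENNReal.ofReal_add (by linarith) (by linarith),
          ← ENNReal.ofReal_add (by linarith) hd]
        congr 1
        ring
  have h1 := Φ.dist_le_of_floor_eq hR (by positivity) hplane (by rw [hf₁, hfl])
  have h2 := dist_hpt_vertical x t t₁
  have h3 := dist_triangle (hpt x t) (hpt x t₁) (hpt x' t')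
  rw [abs_sub_comm] at h2
  linarith

theorem WordMap.dist_le (hR : 0 < R) {x t x' t' d : ℝ} (hd : 0 ≤ d)
    (h : Φ.planeDist x t x' t' ≤ ENNReal.ofReal d) :
    dist (hpt x t) (hpt x' t') ≤ (60 + 1568 * R) * d := by
  rcases le_total ⌊t⌋ ⌊t'⌋ with hle | hle
  · exact Φ.dist_le_of_floor_le hR hd h hle
  · rw [dist_comm]
    rw [Φ.planeDist_comm] at h
    exact Φ.dist_le_of_floor_le hR hd h hle

end

end TernaryForest

namespace TernaryForest

/-! ### The upper bound -/

theorem sq_le_of_cosh {d s h h' : ℝ} (hd : 0 ≤ d) (hh : 0 < h) (hh' : 0 < h')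
    (hcosh : Real.cosh d = 1 + (s ^ 2 + (h - h') ^ 2) / (2 * h * h')) :
    s ^ 2 ≤ h * h' * Real.exp d := by
  have h1 : Real.cosh d ≤ (Real.exp d + 1) / 2 := by
    rw [Real.cosh_eq]
    have := Real.exp_le_one_iff.2 (neg_nonpos.2 hd)
    linarith
  have h2 : (s ^ 2 + (h - h') ^ 2) / (2 * h * h') ≤ Real.exp d / 2 := by linarith
  rw [div_le_iff₀ (by positivity)] at h2
  nlinarith [sq_nonneg (h - h')]

/-- For small `d` a bound quadratic in `d` is needed; it comes from `cosh d ≤ exp (d ^ 2 / 2) ≤ 1 +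
d ^ 2`. -/
theorem sq_le_of_cosh_of_le {d s h h' : ℝ} (hd : 0 ≤ d) (hd1 : d ≤ 1) (hh : 0 < h) (hh' : 0 < h')
    (hcosh : Real.cosh d = 1 + (s ^ 2 + (h - h') ^ 2) / (2 * h * h')) :
    s ^ 2 ≤ 2 * d ^ 2 * (h * h') := by
  have h0 : d ^ 2 ≤ 1 := by nlinarith
  have h1 : Real.cosh d ≤ 1 + d ^ 2 := by
    refine (Real.cosh_le_exp_half_sq d).trans
      ((Real.exp_bound_div_one_sub_of_interval (by positivity) (by linarith)).trans ?_)
    rw [div_le_iff₀ (by linarith)]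
    nlinarith [sq_nonneg d]
  have h2 : (s ^ 2 + (h - h') ^ 2) / (2 * h * h') ≤ d ^ 2 := by linarith
  rw [div_le_iff₀ (by positivity)] at h2
  nlinarith [sq_nonneg (h - h')]

/-- The logarithmic height coordinate. -/
noncomputable def logHeight (h : ℝ) : ℝ := -Real.logb 3 h

theorem rpow_logHeight {h : ℝ} (hh : 0 < h) : (3 : ℝ) ^ logHeight h = h⁻¹ := by
  rw [logHeight, Real.rpow_neg (by norm_num), Real.rpow_logb (by norm_num) (by norm_num) hh]

theorem abs_logHeight_sub_add_le {h h' H d : ℝ} (hh : 0 < h) (hh' : 0 < h') (hH : h ≤ H)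
    (hH' : h' ≤ H) (hd : H ^ 2 ≤ h * h' * Real.exp d) :
    |logHeight h - logHeight H| + |logHeight H - logHeight h'| ≤ d := by
  have hH0 : 0 < H := hh.trans_le hH
  have h3 : (1 : ℝ) ≤ Real.log 3 := by
    rw [Real.le_log_iff_exp_le (by norm_num)]; exact Real.exp_one_lt_three.le
  have h1 := Real.log_le_log hh hH
  have h2 := Real.log_le_log hh' hH'
  have h4 := Real.log_le_log (by positivity) hd
  rw [Real.log_mul (by positivity) (Real.exp_pos d).ne', Real.log_mul hh.ne' hh'.ne', Real.log_exp,
    Real.log_pow] at h4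
  push_cast at h4
  have e : logHeight h - logHeight H = (Real.log H - Real.log h) / Real.log 3 := by
    rw [logHeight, logHeight, Real.logb, Real.logb]; ring
  have e' : logHeight H - logHeight h' = -((Real.log H - Real.log h') / Real.log 3) := by
    rw [logHeight, logHeight, Real.logb, Real.logb]; ring
  rw [e, e', abs_neg, abs_of_nonneg (div_nonneg (by linarith) (by linarith)),
    abs_of_nonneg (div_nonneg (by linarith) (by linarith)), ← add_div,
    div_le_iff₀ (by linarith)]
  have hd0 : 0 ≤ d := by linarith
  nlinarith

/-- Go up to height `H`, across, and down again. The vertical parts cost at most `7 * R * d`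
together, the horizontal one `12 * R * |x - x'| / H ≤ 24 * R * d`. -/
theorem WordMap.edist_plane_le {E : Type*} [PseudoEMetricSpace E] {R : ℕ} (Φ : WordMap E R) (c : ℤ)
    {d x x' h h' : ℝ} (hd : 0 ≤ d) (hh : 0 < h) (hh' : 0 < h')
    (hcosh : Real.cosh d = 1 + ((x - x') ^ 2 + (h - h') ^ 2) / (2 * h * h')) :
    edist (Φ.plane c x (logHeight h)) (Φ.plane c x' (logHeight h')) ≤
      (31 * R : ℕ) * ENNReal.ofReal d := by
  set H := max (max h h') |x - x'| with hHdef
  have hH : h ≤ H := (le_max_left _ _).trans (le_max_left _ _)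
  have hH' : h' ≤ H := (le_max_right _ _).trans (le_max_left _ _)
  have hHs : |x - x'| ≤ H := le_max_right _ _
  have hH0 : 0 < H := hh.trans_le hH
  have hs := sq_le_of_cosh hd hh hh' hcosh
  have hHsq : H ^ 2 ≤ h * h' * Real.exp d := by
    have key : ∀ h h' : ℝ, 0 < h → 0 < h' → h' ≤ h →
        Real.cosh d = 1 + ((x - x') ^ 2 + (h - h') ^ 2) / (2 * h * h') →
        h ^ 2 ≤ h * h' * Real.exp d := by
      intro h h' hh hh' hle hcosh
      have h1 : (h ^ 2 + h' ^ 2) / (2 * h * h') ≤ Real.cosh d := by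
        have e : 1 + ((x - x') ^ 2 + (h - h') ^ 2) / (2 * h * h') =
            (h ^ 2 + h' ^ 2) / (2 * h * h') + (x - x') ^ 2 / (2 * h * h') := by
          field_simp; ring
        rw [hcosh, e]
        have : 0 ≤ (x - x') ^ 2 / (2 * h * h') := by positivity
        linarith
      have h2 : (h ^ 2 + h' ^ 2) / (2 * h * h') = Real.cosh (Real.log (h / h')) := by
        rw [Real.cosh_log (by positivity)]
        field_simp
      have hlog : 0 ≤ Real.log (h / h') := Real.log_nonneg ((one_le_div hh').2 hle)
      rw [h2, Real.cosh_le_cosh, abs_of_nonneg hlog, abs_of_nonneg hd,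
        Real.log_le_iff_le_exp (by positivity), div_le_iff₀ hh'] at h1
      nlinarith
    rcases max_choice (max h h') |x - x'| with e | e
    · rcases max_choice h h' with e' | e'
      · rw [hHdef, e, e']
        exact key h h' hh hh' (max_eq_left_iff.1 e') hcosh
      · rw [hHdef, e, e', mul_comm h h']
        refine key h' h hh' hh (max_eq_right_iff.1 e') ?_
        rw [hcosh]
        congr 2
        · ring
        · ring
    · rw [hHdef, e, sq_abs]; exact hs
  have hratio : |x - x'| * H⁻¹ ≤ 2 * d := by
    rw [← div_eq_mul_inv, div_le_iff₀ hH0]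
    rcases le_or_gt (1 / 2) d with h1 | h1
    · nlinarith
    · have h2 := sq_le_of_cosh_of_le hd (by linarith) hh hh' hcosh
      refine abs_le_of_sq_le_sq ?_ (by positivity)
      have h3 : h * h' ≤ H * H := mul_le_mul hH hH' hh'.le hH0.le
      nlinarith [mul_le_mul_of_nonneg_left h3 (sq_nonneg d), sq_nonneg (d * H)]
  have hvert := abs_logHeight_sub_add_le hh hh' hH hH' hHsq
  set T := logHeight H
  have h1 := Φ.edist_plane_le_vertical c x (logHeight h) T
  have h2 := Φ.edist_plane_le_horizontal c x x' T
  have h3 := Φ.edist_plane_le_vertical c x' T (logHeight h')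
  rw [rpow_logHeight hH0] at h2
  refine (edist_triangle4 _ (Φ.plane c x T) (Φ.plane c x' T) _).trans
    ((add_le_add (add_le_add h1 h2) h3).trans ?_)
  simp only [← ENNReal.ofReal_natCast]
  rw [← ENNReal.ofReal_mul (Nat.cast_nonneg _), ← ENNReal.ofReal_mul (Nat.cast_nonneg _),
    ← ENNReal.ofReal_mul (Nat.cast_nonneg _), ← ENNReal.ofReal_mul (Nat.cast_nonneg _),
    ← ENNReal.ofReal_add (by positivity) (by positivity),
    ← ENNReal.ofReal_add (by positivity) (by positivity)]
  refine ENNReal.ofReal_le_ofReal ?_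
  push_cast
  have hR : (0 : ℝ) ≤ R := Nat.cast_nonneg R
  nlinarith [mul_le_mul_of_nonneg_left hvert hR, mul_le_mul_of_nonneg_left hratio hR]

/-! ### Hyperbolic space and the hyperbolic plane -/

/-- Follows from `cosh (x + y) ≥ cosh x * cosh y` for nonnegative arguments by expanding the product
of the `1 + b + a i`. The common term `b` must come from some factor, so `s` has to be nonempty. -/
theorem one_add_sum_le_cosh {ι : Type*} (s : Finset ι) (hs : s.Nonempty) {b : ℝ} (hb : 0 ≤ b)
    (a d : ι → ℝ) (ha : ∀ i, 0 ≤ a i) (hd : ∀ i, 0 ≤ d i)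
    (hcosh : ∀ i, Real.cosh (d i) = 1 + b + a i) :
    1 + b + ∑ i ∈ s, a i ≤ Real.cosh (∑ i ∈ s, d i) := by
  induction hs using Finset.Nonempty.cons_induction with
  | singleton i => simp [hcosh]
  | cons i s hi hs ih =>
    rw [Finset.sum_cons, Finset.sum_cons, Real.cosh_add]
    have h1 : 0 ≤ ∑ i ∈ s, a i := Finset.sum_nonneg fun i _ => ha i
    have h2 : 0 ≤ Real.sinh (d i) * Real.sinh (∑ i ∈ s, d i) :=
      mul_nonneg (Real.sinh_nonneg_iff.2 (hd i))
        (Real.sinh_nonneg_iff.2 (Finset.sum_nonneg fun i _ => hd i))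
    have h3 := mul_le_mul_of_nonneg_left ih (Real.cosh_pos (d i)).le
    rw [hcosh] at h3 ⊢
    nlinarith [mul_nonneg (ha i) h1, mul_nonneg hb h1, mul_nonneg hb (ha i), mul_nonneg hb hb]

/-- The distance of the projections of two points to the hyperbolic plane given by the `i`-th
horizontal coordinate. -/
noncomputable def coordDist {n : ℕ} (p q : HyperbolicSpace n) (i : Fin (n - 1)) : ℝ :=
  dist (hpt (p.horiz i) (logHeight p.height)) (hpt (q.horiz i) (logHeight q.height))

theorem cosh_coordDist {n : ℕ} (p q : HyperbolicSpace n) (i : Fin (n - 1)) :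
    Real.cosh (coordDist p q i) = 1 + ((p.horiz i - q.horiz i) ^ 2 +
      (p.height - q.height) ^ 2) / (2 * p.height * q.height) := by
  have e : ∀ p : HyperbolicSpace n, hpt (p.horiz i) (logHeight p.height) =
      ⟨⟨p.horiz i, p.height⟩, p.height_pos⟩ := by
    intro p
    have : (3 : ℝ) ^ (-logHeight p.height) = p.height := by
      rw [Real.rpow_neg (by norm_num), rpow_logHeight p.height_pos, inv_inv]
    simp only [hpt, this]
  rw [coordDist, e, e, UpperHalfPlane.cosh_dist]
  congr 2
  simp only [Complex.dist_eq, Complex.sq_norm, Complex.normSq_apply, Complex.sub_re,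
    Complex.sub_im]
  ring

theorem cosh_dist_eq {n : ℕ} (p q : HyperbolicSpace n) :
    Real.cosh (dist p q) = 1 + (∑ i, (p.horiz i - q.horiz i) ^ 2 +
      (p.height - q.height) ^ 2) / (2 * p.height * q.height) := by
  rw [HyperbolicSpace.dist_def, Real.cosh_arcosh
    (HyperbolicSpace.one_le_aux p.height_pos q.height_pos _), EuclideanSpace.norm_sq_eq]
  simp

theorem coordDist_le {n : ℕ} (p q : HyperbolicSpace n) (i : Fin (n - 1)) :
    coordDist p q i ≤ dist p q := by
  have hp := p.height_pos
  have hq := q.height_pos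
  have h0 : 0 ≤ coordDist p q i := dist_nonneg
  have h : Real.cosh (coordDist p q i) ≤ Real.cosh (dist p q) := by
    rw [cosh_coordDist, cosh_dist_eq]
    gcongr
    exact Finset.single_le_sum (f := fun i => (p.horiz i - q.horiz i) ^ 2)
      (fun i _ => sq_nonneg _) (Finset.mem_univ i)
  rwa [Real.cosh_le_cosh, abs_of_nonneg h0, abs_of_nonneg dist_nonneg] at h

/-- The projections share the height term while the horizontal squares add up, which is the
situation of `one_add_sum_le_cosh`; `2 ≤ n` provides at least one coordinate. -/
theorem dist_le_sum_coordDist {n : ℕ} (hn : 2 ≤ n) (p q : HyperbolicSpace n) :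
    dist p q ≤ ∑ i, coordDist p q i := by
  have hp := p.height_pos
  have hq := q.height_pos
  have : Nonempty (Fin (n - 1)) := ⟨⟨0, by omega⟩⟩
  have h0 : ∀ i, 0 ≤ coordDist p q i := fun i => dist_nonneg
  have h := one_add_sum_le_cosh (Finset.univ : Finset (Fin (n - 1))) Finset.univ_nonempty
    (b := (p.height - q.height) ^ 2 / (2 * p.height * q.height)) (by positivity)
    (fun i => (p.horiz i - q.horiz i) ^ 2 / (2 * p.height * q.height)) (coordDist p q)
    (fun i => by positivity) h0 (fun i => by rw [cosh_coordDist]; ring)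
  have h' : Real.cosh (dist p q) ≤ Real.cosh (∑ i, coordDist p q i) := by
    refine le_trans (le_of_eq ?_) h
    rw [cosh_dist_eq, ← Finset.sum_div]
    ring
  rwa [Real.cosh_le_cosh, abs_of_nonneg dist_nonneg,
    abs_of_nonneg (Finset.sum_nonneg fun i _ => h0 i)] at h'

/-! ### The embedding -/

section

variable {E : Type*} [PseudoEMetricSpace E] {R : ℕ} (Φ : WordMap E R)

/-- The map of hyperbolic space to a product of trees. -/
noncomputable def WordMap.embedding (n : ℕ) (p : HyperbolicSpace n) :
    PiLp 1 (fun _ : Fin (2 * (n - 1)) => E) :=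
  WithLp.toLp 1 fun j => Φ.plane (finProdFinEquiv.symm j).1.val
    (p.horiz (finProdFinEquiv.symm j).2) (logHeight p.height)

theorem WordMap.edist_embedding (n : ℕ) (p q : HyperbolicSpace n) :
    edist (Φ.embedding n p) (Φ.embedding n q) =
      ∑ i, Φ.planeDist (p.horiz i) (logHeight p.height) (q.horiz i) (logHeight q.height) := by
  rw [PiLp.edist_eq_sum (by norm_num)]
  simp only [ENNReal.toReal_one, ENNReal.rpow_one, div_one]
  rw [← finProdFinEquiv.sum_comp, Fintype.sum_prod_type, Fin.sum_univ_two,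
    ← Finset.sum_add_distrib]
  simp only [embedding, planeDist, Equiv.symm_apply_apply]
  rfl

theorem WordMap.planeDist_le {n : ℕ} (p q : HyperbolicSpace n) (i : Fin (n - 1)) :
    Φ.planeDist (p.horiz i) (logHeight p.height) (q.horiz i) (logHeight q.height) ≤
      (62 * R : ℕ) * edist p q := by
  have key : ∀ c, edist (Φ.plane c (p.horiz i) (logHeight p.height))
      (Φ.plane c (q.horiz i) (logHeight q.height)) ≤ (31 * R : ℕ) * edist p q := by
    intro c
    refine (Φ.edist_plane_le c (d := coordDist p q i) dist_nonneg p.height_pos q.height_pos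
      (cosh_coordDist p q i)).trans (mul_le_mul_right ?_ _)
    rw [edist_dist]
    exact ENNReal.ofReal_le_ofReal (coordDist_le p q i)
  refine (add_le_add (key 0) (key 1)).trans (le_of_eq ?_)
  push_cast
  ring

theorem WordMap.isBilipschitzEmbedding (hR : 0 < R) {n : ℕ} (hn : 2 ≤ n) :
    IsBilipschitzEmbedding (Φ.embedding n) := by
  have hlip : LipschitzWith ((n - 1 : ℕ) * (62 * R : ℕ) : ℝ≥0) (Φ.embedding n) := by
    intro p q
    rw [Φ.edist_embedding]
    refine (Finset.sum_le_card_nsmul _ _ _ fun i _ => Φ.planeDist_le p q i).trans (le_of_eq ?_)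
    rw [Finset.card_univ, Fintype.card_fin, nsmul_eq_mul, ← mul_assoc]
    push_cast
    rfl
  refine ⟨⟨_, hlip⟩, ((n - 1 : ℕ) * (60 + 1568 * R : ℕ) : ℝ≥0), fun p q => ?_⟩
  set D := edist (Φ.embedding n p) (Φ.embedding n q) with hD
  have hfin : D ≠ ⊤ := ((hlip p q).trans_lt
    (ENNReal.mul_lt_top ENNReal.coe_lt_top (edist_lt_top p q))).ne
  have hi : ∀ i, coordDist p q i ≤ (60 + 1568 * R) * D.toReal := by
    intro i
    refine Φ.dist_le hR ENNReal.toReal_nonneg ?_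
    rw [ENNReal.ofReal_toReal hfin, hD, Φ.edist_embedding]
    exact Finset.single_le_sum (f := fun i => Φ.planeDist (p.horiz i) (logHeight p.height)
      (q.horiz i) (logHeight q.height)) (fun _ _ => zero_le) (Finset.mem_univ i)
  have h1 : dist p q ≤ (n - 1 : ℕ) * ((60 + 1568 * R) * D.toReal) := by
    refine (dist_le_sum_coordDist hn p q).trans
      ((Finset.sum_le_card_nsmul _ _ _ fun i _ => hi i).trans (le_of_eq ?_))
    rw [Finset.card_univ, Fintype.card_fin, nsmul_eq_mul]
  rw [edist_dist]
  refine (ENNReal.ofReal_le_ofReal h1).trans (le_of_eq ?_)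
  rw [ENNReal.ofReal_mul (Nat.cast_nonneg _), ENNReal.ofReal_mul (by positivity),
    ENNReal.ofReal_toReal hfin, ← mul_assoc]
  congr 1
  rw [ENNReal.ofReal_natCast, show (60 + 1568 * R : ℝ) = ((60 + 1568 * R : ℕ) : ℝ) by push_cast; ring,
    ENNReal.ofReal_natCast]
  push_cast
  rfl

end

end TernaryForest

theorem corollary2 {V : Type*} (G : SimpleGraph V) (hG : G.IsTree) (t₀ : V)
    (hbranch : G.IsExponentiallyBranching t₀) (n : ℕ) (hn : 2 ≤ n) :
    ∃ ψ : HyperbolicSpace n → PiLp 1 (fun _ : Fin (2 * (n - 1)) => G.Realization),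
      IsBilipschitzEmbedding ψ := by
  obtain ⟨R, hR, P, h1, h2, h3, h4⟩ := hG.exists_wordMap t₀ hbranch
    (B := TernaryForest.base) (by norm_num)
  exact ⟨_, (⟨P, h1, h2, h3, h4⟩ : TernaryForest.WordMap G.Realization R).isBilipschitzEmbedding
    hR hn⟩
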